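/- **Setting.** Let $K$ be a global function field with exact field of constants $\mathbb F=\mathbb F_q$, $\infty$ a place of $K$ of degree $d_\infty$ over $\mathbb F$, $q_\infty=q^{d_\infty}$, $A\subset K$ the ring of elements regular away from $\infty$, $K_\infty$ the completion of $K$ at $\infty$, and $C_\infty$ the completed algebraic closure of $K_\infty$ with the absolute value normalized by $|\pi|^{-1}=q_\infty$, where $\pi\in K$ is a fixed uniformizer at $\infty$. Put $\log z=\log_q|z|\in\mathbb Q$ for $z\in C_\infty^*$. Fix $n$-th roots $\pi^{1/n}\in C_\infty$ of $\pi$ for all $n\ge 1$ with $(\pi^{1/n})^{n/m}=\pi^{1/m}$ for $m\mid n$; thus $\pi^x$ is defined for $x\in\mathbb Q$. For $z\in C_\infty^*$ let $\operatorname{sgn}(z)$ be the unique root of unity with $|\operatorname{sgn}(z)^{-1}z\pi^{\log z/d_\infty}-1|<1$, and let $\langle z\rangle=z\,\pi^{\log z/d_\infty}\operatorname{sgn}(z)^{-1}$, so that $z=\pi^{-\log z/d_\infty}\operatorname{sgn}(z)\langle z\rangle$. An $A$-lattice in $C_\infty$ is a finitely generated $A$-submodule of $C_\infty$ having finite intersection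 with each ball of finite radius. A lattice pair $\Lambda'|\Lambda$ of rank $r\ge 1$ consists of two $A$-lattices $\Lambda\subseteq\Lambda'$ of rank $r$. Sums $\sum'$ and products $\prod'$ run over nonzero elements only. For a lattice $\Lambda$, $u\in K\Lambda$ and $N\in\mathbb Q$ let $$e^\Lambda(z)=z\prod_{\lambda\in\Lambda}{}^{'}(1-z/\lambda),\qquad Z_{u,\Lambda}(S)=\sum_{\lambda\equiv u\,(\mathrm{mod}\ \Lambda)}{}^{'}S^{\log\lambda},\qquad U_{u,\Lambda}=\lim_{N\to\infty}\ \prod_{\substack{\lambda\equiv u\,(\mathrm{mod}\ \Lambda)\\ \log\lambda\le N}}{}^{'}\langle\lambda\rangle ,$$ $Z_\Lambda=Z_{0,\Lambda}$, $U_\Lambda=U_{0,\Lambda}$; $Z_{u,\Lambda}$ is a formal series in some $S^{1/n}$, and $Z'_{u,\Lambda}=\frac{d}{dS}Z_{u,\Lambda}$. For $u\in K\Lambda\smallsetminus\Lambda$ let $\varepsilon_u^\Lambda$ be the value, for all sufficiently large $N$, of $$\prod_{\substack{\lambda\equiv u\,(\mathrm{mod}\ \Lambda)\\ \log\lambda\le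 N}}\operatorname{sgn}(\lambda)\Big/\prod_{\substack{\lambda\in\Lambda\\ \log\lambda\le N}}{}^{'}\operatorname{sgn}(\lambda),$$ and for a lattice pair $\Lambda'|\Lambda$ let $\varepsilon^{\Lambda'|\Lambda}=\big(\prod'_{u\in\Lambda'/\Lambda}\varepsilon_u^\Lambda\big)^{-1}$. The discriminant $\Delta(\Lambda'|\Lambda)$ is the leading coefficient of the polynomial $\varphi\in C_\infty[X]$ which is $\mathbb F$-linear (only the exponents $1,q,q^2,\dots$ occur), has linear coefficient $1$ and degree $[\Lambda':\Lambda]$, and satisfies $e^{\Lambda'}=\varphi\circ e^\Lambda$. **Theorem.** Let $\Lambda'|\Lambda$ be a lattice pair of rank $r\ge1$ in $C_\infty$. (0) All objects above are well defined. For $M\in\{\Lambda,\Lambda'\}$ the product $e^M(z)$ converges for every $z\in C_\infty$. For $u\in KM$, $Z_{u,M}$ is a rational function in some $S^{1/n}$, regular at $S=1$, and the limit $U_{u,M}$ exists and satisfies $|U_{u,M}-1|<1$. For $u\in K\Lambda\smallsetminus\Lambda$ the quotient defining $\varepsilon_u^\Lambda$ is constant for large $N$. The elements $\varepsilon_u^\Lambda$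 and $\varepsilon^{\Lambda'|\Lambda}$ are roots of unity, and the polynomial $\varphi$ exists and is unique. (i) For $u\in K\Lambda\smallsetminus\Lambda$, $$e^\Lambda(u)=\pi^{-k}\,\varepsilon_u^\Lambda\,U_{u,\Lambda}\,U_\Lambda^{-1}\qquad\text{with } k=d_\infty^{-1}\big(Z'_{u,\Lambda}(1)-Z'_\Lambda(1)\big).$$ (ii) $$\Delta(\Lambda'|\Lambda)=\pi^{k}\,\varepsilon^{\Lambda'|\Lambda}\,U_\Lambda^{[\Lambda':\Lambda]}\,U_{\Lambda'}^{-1}\qquad\text{with } k=d_\infty^{-1}\big(Z'_{\Lambda'}(1)-[\Lambda':\Lambda]\,Z'_\Lambda(1)\big).$$ -/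

import Mathlib

open scoped IntermediateField

/-- `K` is a function field in one variable over `F` whose exact field of constants is `F`
(a global function field when `F` is finite). -/
class IsGlobalFunctionField (F K : Type*) [Field F] [Field K] [Algebra F K] : Prop where
  exists_finite : ∃ t : K, Transcendental F t ∧ FiniteDimensional F⟮t⟯ K
  constants : ∀ x : K, IsAlgebraic F x → x ∈ Set.range (algebraMap F K)

/-- A place of `K`, given by its normalized discrete valuation (written multiplicatively:
`v x = exp (-ord x)`). Over a finite field of constants every place of a function field is of this
kind, and the valuation is automatically trivial on the constants. -/
structure Place (K : Type*) [Field K] where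
  v : Valuation K (WithZero (Multiplicative ℤ))
  surjective : Function.Surjective v

namespace Place
variable {F K : Type*} [Field F] [Finite F] [Field K] [Algebra F K]
variable (P : Place K)

/-- The valuation ring of the place. -/
abbrev ring : ValuationSubring K := P.v.valuationSubring

theorem v_eq_one_of_pow {x : K} {n : ℕ} (hn : n ≠ 0) (h : x ^ n = 1) : P.v x = 1 := by
  have h1 : P.v x ^ n = 1 := by rw [← map_pow, h, map_one]
  exact (pow_eq_one_iff_of_nonneg zero_le hn).1 h1

theorem v_algebraMap_le (c : F) : P.v (algebraMap F K c) ≤ 1 := by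
  by_cases hc : c = 0
  · simp [hc]
  · have : Fintype F := Fintype.ofFinite F
    refine (P.v_eq_one_of_pow (n := Fintype.card F - 1) ?_ ?_).le
    · have := Fintype.one_lt_card (α := F); omega
    · rw [← map_pow, FiniteField.pow_card_sub_one_eq_one c hc, map_one]

/-- The constants lie in the valuation ring. -/
instance : Algebra F P.ring :=
  ((algebraMap F K).codRestrict P.ring.toSubring (fun c => P.v_algebraMap_le c)).toAlgebra

theorem coe_algebraMap (c : F) : ((algebraMap F P.ring c : P.ring) : K) = algebraMap F K c := rfl

instance : IsScalarTower F P.ring K := IsScalarTower.of_algebraMap_eq (fun _ => rfl)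

/-- The residue field of the place. -/
abbrev Residue := IsLocalRing.ResidueField P.ring

variable (F) in
/-- The degree of the place over the constants. -/
noncomputable def degree : ℕ := Module.finrank F P.Residue

end Place

open Polynomial in
theorem finite_adjoin_of_transcendental {F K : Type*} [Field F] [Field K] [Algebra F K]
    [IsGlobalFunctionField F K] {x : K} (hx : Transcendental F x) :
    FiniteDimensional F⟮x⟯ K := by
  obtain ⟨t, ht, hfin⟩ := IsGlobalFunctionField.exists_finite (F := F) (K := K)
  have h1 : Algebra.EssFiniteType F F⟮t⟯ := by
    rw [IntermediateField.essFiniteType_iff]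
    exact IntermediateField.fg_adjoin_of_finite (Set.finite_singleton t)
  have h2 : Algebra.EssFiniteType F K := Algebra.EssFiniteType.comp F F⟮t⟯ K
  have h3 : Algebra.EssFiniteType F⟮x⟯ K := Algebra.EssFiniteType.of_comp F F⟮x⟯ K
  have halg : Algebra.IsAlgebraic F⟮t⟯ K := inferInstance
  have h4 : Algebra.IsAlgebraic (Algebra.adjoin F {t}) K := by
    open scoped IntermediateField.algebraAdjoinAdjoin in
    exact IsFractionRing.comap_isAlgebraic_iff (K := F⟮t⟯) |>.2 halg
  have h5 : Algebra.trdeg F K ≤ 1 := by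
    simpa using Algebra.IsAlgebraic.trdeg_le_cardinalMk F ({t} : Set K)
  have h6 : AlgebraicIndependent F (fun _ : Unit => x) :=
    (algebraicIndependent_unique_type_iff (ι := Unit)).2 hx
  have h7 := (h6.isTranscendenceBasis_of_lift_trdeg_le_of_finite (by simpa using h5)).isAlgebraic_field
  rw [Set.range_const] at h7
  exact Algebra.finite_of_essFiniteType_of_isAlgebraic

namespace Place
variable {F K : Type*} [Field F] [Finite F] [Field K] [Algebra F K]
variable (P : Place K)

theorem transcendental_of_v_lt {x : K} (h0 : x ≠ 0) (h : P.v x < 1) : Transcendental F x := by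
  intro hx
  have := hx.isIntegral
  obtain ⟨n, hn, h1⟩ : ∃ n : ℕ, n ≠ 0 ∧ x ^ n = 1 := by
    have : FiniteDimensional F F⟮x⟯ := IntermediateField.adjoin.finiteDimensional this
    have : Finite F⟮x⟯ := Module.finite_of_finite F
    have : Fintype F⟮x⟯ := Fintype.ofFinite _
    refine ⟨Fintype.card F⟮x⟯ - 1, ?_, ?_⟩
    · have := Fintype.one_lt_card (α := F⟮x⟯); omega
    · have h2 := FiniteField.pow_card_sub_one_eq_one (IntermediateField.AdjoinSimple.gen F x)
        (by intro h; apply h0; simpa using congrArg (algebraMap F⟮x⟯ K) h)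
      simpa using congrArg (algebraMap F⟮x⟯ K) h2
  exact h.ne (P.v_eq_one_of_pow hn h1)

open Polynomial in
theorem residue_aeval {x : P.ring} (hx : IsLocalRing.residue P.ring x = 0) (p : F[X]) :
    IsLocalRing.residue P.ring (aeval x p) = algebraMap F P.Residue (p.coeff 0) := by
  have : IsLocalRing.residue P.ring (aeval x p) = aeval (IsLocalRing.residue P.ring x) p := by
    simp [Polynomial.aeval_def, Polynomial.hom_eval₂]
    rfl
  rw [this, hx, ← coeff_zero_eq_aeval_zero']

open Polynomial in
theorem poly_indep {x : P.ring} (hx0 : x ≠ 0) (hx : IsLocalRing.residue P.ring x = 0)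
    {ι : Type*} [Fintype ι] (b : ι → P.ring)
    (hb : LinearIndependent F (fun i => IsLocalRing.residue P.ring (b i))) (n : ℕ) :
    ∀ p : ι → F[X], (∀ i, (p i).natDegree ≤ n) → ∑ i, aeval x (p i) * b i = 0 → ∀ i, p i = 0 := by
  induction n with
  | zero =>
    intro p hp hs i
    have h := congrArg (IsLocalRing.residue P.ring) hs
    simp only [map_sum, map_mul, map_zero, P.residue_aeval hx, ← Algebra.smul_def] at h
    have := Fintype.linearIndependent_iff.1 hb _ h i
    rw [Polynomial.eq_C_of_natDegree_le_zero (hp i), this, map_zero]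
  | succ n ih =>
    intro p hp hs i
    have h := congrArg (IsLocalRing.residue P.ring) hs
    simp only [map_sum, map_mul, map_zero, P.residue_aeval hx, ← Algebra.smul_def] at h
    have h0 := Fintype.linearIndependent_iff.1 hb _ h
    have hX : ∀ i, p i = (p i).divX * X := fun i => by
      conv_lhs => rw [← divX_mul_X_add (p i), h0 i, map_zero, add_zero]
    have hs' : ∑ i, aeval x ((p i).divX) * b i = 0 := by
      apply mul_left_cancel₀ hx0
      rw [mul_zero, ← hs, Finset.mul_sum]
      refine Finset.sum_congr rfl fun i _ => ?_
      conv_rhs => rw [hX i]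
      simp only [map_mul, aeval_X]; ring
    have := ih (fun i => (p i).divX) (fun i => by
      rw [natDegree_divX_eq_natDegree_tsub_one]; have := hp i; omega) hs' i
    rw [hX i, this, zero_mul]

open Polynomial in
instance finite_residue [IsGlobalFunctionField F K] : Module.Finite F P.Residue := by
  obtain ⟨x, hx⟩ := P.surjective (WithZero.exp (-1))
  have hlt : P.v x < 1 := by rw [hx, ← WithZero.exp_zero, WithZero.exp_lt_exp]; norm_num
  have h0 : x ≠ 0 := by rintro rfl; rw [map_zero] at hx; exact WithZero.exp_ne_zero hx.symm
  have htr : Transcendental F x := P.transcendental_of_v_lt h0 hlt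
  have hfin := finite_adjoin_of_transcendental (F := F) htr
  let y : P.ring := ⟨x, hlt.le⟩
  have hy : IsLocalRing.residue P.ring y = 0 := by
    rw [IsLocalRing.residue_eq_zero_iff]
    exact (Valuation.mem_maximalIdeal_iff ..).2 hlt
  have hy0 : y ≠ 0 := fun h => h0 (congrArg Subtype.val h)
  rw [← Module.rank_lt_aleph0_iff]
  refine lt_of_le_of_lt (b := ((Module.finrank F⟮x⟯ K : ℕ) : Cardinal)) (rank_le ?_) (Cardinal.natCast_lt_aleph0)
  intro s hs
  let b : s → P.ring := fun i => (IsLocalRing.residue_surjective (i : P.Residue)).choose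
  have hb : ∀ i, IsLocalRing.residue P.ring (b i) = i := fun i => 
    (IsLocalRing.residue_surjective (i : P.Residue)).choose_spec
  have hs' : LinearIndependent F (fun i => IsLocalRing.residue P.ring (b i)) := by
    simpa [hb] using hs
  have key : LinearIndependent F⟮x⟯ (fun i => (b i : K)) := by
    open scoped IntermediateField.algebraAdjoinAdjoin in
    rw [← LinearIndependent.iff_fractionRing (Algebra.adjoin F {x}) F⟮x⟯, Fintype.linearIndependent_iff]
    intro g hg
    have : ∀ i, ∃ p : F[X], aeval x p = (g i : K) := fun i => by
      exact (Algebra.adjoin_singleton_eq_range_aeval F x).le (g i).2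
    choose p hp using this
    have hpy : ∀ i, ((aeval y (p i) : P.ring) : K) = aeval x (p i) := fun i => by
      exact (Polynomial.aeval_algebraMap_apply K y (p i)).symm
    have hz := P.poly_indep hy0 hy b hs' (Finset.univ.sup fun i => (p i).natDegree) p
      (fun i => Finset.le_sup (f := fun i => (p i).natDegree) (Finset.mem_univ i)) (by
        apply Subtype.ext
        simp only [Algebra.smul_def] at hg
        push_cast
        simp only [hpy, hp]
        exact hg)
    intro i
    apply Subtype.ext
    rw [← hp i, hz i]; simp
  simpa using key.fintype_card_le_finrank

theorem degree_pos [IsGlobalFunctionField F K] : 0 < P.degree F := Module.finrank_pos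

end Place

noncomputable section
namespace Place
open scoped NNReal
variable (F : Type*) {K : Type*} [Field F] [Finite F] [Field K] [Algebra F K]
  [IsGlobalFunctionField F K] (P : Place K)

/-- The cardinality `q ^ d` of the residue field, `d` the degree of the place. -/
def qInf : ℕ := Nat.card F ^ P.degree F

theorem one_lt_qInf : 1 < P.qInf F :=
  Nat.one_lt_pow P.degree_pos.ne' Finite.one_lt_card

theorem one_lt_qInf_nnreal : (1 : ℝ≥0) < P.qInf F := by exact_mod_cast P.one_lt_qInf F

/-- The normalized absolute value: a uniformizer has absolute value `1 / q ^ d`. -/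
def abv : AbsoluteValue K ℝ where
  toFun x := WithZeroMulInt.toNNReal (P.one_lt_qInf_nnreal F).ne_zero (P.v x)
  map_mul' x y := by simp
  nonneg' x := NNReal.coe_nonneg _
  eq_zero' x := by simp
  add_le' x y := by
    have hm := (WithZeroMulInt.toNNReal_strictMono (P.one_lt_qInf_nnreal F)).monotone
    have h := hm (P.v.map_add x y)
    rw [hm.map_max] at h
    exact_mod_cast h.trans (max_le_add_of_nonneg zero_le zero_le)

theorem abv_add_le_max (x y : K) : P.abv F (x + y) ≤ max (P.abv F x) (P.abv F y) := by
  have hm := (WithZeroMulInt.toNNReal_strictMono (P.one_lt_qInf_nnreal F)).monotone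
  have h := hm (P.v.map_add x y)
  rw [hm.map_max] at h
  exact_mod_cast h

theorem abv_of_v_eq_exp {x : K} {n : ℤ} (h : P.v x = WithZero.exp n) :
    P.abv F x = (P.qInf F : ℝ) ^ n := by
  change ((WithZeroMulInt.toNNReal (P.one_lt_qInf_nnreal F).ne_zero (P.v x) : ℝ≥0) : ℝ) = _
  rw [h, WithZeroMulInt.toNNReal_neg_apply _ WithZero.exp_ne_zero]
  push_cast
  rfl

/-- The completion of `K` at the place. -/
abbrev KInf : Type _ := (P.abv F).Completion

instance : IsUltrametricDist (WithAbs (P.abv F)) :=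
  IsUltrametricDist.isUltrametricDist_of_forall_norm_add_le_max_norm fun x y =>
    P.abv_add_le_max F x.ofAbs y.ofAbs

theorem ultra_completion {E : Type*} [NormedField E] [IsUltrametricDist E] :
    IsUltrametricDist (UniformSpace.Completion E) := by
  refine IsUltrametricDist.isUltrametricDist_of_forall_norm_add_le_max_norm fun x y => ?_
  induction x, y using UniformSpace.Completion.induction_on₂ with
  | hp => exact isClosed_le (by fun_prop) (by fun_prop)
  | ih a b =>
    rw [← UniformSpace.Completion.coe_add, UniformSpace.Completion.norm_coe,
      UniformSpace.Completion.norm_coe, UniformSpace.Completion.norm_coe]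
    exact IsUltrametricDist.norm_add_le_max a b

instance : IsUltrametricDist (P.KInf F) := ultra_completion

instance : NontriviallyNormedField (P.KInf F) where
  non_trivial := by
    obtain ⟨x, hx⟩ := P.surjective (WithZero.exp 1)
    refine ⟨((WithAbs.toAbs (P.abv F) x : WithAbs (P.abv F)) : P.KInf F), ?_⟩
    rw [UniformSpace.Completion.norm_coe, WithAbs.norm_toAbs_eq, P.abv_of_v_eq_exp F hx, zpow_one]
    exact_mod_cast P.one_lt_qInf F

/-- An algebraic closure of the completion, with the unique extension of the absolute value. -/
abbrev AlgCl : Type _ := AlgebraicClosure (P.KInf F)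

instance : NormedField (P.AlgCl F) := spectralNorm.normedField (P.KInf F) (P.AlgCl F)

instance : IsUltrametricDist (P.AlgCl F) :=
  IsUltrametricDist.isUltrametricDist_of_forall_norm_add_le_max_norm
    (isNonarchimedean_spectralNorm (K := P.KInf F) (L := P.AlgCl F))

/-- The completed algebraic closure of the completion of `K` at the place. -/
def CInf : Type _ := UniformSpace.Completion (P.AlgCl F)

instance : NormedField (P.CInf F) := inferInstanceAs (NormedField (UniformSpace.Completion (P.AlgCl F)))
instance : CompleteSpace (P.CInf F) := inferInstanceAs (CompleteSpace (UniformSpace.Completion (P.AlgCl F)))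
instance : IsUltrametricDist (P.CInf F) := ultra_completion (E := P.AlgCl F)

def algClToCInf : P.AlgCl F →+* P.CInf F := UniformSpace.Completion.coeRingHom

def toCInf : K →+* P.CInf F :=
  (P.algClToCInf F).comp <| (algebraMap (P.KInf F) (P.AlgCl F)).comp <|
    (UniformSpace.Completion.coeRingHom (α := WithAbs (P.abv F))).comp
      (WithAbs.equiv (P.abv F)).symm.toRingHom

/-- The canonical embedding of `K`. -/
instance : Algebra K (P.CInf F) := (P.toCInf F).toAlgebra

theorem norm_algClToCInf (x : P.AlgCl F) : ‖P.algClToCInf F x‖ = ‖x‖ :=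
  UniformSpace.Completion.norm_coe x

theorem norm_algebraMap (x : K) : ‖algebraMap K (P.CInf F) x‖ = P.abv F x := by
  change ‖P.algClToCInf F (algebraMap (P.KInf F) (P.AlgCl F) ((WithAbs.toAbs (P.abv F) x : WithAbs (P.abv F)) : P.KInf F))‖ = _
  rw [norm_algClToCInf]
  refine (spectralNorm_extends (L := P.AlgCl F) _).trans ?_
  rw [UniformSpace.Completion.norm_coe, WithAbs.norm_toAbs_eq]

theorem norm_KInf {x : P.KInf F} (hx : x ≠ 0) : ∃ n : ℤ, ‖x‖ = (P.qInf F : ℝ) ^ n := by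
  obtain ⟨y, hy⟩ := (UniformSpace.Completion.denseRange_coe (α := WithAbs (P.abv F))).exists_dist_lt x (norm_pos_iff.2 hx)
  have h1 : ‖x‖ = ‖(y : P.KInf F)‖ := by
    have : ‖(y : P.KInf F) - x‖ < ‖x‖ := by rwa [← dist_eq_norm, dist_comm]
    have h2 := IsUltrametricDist.norm_add_eq_max_of_norm_ne_norm (x := (y : P.KInf F) - x) (y := x) this.ne
    rw [sub_add_cancel, max_eq_right this.le] at h2
    exact h2.symm
  have hy0 : P.v y.ofAbs ≠ 0 := by
    intro h
    have : y = 0 := WithAbs.ofAbs_injective _ (by simpa using h)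
    exact hx (norm_eq_zero.1 (by rw [h1, this]; simp))
  refine ⟨WithZero.log (P.v y.ofAbs), ?_⟩
  rw [h1, UniformSpace.Completion.norm_coe, WithAbs.norm_eq_apply_ofAbs]
  exact P.abv_of_v_eq_exp F (WithZero.exp_log hy0).symm

theorem exists_norm_eq_rpow {z : P.CInf F} (hz : z ≠ 0) :
    ∃ x : ℚ, ‖z‖ = (Nat.card F : ℝ) ^ (x : ℝ) := by
  obtain ⟨y, hy⟩ := (UniformSpace.Completion.denseRange_coe (α := P.AlgCl F)).exists_dist_lt z (norm_pos_iff.2 hz)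
  have h1 : ‖z‖ = ‖y‖ := by
    have : ‖P.algClToCInf F y - z‖ < ‖z‖ := by rw [← dist_eq_norm, dist_comm]; exact hy
    have h2 := IsUltrametricDist.norm_add_eq_max_of_norm_ne_norm (x := P.algClToCInf F y - z) (y := z) this.ne
    rw [sub_add_cancel, max_eq_right this.le] at h2
    rw [← h2, norm_algClToCInf]
  have hy0 : y ≠ 0 := by
    rintro rfl
    exact hz (norm_eq_zero.1 (h1.trans norm_zero))
  have h2 : ‖y‖ = _ := spectralNorm.spectralNorm_eq_norm_coeff_zero_rpow (P.KInf F) (P.AlgCl F) y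
  obtain ⟨n, hn⟩ := P.norm_KInf F (minpoly.coeff_zero_ne_zero (Algebra.IsIntegral.isIntegral (R := P.KInf F) y) hy0)
  refine ⟨P.degree F * n * (1 / (minpoly (P.KInf F) y).natDegree), ?_⟩
  rw [h1, h2, hn]
  have hq : (0:ℝ) ≤ Nat.card F := by positivity
  push_cast
  rw [Real.rpow_mul hq, Real.rpow_mul hq, qInf]
  push_cast
  rw [Real.rpow_natCast, Real.rpow_intCast]

open Classical in
/-- `log z = log_q |z|`, a rational number for `z ≠ 0` (the value at `0` is never used). -/
def logq (z : P.CInf F) : ℚ :=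
  if h : z ≠ 0 then (P.exists_norm_eq_rpow F h).choose else 0

variable {F P} in
theorem norm_eq_rpow_logq {z : P.CInf F} (hz : z ≠ 0) :
    ‖z‖ = (Nat.card F : ℝ) ^ (P.logq F z : ℝ) := by
  rw [logq, dif_pos hz]
  exact (P.exists_norm_eq_rpow F hz).choose_spec

/-- The ring of elements of `K` that are regular away from the fixed place. -/
def coeffRing : Subalgebra F K where
  carrier := {x | ∀ Q : Place K, Q ≠ P → Q.v x ≤ 1}
  mul_mem' hx hy Q hQ := by
    rw [map_mul]
    exact mul_le_one' (hx Q hQ) (hy Q hQ)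
  add_mem' hx hy Q hQ := (Q.v.map_add _ _).trans (max_le (hx Q hQ) (hy Q hQ))
  algebraMap_mem' c Q _ := Q.v_algebraMap_le c

/-- A lattice: a finitely generated submodule of `CInf` over the ring `A = coeffRing` which meets
each ball in a finite set. -/
structure Lattice where
  carrier : Submodule (P.coeffRing F) (P.CInf F)
  fg : carrier.FG
  discrete : ∀ R : ℝ, {z | z ∈ carrier ∧ ‖z‖ ≤ R}.Finite

/-- A compatible system of `n`-th roots of `π` in `CInf`, for all `n ≥ 1` (`root 0` is not used). -/
structure RootSystem (π : K) where
  root : ℕ → P.CInf F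
  root_pow : ∀ n, 0 < n → root n ^ n = algebraMap K (P.CInf F) π
  compatible : ∀ m n, 0 < n → m ∣ n → root n ^ (n / m) = root m

namespace RootSystem
variable {F P} {π : K} (ϖ : P.RootSystem F π)

/-- The power `π ^ x` for rational `x`. -/
def rpow (x : ℚ) : P.CInf F := ϖ.root x.den ^ x.num

/-- The part `z * π ^ (log z / d)` of absolute value one of `z ≠ 0`. -/
def absUnit (z : P.CInf F) : P.CInf F := z * ϖ.rpow (P.logq F z / P.degree F)

open Classical in
/-- The root of unity that is congruent to `z * π ^ (log z / d)` modulo the valuation ideal. -/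
def sgn (z : P.CInf F) : P.CInf F :=
  if h : ∃ ζ : P.CInf F, (∃ n : ℕ, 0 < n ∧ ζ ^ n = 1) ∧ ‖ζ⁻¹ * ϖ.absUnit z - 1‖ < 1
  then h.choose else 1

/-- The one-unit part `z * π ^ (log z / d) * (sgn z)⁻¹` of `z ≠ 0`. -/
def oneUnit (z : P.CInf F) : P.CInf F := ϖ.absUnit z * (ϖ.sgn z)⁻¹

end RootSystem

/-- The value of an eventually constant function on `ℚ`. -/
def eventualValue {X : Type*} [Nonempty X] (f : ℚ → X) : X :=
  Classical.epsilon fun a => ∀ᶠ N in Filter.atTop, f N = a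

/-- A finitely supported `p` stands for the finite sum `∑ p x * S ^ x`, a Laurent polynomial in some
`S ^ (1 / n)`; this is its value at `S = 1`. -/
def valueAtOne (p : ℚ →₀ ℤ) : ℤ := p.sum fun _ c => c

/-- The value at `S = 1` of the derivative with respect to `S` of `∑ p x * S ^ x`. -/
def derivAtOne (p : ℚ →₀ ℤ) : ℚ := p.sum fun x c => c * x

/-- The series `f` in rational powers of `S` is a rational function `p / s` in some `S ^ (1 / n)`, with
`s` not vanishing at `S = 1`, and its derivative with respect to `S` at `S = 1` is `D`. Here `D` is
determined by `f` and does not depend on the choice of `p` and `s`. -/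
def IsRationalWithDerivAtOne (f : HahnSeries ℚ ℤ) (D : ℚ) : Prop :=
  ∃ p s : ℚ →₀ ℤ, valueAtOne s ≠ 0 ∧
    f * HahnSeries.ofFinsupp s = HahnSeries.ofFinsupp p ∧
    D = (derivAtOne p * valueAtOne s - valueAtOne p * derivAtOne s) / (valueAtOne s : ℚ) ^ 2

namespace Lattice
variable {F P} (Λ Λ' : P.Lattice F)

/-- The rank of the lattice as a module over `coeffRing`. -/
def rank : ℕ := Module.finrank (P.coeffRing F) Λ.carrier

/-- The `K`-subspace `K Λ` of `CInf` generated by the lattice. -/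
def kSpan : Submodule K (P.CInf F) := Submodule.span K (Λ.carrier : Set (P.CInf F))

/-- The nonzero elements that are congruent to `u` modulo the lattice. -/
def coset (u : P.CInf F) : Set (P.CInf F) := {z | z - u ∈ Λ.carrier ∧ z ≠ 0}

/-- The nonzero elements `z` congruent to `u` modulo the lattice with `log z ≤ N`. -/
def cosetLE (u : P.CInf F) (N : ℚ) : Set (P.CInf F) := {z | z ∈ Λ.coset u ∧ P.logq F z ≤ N}

theorem cosetLE_finite (u : P.CInf F) (N : ℚ) : (Λ.cosetLE u N).Finite := by
  refine ((Λ.discrete ((Nat.card F : ℝ) ^ (N : ℝ) + ‖u‖)).image (· + u)).subset ?_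
  rintro z ⟨⟨hz, h0⟩, hN⟩
  refine ⟨z - u, ⟨hz, (norm_sub_le _ _).trans ?_⟩, sub_add_cancel _ _⟩
  gcongr
  rw [norm_eq_rpow_logq h0]
  gcongr
  · exact_mod_cast Finite.one_lt_card.le

/-- The `Z`-function `∑ S ^ (log z)`, the sum over the nonzero `z` congruent to `u` modulo the lattice,
as a formal series in rational powers of `S` with integer coefficients. -/
def Z (u : P.CInf F) : HahnSeries ℚ ℤ where
  coeff x := {z | z ∈ Λ.coset u ∧ P.logq F z = x}.ncard
  isPWO_support' := by
    rw [Set.isPWO_iff_isWF, Set.isWF_iff_no_descending_seq]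
    intro f hf hs
    have hfin : (Set.range f).Finite := by
      refine ((Λ.cosetLE_finite u (f 0)).image (P.logq F)).subset ?_
      rintro _ ⟨n, rfl⟩
      have h : ({z | z ∈ Λ.coset u ∧ P.logq F z = f n}.ncard : ℤ) ≠ 0 := hs n
      obtain ⟨z, hz, hzn⟩ := Set.nonempty_of_ncard_ne_zero (by exact_mod_cast h)
      exact ⟨z, ⟨hz, hzn.trans_le (hf.antitone (Nat.zero_le n))⟩, hzn⟩
    exact Set.infinite_range_of_injective hf.injective hfin

open Classical in
/-- The derivative at `S = 1` of the rational function `Z`. -/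
def ZDeriv (u : P.CInf F) : ℚ :=
  if h : ∃ D, IsRationalWithDerivAtOne (Λ.Z u) D then h.choose else 0

/-- The exponential function `z * ∏ (1 - z / l)` of the lattice, `l` running through its nonzero
elements. -/
def exp (z : P.CInf F) : P.CInf F :=
  z * ∏' l : {l : P.CInf F // l ∈ Λ.carrier ∧ l ≠ 0}, (1 - z / l)

variable {π : K} (ϖ : P.RootSystem F π)

/-- The product of the one-unit parts of the nonzero `z ≡ u` with `log z ≤ N`. -/
def partialU (u : P.CInf F) (N : ℚ) : P.CInf F := ∏ᶠ z ∈ Λ.cosetLE u N, ϖ.oneUnit z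

/-- The limit for `N → ∞` of the products of one-unit parts. The invariant of the lattice itself is
`U 0`. -/
def U (u : P.CInf F) : P.CInf F := Filter.limUnder Filter.atTop (Λ.partialU ϖ u)

/-- The product of the `sgn z` over the nonzero `z ≡ u` with `log z ≤ N`, divided by the product of
the `sgn l` over the nonzero lattice elements `l` with `log l ≤ N`. -/
def partialEps (u : P.CInf F) (N : ℚ) : P.CInf F :=
  (∏ᶠ z ∈ Λ.cosetLE u N, ϖ.sgn z) / ∏ᶠ z ∈ Λ.cosetLE 0 N, ϖ.sgn z

/-- The value of `partialEps` for all sufficiently large `N`. -/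
def eps (u : P.CInf F) : P.CInf F := eventualValue (Λ.partialEps ϖ u)

/-- The index of `Λ` in `Λ'` (for `Λ ⊆ Λ'`). -/
def index : ℕ := Λ.carrier.toAddSubgroup.relIndex Λ'.carrier.toAddSubgroup

/-- The inverse of the product of the `eps u` over the nonzero classes `u` in `Λ' / Λ`. -/
def pairEps : P.CInf F :=
  (∏ᶠ (x : Λ'.carrier ⧸ Λ.carrier.submoduleOf Λ'.carrier) (_ : x ≠ 0),
    Λ.eps ϖ (x.out : Λ'.carrier))⁻¹

/-- `φ` is an `𝔽_q`-linear polynomial with linear coefficient `1`, of degree the index of `Λ` in `Λ'`,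
such that `exp_Λ' = φ ∘ exp_Λ`. -/
structure IsNormalizedIsogeny (φ : Polynomial (P.CInf F)) : Prop where
  linear : ∀ i, φ.coeff i ≠ 0 → ∃ j : ℕ, i = Nat.card F ^ j
  coeff_one : φ.coeff 1 = 1
  natDegree : φ.natDegree = Λ.index Λ'
  exp_eq : ∀ z, Λ'.exp z = φ.eval (Λ.exp z)

open Classical in
/-- The leading coefficient of the normalized isogeny from `Λ` to `Λ'`. -/
def discriminant : P.CInf F :=
  if h : ∃ φ, Λ.IsNormalizedIsogeny Λ' φ then h.choose.leadingCoeff else 0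

end Lattice
end Place
end

/-! For `u` outside `Λ` and `log u ≤ N`, the elements `λ ≡ u` with `log λ ≤ N` are the translates by
`u` of the finite `F`-space of lattice points of `log` at most `N`. Hence the partial product of
`e^Λ(u)` is the product of these `λ` divided by the product of the nonzero lattice points of `log`
at most `N` (`partialExp_of_notMem`). Writing each factor as a power of `π`, a root of unity and a
one-unit splits the quotient into three parts.

Translation by `u` matches the elements of `Λ` and of `u + Λ` of absolute value above `|u|`, and it
preserves `log` and `sgn`. So the quotient of the signs is constant for large `N`
(`partialEps_eq_of_le`), and `Z_u - Z_0` is a finite sum whose derivative at `S = 1` gives the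
exponent of `π` (`Z_eq_add`, `ZDeriv_sub_ZDeriv_zero`). Only the one-units need a limit. It exists
because a shell of large elements is a union of translates of a finite `F`-space `V`: the product
over `z + V` is `⟨z⟩ ^ |V|` up to small errors, and `|V|` is a power of `q`, so its distance to `1`
is at most `|⟨z⟩ - 1| ^ |V|` or the size of the errors. This is uniformly small once `|⟨z⟩ - 1|` is
bounded away from `1` on the coset (`exists_bound_oneUnit_coset`, `norm_prod_oneUnit_sub_one_le`).

The bound on one-units and the rationality of `Z` both come from self-similarity: for `a` in `A`
with `|a| > 1`, the lattice is a finite disjoint union of sets `ρ i + a Λ`, and the shift `ρ i` does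
not affect the absolute value of large elements.

For a pair, the zeros of `φ` are the values of `e^Λ` on `Λ'`, and normalizing the linear coefficient
makes the leading coefficient the inverse of the product of `e^Λ(u)` over the nonzero classes `u` of
`Λ'/Λ`. Inserting the formula for each `e^Λ(u)`, and splitting `Λ'` into cosets of `Λ` in `Z` and
`U`, gives the discriminant. -/

section Ultrametric
-- Ultrametric estimates and infinite products
variable {C : Type*} [NormedField C] [IsUltrametricDist C]

theorem norm_eq_one_of_norm_sub_one_lt {x : C} (h : ‖x - 1‖ < 1) : ‖x‖ = 1 := by
  have h2 := IsUltrametricDist.norm_add_eq_max_of_norm_ne_norm (x := x - 1) (y := 1)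
    (by rw [norm_one]; exact h.ne)
  rwa [sub_add_cancel, norm_one, max_eq_right h.le] at h2

theorem norm_sub_le_max (x y : C) : ‖x - y‖ ≤ max ‖x‖ ‖y‖ := by
  rw [sub_eq_add_neg, ← norm_neg y]
  exact IsUltrametricDist.norm_add_le_max _ _

theorem norm_add_eq_right_of_lt {x y : C} (h : ‖x‖ < ‖y‖) : ‖x + y‖ = ‖y‖ := by
  rw [IsUltrametricDist.norm_add_eq_max_of_norm_ne_norm h.ne, max_eq_right h.le]

theorem norm_mul_sub_one_le {x y : C} {ε : ℝ} (h1 : ε ≤ 1) (hx : ‖x - 1‖ ≤ ε) (hy : ‖y - 1‖ ≤ ε) :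
    ‖x * y - 1‖ ≤ ε := by
  have hy1 : ‖y‖ ≤ 1 := by
    have := IsUltrametricDist.norm_add_le_max (y - 1) 1
    rw [sub_add_cancel, norm_one] at this
    exact this.trans (max_le (hy.trans h1) le_rfl)
  have : x * y - 1 = (x - 1) * y + (y - 1) := by ring
  rw [this]
  refine (IsUltrametricDist.norm_add_le_max _ _).trans (max_le ?_ hy)
  rw [norm_mul]
  exact (mul_le_of_le_one_right (norm_nonneg _) hy1).trans hx

/-- Closed balls around `1` of radius at most `1` are closed under multiplication, so the bound does
not deteriorate with the number of factors. -/
theorem norm_prod_sub_one_le {ι : Type*} (s : Finset ι) (x : ι → C) {ε : ℝ} (h0 : 0 ≤ ε) (h1 : ε ≤ 1)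
    (h : ∀ i ∈ s, ‖x i - 1‖ ≤ ε) : ‖∏ i ∈ s, x i - 1‖ ≤ ε := by
  classical
  induction s using Finset.induction_on with
  | empty => simpa using h0
  | insert i s hi ih =>
    rw [Finset.prod_insert hi]
    exact norm_mul_sub_one_le h1 (h i (Finset.mem_insert_self i s))
      (ih fun j hj => h j (Finset.mem_insert_of_mem hj))

theorem norm_inv_sub_one {x : C} (h : ‖x - 1‖ < 1) : ‖x⁻¹ - 1‖ = ‖x - 1‖ := by
  have hx := norm_eq_one_of_norm_sub_one_lt h
  have hx0 : x ≠ 0 := norm_pos_iff.1 (by rw [hx]; exact one_pos)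
  have : x⁻¹ - 1 = -(x - 1) * x⁻¹ := by field_simp; ring
  rw [this, norm_mul, norm_neg, norm_inv, hx, inv_one, mul_one]

/-- In a complete ultrametric field `∏ (1 + f i)` converges as soon as `f` tends to zero. -/
theorem multipliable_one_add_of_tendsto_cofinite [CompleteSpace C] {ι : Type*} {f : ι → C}
    (hf : Filter.Tendsto f Filter.cofinite (nhds 0)) : Multipliable fun i => 1 + f i := by
  classical
  have hfin : ∀ ε : ℝ, 0 < ε → ∃ s : Finset ι, ∀ i, i ∉ s → ‖f i‖ < ε := by
    intro ε hε
    have := (Metric.tendsto_nhds.1 hf) ε hε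
    rw [Filter.eventually_cofinite] at this
    refine ⟨this.toFinset, fun i hi => ?_⟩
    simpa using hi
  have hsub : ∀ ε : ℝ, 0 < ε → ε ≤ 1 → ∀ s : Finset ι, (∀ i, i ∉ s → ‖f i‖ < ε) → ∀ t, s ⊆ t →
      ‖∏ i ∈ t, (1 + f i) - ∏ i ∈ s, (1 + f i)‖ ≤ ‖∏ i ∈ s, (1 + f i)‖ * ε := by
    intro ε hε hε1 s hs t hst
    rw [← Finset.prod_sdiff hst]
    have : ∀ a b : C, a * b - b = b * (a - 1) := fun a b => by ring
    rw [this, norm_mul]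
    gcongr
    refine norm_prod_sub_one_le _ _ hε.le hε1 fun i hi => ?_
    rw [add_sub_cancel_left]
    exact (hs i (Finset.mem_sdiff.1 hi).2).le
  obtain ⟨s0, hs0⟩ := hfin 1 one_pos
  -- Factors indexed outside `s0` are one-units, so `B` bounds every partial product that contains
  -- `s0`, even if finitely many factors are large or zero.
  set B := ‖∏ i ∈ s0, (1 + f i)‖ with hB
  have hbound : ∀ t, s0 ⊆ t → ‖∏ i ∈ t, (1 + f i)‖ ≤ B := by
    intro t ht
    have h1 := hsub 1 one_pos le_rfl s0 hs0 t ht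
    rw [← sub_add_cancel (∏ i ∈ t, (1 + f i)) (∏ i ∈ s0, (1 + f i))]
    refine (IsUltrametricDist.norm_add_le_max _ _).trans (max_le ?_ le_rfl)
    rwa [mul_one] at h1
  have hB0 : 0 ≤ B := norm_nonneg _
  have hc : CauchySeq fun s : Finset ι => ∏ i ∈ s, (1 + f i) := by
    rw [Metric.cauchySeq_iff']
    intro ε hε
    -- The choice makes `B * η < ε`; the `+ 1` covers `B = 0`.
    set η := min 1 (ε / (B + 1)) with hη
    have hη0 : 0 < η := by positivity
    obtain ⟨s1, hs1⟩ := hfin η hη0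
    refine ⟨s0 ∪ s1, fun t ht => ?_⟩
    rw [dist_eq_norm]
    refine (hsub η hη0 (min_le_left _ _) (s0 ∪ s1)
      (fun i hi => hs1 i fun h => hi (Finset.mem_union_right _ h)) t ht).trans_lt ?_
    calc _ ≤ B * (ε / (B + 1)) := by
          gcongr
          · exact hbound _ Finset.subset_union_left
          · exact min_le_right _ _
      _ < ε := by
          rw [mul_div_assoc', div_lt_iff₀ (by positivity)]
          nlinarith
  obtain ⟨a, ha⟩ := cauchySeq_tendsto_of_complete hc
  exact ⟨a, by simpa [HasProd] using ha⟩

end Ultrametric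

/-! ### Linearized polynomials -/

section Linearized
open Polynomial
variable (F : Type*) {C : Type*} [Field F] [Finite F] [Field C] [Algebra F C]

theorem add_pow_natCard_pow (j : ℕ) (x y : C) :
    (x + y) ^ Nat.card F ^ j = x ^ Nat.card F ^ j + y ^ Nat.card F ^ j := by
  have := Fintype.ofFinite F
  rw [Nat.card_eq_fintype_card]
  have h : ∀ z : C, ((FiniteField.frobeniusAlgHom F C) ^ j) z = z ^ Fintype.card F ^ j := by
    intro z
    rw [AlgHom.coe_pow, FiniteField.coe_frobeniusAlgHom, pow_iterate]
  rw [← h, ← h, ← h, map_add]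

theorem smul_pow_natCard_pow (j : ℕ) (c : F) (x : C) :
    (c • x) ^ Nat.card F ^ j = c • x ^ Nat.card F ^ j := by
  have := Fintype.ofFinite F
  rw [_root_.smul_pow, Nat.card_eq_fintype_card, FiniteField.pow_card_pow]

theorem sub_pow_natCard_pow (j : ℕ) (x y : C) :
    (x - y) ^ Nat.card F ^ j = x ^ Nat.card F ^ j - y ^ Nat.card F ^ j := by
  have := add_pow_natCard_pow F j (x - y) y
  rw [sub_add_cancel] at this
  rw [this, add_sub_cancel_right]

/-- Only the exponents `1, q, q ^ 2, …` occur in the polynomial. -/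
def IsLinearized (f : C[X]) : Prop := ∀ i, f.coeff i ≠ 0 → ∃ j : ℕ, i = Nat.card F ^ j

variable {F}

/-- The linear map defined by a linearized polynomial. -/
def IsLinearized.toLinearMap {f : C[X]} (hf : IsLinearized F f) : C →ₗ[F] C where
  toFun x := f.eval x
  map_add' x y := by
    simp only [eval_eq_sum, Polynomial.sum, ← Finset.sum_add_distrib]
    refine Finset.sum_congr rfl fun i hi => ?_
    obtain ⟨j, rfl⟩ := hf i (mem_support_iff.1 hi)
    rw [add_pow_natCard_pow, mul_add]
  map_smul' c x := by
    simp only [eval_eq_sum, Polynomial.sum, RingHom.id_apply, Finset.smul_sum]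
    refine Finset.sum_congr rfl fun i hi => ?_
    obtain ⟨j, rfl⟩ := hf i (mem_support_iff.1 hi)
    rw [smul_pow_natCard_pow, mul_smul_comm]

theorem IsLinearized.toLinearMap_apply {f : C[X]} (hf : IsLinearized F f) (x : C) :
    hf.toLinearMap x = f.eval x := rfl

/-- The monic polynomial whose roots are the elements of a finite subspace is linearized. -/
theorem isLinearized_prod_X_sub_C (V : Submodule F C) [Fintype V] :
    IsLinearized F (∏ v : V, (X - Polynomial.C (v : C))) := by
  classical
  have : Fintype F := Fintype.ofFinite F
  have hq1 : 1 < Nat.card F := Finite.one_lt_card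
  set n := Module.finrank F V with hn
  let b := Module.finBasis F V
  have hcard : Fintype.card V = Nat.card F ^ n := by
    rw [Nat.card_eq_fintype_card, Module.card_eq_pow_finrank (K := F)]
  -- The linearized polynomials with exponents below `q ^ n`, parametrized by their `n`
  -- coefficients; the product will turn out to be `X ^ q ^ n + g a` for some `a`.
  let g : (Fin n → C) → C[X] := fun a => ∑ j, Polynomial.C (a j) * X ^ Nat.card F ^ (j : ℕ)
  have hinj : Function.Injective fun j : ℕ => Nat.card F ^ j := Nat.pow_right_injective hq1
  have hgl : ∀ a, IsLinearized F (g a) := by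
    intro a i hi
    by_contra! hc
    apply hi
    simp only [g, finsetSum_coeff, coeff_C_mul, coeff_X_pow]
    exact Finset.sum_eq_zero fun j _ => by rw [if_neg (hc j), mul_zero]
  have hgd : ∀ a, (g a).degree < (Nat.card F ^ n : ℕ) := by
    intro a
    rw [Polynomial.degree_lt_iff_coeff_zero]
    intro m hm
    simp only [g, finsetSum_coeff, coeff_C_mul, coeff_X_pow]
    refine Finset.sum_eq_zero fun j _ => ?_
    rw [if_neg, mul_zero]
    have := Nat.pow_lt_pow_right hq1 j.2
    omega
  have hvan : ∀ f : C[X], IsLinearized F f → (∀ i, f.eval (b i : C) = 0) → ∀ v ∈ V, f.eval v = 0 := by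
    intro f hf h v hv
    have h1 : hf.toLinearMap ∘ₗ V.subtype = 0 := b.ext fun i => h i
    exact LinearMap.congr_fun h1 ⟨v, hv⟩
  have hzero : ∀ f : C[X], f.degree < (Nat.card F ^ n : ℕ) → (∀ v ∈ V, f.eval v = 0) → f = 0 := by
    intro f hd h
    refine Polynomial.eq_zero_of_degree_lt_of_eval_index_eq_zero (s := (Finset.univ : Finset V))
      (v := fun v : V => (v : C)) Subtype.val_injective.injOn ?_ fun v _ => h v v.2
    rwa [Finset.card_univ, hcard]
  -- Evaluation at a basis of `V`, given by the Moore matrix. It is injective because a linearized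
  -- polynomial vanishing on the basis vanishes on all `q ^ n` elements of `V`, which exceeds its
  -- degree; hence it is also surjective.
  let T : (Fin n → C) →ₗ[C] (Fin n → C) :=
    { toFun := fun a i => (g a).eval (b i : C)
      map_add' := fun a a' => by
        ext i; simp [g, eval_finsetSum, add_mul, Finset.sum_add_distrib]
      map_smul' := fun c a => by
        ext i; simp [g, eval_finsetSum, Finset.mul_sum, mul_assoc] }
  have hT : Function.Injective T := by
    rw [injective_iff_map_eq_zero]
    intro a ha
    have h0 : g a = 0 := hzero _ (hgd a) (hvan _ (hgl a) fun i => congrFun ha i)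
    ext j
    have := congrArg (fun p => p.coeff (Nat.card F ^ (j : ℕ))) h0
    simp only [g, finsetSum_coeff, coeff_C_mul, coeff_X_pow, coeff_zero] at this
    rw [Finset.sum_eq_single j] at this
    · simpa using this
    · intro i _ hij
      rw [if_neg, mul_zero]
      exact fun h => hij (Fin.ext (hinj h)).symm
    · simp
  obtain ⟨a, ha⟩ := LinearMap.injective_iff_surjective.1 hT fun i => -(b i : C) ^ Nat.card F ^ n
  have hf : IsLinearized F (X ^ Nat.card F ^ n + g a) := by
    intro i hi
    by_cases h : i = Nat.card F ^ n
    · exact ⟨n, h⟩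
    · rw [coeff_add, coeff_X_pow, if_neg h, zero_add] at hi
      exact hgl a i hi
  have hroot := hvan _ hf fun i => by
    have := congrFun ha i
    change (g a).eval (b i : C) = _ at this
    rw [eval_add, this]; simp
  -- Both sides are monic of degree `q ^ n` and vanish on `V`, so their difference has more zeros
  -- than its degree allows.
  have hprod : (∏ v : V, (X - Polynomial.C (v : C))) = X ^ Nat.card F ^ n + g a := by
    rw [← sub_eq_zero]
    apply hzero
    · have h1 : (∏ v : V, (X - Polynomial.C (v : C))).Monic := monic_prod_X_sub_C _ _
      have hd1 : (∏ v : V, (X - Polynomial.C (v : C))).degree = ((Nat.card F ^ n : ℕ) : WithBot ℕ) := by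
        rw [degree_prod, ← hcard]; simp
      have h2 : (X ^ Nat.card F ^ n + g a).Monic := monic_X_pow_add (hgd a)
      have hd2 : (X ^ Nat.card F ^ n + g a).degree = ((Nat.card F ^ n : ℕ) : WithBot ℕ) := by
        rw [degree_add_eq_left_of_degree_lt] <;> rw [degree_X_pow]
        exact hgd a
      rw [← hd1]
      exact degree_sub_lt_left (hd1.trans hd2.symm) h1.ne_zero (h1.leadingCoeff.trans h2.leadingCoeff.symm)
    · intro v hv
      rw [eval_sub, hroot v hv, sub_zero, eval_prod]
      exact Finset.prod_eq_zero (Finset.mem_univ ⟨v, hv⟩) (by simp)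
  rwa [hprod]

end Linearized

/-! ### Teichmüller representatives -/

section Teichmuller
open Polynomial Filter
variable (F : Type*) {L : Type*} [Field F] [Finite F]

/-- An element algebraic over a finite field generates a finite field, on which a power of Frobenius
is the identity. -/
theorem exists_pow_natCard_pow_eq_self [Field L] [Algebra F L] {x : L} (hx : IsIntegral F x) :
    ∃ m : ℕ, 0 < m ∧ x ^ Nat.card F ^ m = x := by
  have : FiniteDimensional F F⟮x⟯ := IntermediateField.adjoin.finiteDimensional hx
  have : Finite F⟮x⟯ := Module.finite_of_finite F
  have : Fintype F⟮x⟯ := Fintype.ofFinite _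
  refine ⟨Module.finrank F F⟮x⟯, Module.finrank_pos, ?_⟩
  have h := FiniteField.pow_card (IntermediateField.AdjoinSimple.gen F x)
  rw [← Nat.card_eq_fintype_card, Module.natCard_eq_pow_finrank (K := F)] at h
  simpa using congrArg (algebraMap F⟮x⟯ L) h

variable [NormedField L] [Algebra F L]

theorem norm_algebraMap_finite {c : F} (hc : c ≠ 0) : ‖algebraMap F L c‖ = 1 := by
  have : Fintype F := Fintype.ofFinite F
  have h1 := FiniteField.pow_card_sub_one_eq_one c hc
  have h2 : ‖algebraMap F L c‖ ^ (Fintype.card F - 1) = 1 := by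
    rw [← norm_pow, ← map_pow, h1, map_one, norm_one]
  refine (pow_eq_one_iff_of_nonneg (norm_nonneg _) ?_).1 h2
  have := Fintype.one_lt_card (α := F); omega

theorem norm_smul_finite {c : F} (hc : c ≠ 0) (x : L) : ‖c • x‖ = ‖x‖ := by
  rw [Algebra.smul_def, norm_mul, norm_algebraMap_finite F hc, one_mul]

/-- A root of unity in the open ball of radius one around `1` is `1`. -/
theorem eq_one_of_norm_sub_one_lt (F : Type*) {L : Type*} [Field F] [Finite F] [NormedField L]
    [Algebra F L] {η : L} {n : ℕ} (hn : 0 < n) (h : η ^ n = 1) (h1 : ‖η - 1‖ < 1) :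
    η = 1 := by
  have hint : IsIntegral F η := by
    refine ⟨X ^ n - Polynomial.C 1, monic_X_pow_sub_C 1 hn.ne', by simp [h]⟩
  obtain ⟨m, hm, hη⟩ := exists_pow_natCard_pow_eq_self F hint
  by_contra hne
  -- Additivity of Frobenius makes `η - 1` a fixed point as well, which is impossible for a nonzero
  -- element of absolute value below `1`.
  have h2 : (η - 1) ^ Nat.card F ^ m = η - 1 := by rw [sub_pow_natCard_pow, one_pow, hη]
  have h3 : ‖η - 1‖ ^ Nat.card F ^ m < ‖η - 1‖ :=
    pow_lt_self_of_lt_one₀ (norm_pos_iff.2 (sub_ne_zero.2 hne)) h1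
      (Nat.one_lt_pow hm.ne' Finite.one_lt_card)
  rw [← norm_pow, h2] at h3
  exact h3.false

variable [IsUltrametricDist L]

/-- If the coefficients of a monic polynomial are modulo the valuation ideal in a finite field, so is
every root. -/
theorem exists_norm_pow_sub_lt_of_root {p : L[X]} (hp : p.Monic) {N : ℕ} (hN : 1 < N)
    (h1 : ∀ i, ‖p.coeff i‖ ≤ 1) (h2 : ∀ i, ‖p.coeff i ^ N - p.coeff i‖ < 1) {y : L}
    (hy : p.eval y = 0) (hy1 : ‖y‖ ≤ 1) :
    ∃ m : ℕ, 0 < m ∧ ‖y ^ Nat.card F ^ m - y‖ < 1 := by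
  let S : ValuationSubring L := (NormedField.valuation (K := L)).valuationSubring
  have hS : ∀ x : L, x ∈ S ↔ ‖x‖ ≤ 1 := fun x => by
    change ‖x‖₊ ≤ 1 ↔ _
    exact NNReal.coe_le_coe
  have hmax : ∀ x : S, IsLocalRing.residue S x = 0 ↔ ‖(x : L)‖ < 1 := fun x => by
    rw [IsLocalRing.residue_eq_zero_iff]
    exact (Valuation.mem_maximalIdeal_iff ..).trans (NNReal.coe_lt_coe (r₁ := ‖(x : L)‖₊) (r₂ := 1)).symm
  let f : F →+* S := (algebraMap F L).codRestrict S.toSubring fun c => by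
    refine (hS _).2 ?_
    by_cases hc : c = 0
    · simp [hc]
    · exact (norm_algebraMap_finite F hc).le
  let k := IsLocalRing.ResidueField S
  let : Algebra F k := ((IsLocalRing.residue S).comp f).toAlgebra
  let pS : S[X] := p.toSubring S.toSubring (by
    intro c hc
    obtain ⟨i, -, rfl⟩ := mem_coeffs_iff.1 hc
    exact (hS _).2 (h1 i))
  have hpS : pS.Monic := (monic_toSubring _ _ _).2 hp
  let yS : S := ⟨y, (hS y).2 hy1⟩
  have hroot : pS.eval yS = 0 := by
    apply Subtype.ext
    have : pS.map S.subtype = p := map_toSubring p S.toSubring _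
    have h := hy
    rw [← this, eval_map] at h
    exact (eval₂_at_apply S.subtype yS).symm.trans h
  let pk : k[X] := pS.map (IsLocalRing.residue S)
  -- In the residue field the coefficients are zeros of `X ^ N - X`, hence algebraic over `F`. By
  -- transitivity of integrality so is the residue of the root, and it lies in a finite field.
  have hpk : ∀ i, pk.coeff i ∈ integralClosure F k := by
    intro i
    have h2' := h2 i
    refine ⟨X ^ N - X, monic_X_pow_sub ?_, ?_⟩
    · rw [degree_X]; exact_mod_cast hN
    · have : pk.coeff i ^ N - pk.coeff i = 0 := by
        simp only [pk, coeff_map, ← map_pow, ← map_sub]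
        refine (hmax _).2 ?_
        have h3 : ((pS.coeff i : S) : L) = p.coeff i := coeff_toSubring p S.toSubring _
        rw [← h3] at h2'
        exact h2'
      simpa using this
  have hint : IsIntegral F (IsLocalRing.residue S yS) := by
    have : IsIntegral (integralClosure F k) (IsLocalRing.residue S yS) := by
      refine ⟨pk.toSubring (integralClosure F k).toSubring ?_, (monic_toSubring _ _ _).2 (hpS.map _), ?_⟩
      · intro c hc
        obtain ⟨i, -, rfl⟩ := mem_coeffs_iff.1 hc
        exact hpk i
      · have h3 : eval (IsLocalRing.residue S yS) pk = 0 := by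
          rw [eval_map, eval₂_at_apply, hroot, map_zero]
        rw [← map_toSubring pk (integralClosure F k).toSubring (by
          intro c hc
          obtain ⟨i, -, rfl⟩ := mem_coeffs_iff.1 hc
          exact hpk i), eval_map] at h3
        exact h3
    exact isIntegral_trans _ this
  obtain ⟨m, hm, h⟩ := exists_pow_natCard_pow_eq_self F hint
  refine ⟨m, hm, ?_⟩
  rw [← map_pow, ← sub_eq_zero, ← map_sub] at h
  exact (hmax _).1 h

/-- The Teichmüller representative. -/
theorem exists_rootOfUnity_norm_sub_lt [CompleteSpace L] {z : L} (hz : ‖z‖ = 1) {m : ℕ} (hm : 0 < m)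
    (h : ‖z ^ Nat.card F ^ m - z‖ < 1) :
    ∃ ζ : L, (∃ n : ℕ, 0 < n ∧ ζ ^ n = 1) ∧ ‖ζ⁻¹ * z - 1‖ < 1 := by
  set Q := Nat.card F ^ m with hQ
  have hQ1 : 1 < Q := Nat.one_lt_pow hm.ne' Finite.one_lt_card
  set r := ‖z ^ Q - z‖ with hr
  -- Successive differences are `(z ^ Q - z) ^ Q ^ k`, so the sequence converges to a fixed point of
  -- the `Q`-th power map within distance `r` of `z`.
  let w : ℕ → L := fun k => z ^ Q ^ k
  have hstep : ∀ k, ‖w (k + 1) - w k‖ = r ^ Q ^ k := by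
    intro k
    rw [hr, ← norm_pow, hQ, ← pow_mul, sub_pow_natCard_pow, ← pow_mul]
    simp only [w, hQ, ← pow_mul, ← pow_add]
    congr 4
    ring
  have hr0 : 0 ≤ r := norm_nonneg _
  have hcau : CauchySeq w := by
    refine NonarchimedeanAddGroup.cauchySeq_of_tendsto_sub_nhds_zero ?_
    rw [tendsto_zero_iff_norm_tendsto_zero]
    simp only [hstep]
    exact (tendsto_pow_atTop_nhds_zero_of_lt_one hr0 h).comp
      (tendsto_pow_atTop_atTop_of_one_lt hQ1)
  obtain ⟨ζ, hζ⟩ := cauchySeq_tendsto_of_complete hcau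
  have hζQ : ζ ^ Q = ζ := by
    refine tendsto_nhds_unique ?_ ((tendsto_add_atTop_iff_nat 1).2 hζ)
    convert hζ.pow Q using 2 with k
    simp only [w, ← pow_mul, pow_succ]
  have hle : ∀ k, ‖w k - z‖ ≤ r := by
    intro k
    induction k with
    | zero => simp [w, hr0]
    | succ k ih =>
      rw [← sub_add_sub_cancel (w (k + 1)) (w k) z]
      refine (IsUltrametricDist.norm_add_le_max _ _).trans (max_le ?_ ih)
      rw [hstep]
      exact pow_le_of_le_one hr0 h.le (pow_pos (zero_lt_one.trans hQ1) k).ne'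
  have hlim : ‖ζ - z‖ ≤ r :=
    le_of_tendsto ((hζ.sub_const z).norm) (Eventually.of_forall hle)
  have hζ1 : ‖ζ‖ = 1 := by
    rw [← sub_add_cancel ζ z, norm_add_eq_right_of_lt (by rw [hz]; exact hlim.trans_lt h), hz]
  have hζ0 : ζ ≠ 0 := norm_pos_iff.1 (by rw [hζ1]; exact one_pos)
  refine ⟨ζ, ⟨Q - 1, by omega, ?_⟩, ?_⟩
  · apply mul_right_cancel₀ hζ0
    rw [one_mul, ← pow_succ, Nat.sub_add_cancel hQ1.le, hζQ]
  · have : ζ⁻¹ * z - 1 = -(ζ⁻¹ * (ζ - z)) := by field_simp; ring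
    rw [this, norm_neg, norm_mul, norm_inv, hζ1, inv_one, one_mul]
    exact hlim.trans_lt h

end Teichmuller

/-! ### Roots of unity, `sgn` and one-units in `CInf` -/

noncomputable section
namespace Place
open scoped NNReal
section
variable (F : Type*) {K : Type*} [Field F] [Finite F] [Field K] [Algebra F K]
  [IsGlobalFunctionField F K] (P : Place K)

instance : Algebra F (P.CInf F) := ((algebraMap K (P.CInf F)).comp (algebraMap F K)).toAlgebra

instance : IsScalarTower F K (P.CInf F) := IsScalarTower.of_algebraMap_eq fun _ => rfl

instance : IsScalarTower F (P.coeffRing F) (P.CInf F) := IsScalarTower.of_algebraMap_eq fun _ => rfl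

theorem abv_le_one_iff {x : K} : P.abv F x ≤ 1 ↔ P.v x ≤ 1 := by
  have hm := WithZeroMulInt.toNNReal_strictMono (P.one_lt_qInf_nnreal F)
  have h := hm.le_iff_le (a := P.v x) (b := 1)
  rw [map_one] at h
  rw [← h]
  exact NNReal.coe_le_coe (r₂ := 1)

theorem abv_lt_one_iff {x : K} : P.abv F x < 1 ↔ P.v x < 1 := by
  have hm := WithZeroMulInt.toNNReal_strictMono (P.one_lt_qInf_nnreal F)
  have h := hm.lt_iff_lt (a := P.v x) (b := 1)
  rw [map_one] at h
  rw [← h]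
  exact NNReal.coe_lt_coe (r₂ := 1)

theorem abv_pow_qInf_sub_lt {x : K} (hx : P.abv F x ≤ 1) : P.abv F (x ^ P.qInf F - x) < 1 := by
  have hx' := (P.abv_le_one_iff F).1 hx
  rw [abv_lt_one_iff]
  let y : P.ring := ⟨x, hx'⟩
  have : Finite P.Residue := Module.finite_of_finite F
  have : Fintype P.Residue := Fintype.ofFinite _
  have hcard : Fintype.card P.Residue = P.qInf F := by
    rw [← Nat.card_eq_fintype_card, Module.natCard_eq_pow_finrank (K := F)]
    rfl
  have h := FiniteField.pow_card (IsLocalRing.residue P.ring y)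
  rw [hcard, ← map_pow, ← sub_eq_zero, ← map_sub, IsLocalRing.residue_eq_zero_iff] at h
  exact (Valuation.mem_maximalIdeal_iff ..).1 h

/-- The embedding of the completion of `K` at the place. -/
def kInfToCInf : P.KInf F →+* P.CInf F := (P.algClToCInf F).comp (algebraMap (P.KInf F) (P.AlgCl F))

theorem norm_kInfToCInf (x : P.KInf F) : ‖P.kInfToCInf F x‖ = ‖x‖ :=
  (P.norm_algClToCInf F _).trans (spectralNorm_extends (L := P.AlgCl F) x)

/-- The map `c ↦ c ^ q_∞ - c` is additive and contracts the open unit ball into itself, so `c` may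
be replaced by a nearby element of `K`, where the residue field has `q_∞` elements. -/
theorem norm_kInf_pow_qInf_sub_lt {c : P.KInf F} (hc : ‖c‖ ≤ 1) :
    ‖P.kInfToCInf F c ^ P.qInf F - P.kInfToCInf F c‖ < 1 := by
  obtain ⟨y, hy⟩ := (UniformSpace.Completion.denseRange_coe
    (α := WithAbs (P.abv F))).exists_dist_lt c one_pos
  set x : K := y.ofAbs with hx
  have hyx : P.kInfToCInf F (y : P.KInf F) = algebraMap K (P.CInf F) x := rfl
  have h1 : ‖P.kInfToCInf F c - algebraMap K (P.CInf F) x‖ < 1 := by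
    rw [← hyx, ← map_sub, norm_kInfToCInf, ← dist_eq_norm]
    exact hy
  have h2 : P.abv F x ≤ 1 := by
    rw [← norm_algebraMap, ← sub_sub_cancel (P.kInfToCInf F c) (algebraMap K (P.CInf F) x)]
    refine (norm_sub_le_max _ _).trans (max_le ?_ h1.le)
    rwa [norm_kInfToCInf]
  have h3 : ‖algebraMap K (P.CInf F) x ^ P.qInf F - algebraMap K (P.CInf F) x‖ < 1 := by
    rw [← map_pow, ← map_sub, norm_algebraMap]
    exact P.abv_pow_qInf_sub_lt F h2
  set a := P.kInfToCInf F c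
  set b := algebraMap K (P.CInf F) x
  have h4 : a ^ P.qInf F - a = ((a - b) ^ P.qInf F - (a - b)) + (b ^ P.qInf F - b) := by
    rw [qInf, sub_pow_natCard_pow]; ring
  rw [h4]
  refine (IsUltrametricDist.norm_add_le_max _ _).trans_lt (max_lt ?_ h3)
  refine (norm_sub_le_max _ _).trans_lt (max_lt ?_ h1)
  rw [norm_pow]
  exact pow_lt_one₀ (norm_nonneg _) h1 (zero_lt_one.trans (P.one_lt_qInf F)).ne'

/-- By density and additivity of Frobenius one may pass to a nearby algebraic element `y`. The
spectral norm of `y` is at most one, so its minimal polynomial has integral coefficients, whose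
residues lie in the finite residue field of the place. -/
theorem exists_norm_pow_natCard_pow_sub_lt {z : P.CInf F} (hz : ‖z‖ = 1) :
    ∃ m : ℕ, 0 < m ∧ ‖z ^ Nat.card F ^ m - z‖ < 1 := by
  obtain ⟨y, hy⟩ := (UniformSpace.Completion.denseRange_coe (α := P.AlgCl F)).exists_dist_lt z one_pos
  replace hy : ‖z - P.algClToCInf F y‖ < 1 := by rw [← dist_eq_norm]; exact hy
  have hy1 : ‖P.algClToCInf F y‖ ≤ 1 := by
    rw [← sub_sub_cancel z (P.algClToCInf F y)]
    exact (norm_sub_le_max _ _).trans (max_le hz.le hy.le)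
  have hint := Algebra.IsIntegral.isIntegral (R := P.KInf F) y
  have hmon := minpoly.monic hint
  have hcoeff : ∀ i, ‖(minpoly (P.KInf F) y).coeff i‖ ≤ 1 := by
    refine (spectralValue_le_one_iff hmon).1 ?_
    rw [norm_algClToCInf] at hy1
    exact hy1
  obtain ⟨m, hm, h⟩ := exists_norm_pow_sub_lt_of_root F (y := P.algClToCInf F y)
    (p := (minpoly (P.KInf F) y).map (P.kInfToCInf F)) (hmon.map _)
    (N := P.qInf F) (P.one_lt_qInf F)
    (fun i => by rw [Polynomial.coeff_map, norm_kInfToCInf]; exact hcoeff i)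
    (fun i => by rw [Polynomial.coeff_map]; exact P.norm_kInf_pow_qInf_sub_lt F (hcoeff i))
    (by
      rw [Polynomial.eval_map, kInfToCInf, ← Polynomial.hom_eval₂, ← Polynomial.aeval_def,
        minpoly.aeval, map_zero])
    hy1
  refine ⟨m, hm, ?_⟩
  set a := P.algClToCInf F y
  have h4 : z ^ Nat.card F ^ m - z = ((z - a) ^ Nat.card F ^ m - (z - a)) + (a ^ Nat.card F ^ m - a) := by
    rw [sub_pow_natCard_pow]; ring
  rw [h4]
  refine (IsUltrametricDist.norm_add_le_max _ _).trans_lt (max_lt ?_ h)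
  refine (norm_sub_le_max _ _).trans_lt (max_lt ?_ hy)
  rw [norm_pow]
  exact pow_lt_one₀ (norm_nonneg _) hy (pow_pos Nat.card_pos m).ne'

/-- Every element of absolute value one is congruent to a root of unity. -/
theorem exists_rootOfUnity {z : P.CInf F} (hz : ‖z‖ = 1) :
    ∃ ζ : P.CInf F, (∃ n : ℕ, 0 < n ∧ ζ ^ n = 1) ∧ ‖ζ⁻¹ * z - 1‖ < 1 := by
  obtain ⟨m, hm, h⟩ := P.exists_norm_pow_natCard_pow_sub_lt F hz
  exact exists_rootOfUnity_norm_sub_lt F hz hm h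

end

section
variable {F : Type*} {K : Type*} [Field F] [Finite F] [Field K] [Algebra F K]
  [IsGlobalFunctionField F K] {P : Place K}

theorem one_lt_natCard_real : (1 : ℝ) < Nat.card F := by exact_mod_cast Finite.one_lt_card

theorem logq_unique {z : P.CInf F} (hz : z ≠ 0) {x : ℚ} (h : ‖z‖ = (Nat.card F : ℝ) ^ (x : ℝ)) :
    P.logq F z = x := by
  have h1 := norm_eq_rpow_logq hz
  rw [h] at h1
  have hq := one_lt_natCard_real (F := F)
  exact_mod_cast ((Real.rpow_right_inj (zero_lt_one.trans hq) hq.ne').1 h1).symm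

theorem logq_le_iff {z : P.CInf F} (hz : z ≠ 0) {x : ℚ} :
    P.logq F z ≤ x ↔ ‖z‖ ≤ (Nat.card F : ℝ) ^ (x : ℝ) := by
  rw [norm_eq_rpow_logq hz, Real.rpow_le_rpow_left_iff one_lt_natCard_real, Rat.cast_le]

theorem logq_congr {z w : P.CInf F} (hz : z ≠ 0) (hw : w ≠ 0) (h : ‖z‖ = ‖w‖) :
    P.logq F z = P.logq F w :=
  logq_unique hz (h.trans (norm_eq_rpow_logq hw))

theorem logq_mul {z w : P.CInf F} (hz : z ≠ 0) (hw : w ≠ 0) :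
    P.logq F (z * w) = P.logq F z + P.logq F w := by
  apply logq_unique (mul_ne_zero hz hw)
  rw [norm_mul, norm_eq_rpow_logq hz, norm_eq_rpow_logq hw, Rat.cast_add,
    Real.rpow_add (zero_lt_one.trans one_lt_natCard_real)]

namespace RootSystem
variable {π : K} (ϖ : P.RootSystem F π)

/-- Compatibility of the roots lets any denominator be used, not only the reduced one; additivity of
the exponent is then checked over a common denominator. -/
theorem rpow_eq {x : ℚ} {n : ℕ} (hn : 0 < n) {k : ℤ} (h : x = k / n) : ϖ.rpow x = ϖ.root n ^ k := by
  have hdvd : x.den ∣ n := by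
    have := Rat.den_dvd k n
    rw [Rat.divInt_eq_div] at this
    have h2 : x = (k : ℚ) / ((n : ℤ) : ℚ) := by rw [h]; simp
    rw [← h2] at this
    exact_mod_cast this
  obtain ⟨c, hc⟩ := hdvd
  have hx := x.den_pos
  have h1 := ϖ.compatible x.den n hn ⟨c, hc⟩
  rw [rpow, ← h1, ← zpow_natCast, ← zpow_mul]
  congr 1
  have h2 : n / x.den = c := by rw [hc, Nat.mul_div_cancel_left _ hx]
  rw [h2]
  have h3 : (x.num : ℚ) / x.den = k / n := by rw [Rat.num_div_den, h]
  rw [div_eq_div_iff (by exact_mod_cast hx.ne') (by exact_mod_cast hn.ne')] at h3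
  have h4 : x.num * n = k * x.den := by exact_mod_cast h3
  have hx' : (x.den : ℤ) ≠ 0 := by exact_mod_cast hx.ne'
  apply mul_right_cancel₀ hx'
  rw [← h4, hc]; push_cast; ring

variable (hπ : P.v π = WithZero.exp (-1))
include hπ

theorem norm_algebraMap_uniformizer :
    ‖algebraMap K (P.CInf F) π‖ = (Nat.card F : ℝ) ^ (-(P.degree F : ℝ)) := by
  rw [norm_algebraMap, P.abv_of_v_eq_exp F hπ, qInf, Real.rpow_neg (by positivity)]
  simp

theorem norm_root {n : ℕ} (hn : 0 < n) :
    ‖ϖ.root n‖ = (Nat.card F : ℝ) ^ (-(P.degree F : ℝ) / n) := by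
  have h := congrArg norm (ϖ.root_pow n hn)
  rw [norm_algebraMap_uniformizer hπ, norm_pow] at h
  have hn' : (n : ℝ) ≠ 0 := by exact_mod_cast hn.ne'
  refine (pow_left_inj₀ (norm_nonneg _) (by positivity) hn.ne').1 (h.trans ?_)
  rw [← Real.rpow_natCast, ← Real.rpow_mul (by positivity), div_mul_cancel₀ _ hn']

theorem root_ne_zero {n : ℕ} (hn : 0 < n) : ϖ.root n ≠ 0 := by
  rw [← norm_pos_iff, ϖ.norm_root hπ hn]
  exact Real.rpow_pos_of_pos (zero_lt_one.trans one_lt_natCard_real) _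

theorem rpow_ne_zero (x : ℚ) : ϖ.rpow x ≠ 0 := zpow_ne_zero _ (ϖ.root_ne_zero hπ x.den_pos)

theorem norm_rpow (x : ℚ) : ‖ϖ.rpow x‖ = (Nat.card F : ℝ) ^ (-(P.degree F * x : ℝ)) := by
  rw [rpow, norm_zpow, ϖ.norm_root hπ x.den_pos, ← Real.rpow_intCast, ← Real.rpow_mul (by positivity)]
  congr 1
  conv_rhs => rw [← Rat.num_div_den x]
  push_cast
  ring

theorem rpow_add (x y : ℚ) : ϖ.rpow (x + y) = ϖ.rpow x * ϖ.rpow y := by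
  have hn : 0 < x.den * y.den := Nat.mul_pos x.den_pos y.den_pos
  have hx : (x.den : ℚ) ≠ 0 := by exact_mod_cast x.den_pos.ne'
  have hy : (y.den : ℚ) ≠ 0 := by exact_mod_cast y.den_pos.ne'
  have h1 : x = (x.num * y.den : ℤ) / (x.den * y.den : ℕ) := by
    conv_lhs => rw [← Rat.num_div_den x]
    push_cast; field_simp
  have h2 : y = (y.num * x.den : ℤ) / (x.den * y.den : ℕ) := by
    conv_lhs => rw [← Rat.num_div_den y]
    push_cast; field_simp
  rw [ϖ.rpow_eq hn h1, ϖ.rpow_eq hn h2, ← zpow_add₀ (ϖ.root_ne_zero hπ hn)]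
  apply ϖ.rpow_eq hn
  rw [Int.cast_add, add_div, ← h1, ← h2]

omit hπ in
theorem rpow_zero : ϖ.rpow 0 = 1 := by simp [rpow]

theorem rpow_neg (x : ℚ) : ϖ.rpow (-x) = (ϖ.rpow x)⁻¹ := by
  apply eq_inv_of_mul_eq_one_left
  rw [← ϖ.rpow_add hπ, neg_add_cancel, rpow_zero]

theorem rpow_sum {ι : Type*} (s : Finset ι) (f : ι → ℚ) :
    ϖ.rpow (∑ i ∈ s, f i) = ∏ i ∈ s, ϖ.rpow (f i) := by
  classical
  induction s using Finset.induction_on with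
  | empty => simp [rpow_zero]
  | insert i s hi ih => rw [Finset.sum_insert hi, Finset.prod_insert hi, ϖ.rpow_add hπ, ih]

theorem norm_absUnit {z : P.CInf F} (hz : z ≠ 0) : ‖ϖ.absUnit z‖ = 1 := by
  have hd : (P.degree F : ℝ) ≠ 0 := by exact_mod_cast (P.degree_pos (F := F)).ne'
  rw [absUnit, norm_mul, ϖ.norm_rpow hπ, norm_eq_rpow_logq hz,
    ← Real.rpow_add (zero_lt_one.trans one_lt_natCard_real)]
  push_cast
  rw [mul_div_cancel₀ _ hd, add_neg_cancel, Real.rpow_zero]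

theorem sgn_spec {z : P.CInf F} (hz : z ≠ 0) :
    (∃ n : ℕ, 0 < n ∧ ϖ.sgn z ^ n = 1) ∧ ‖(ϖ.sgn z)⁻¹ * ϖ.absUnit z - 1‖ < 1 := by
  have h := P.exists_rootOfUnity F (ϖ.norm_absUnit hπ hz)
  rw [sgn, dif_pos h]
  exact h.choose_spec

omit hπ in
theorem sgn_pow_eq_one (z : P.CInf F) : ∃ n : ℕ, 0 < n ∧ ϖ.sgn z ^ n = 1 := by
  rw [sgn]
  split_ifs with h
  · exact h.choose_spec.1
  · exact ⟨1, one_pos, one_pow 1⟩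

omit hπ in
theorem sgn_ne_zero (z : P.CInf F) : ϖ.sgn z ≠ 0 := by
  obtain ⟨n, hn, h⟩ := ϖ.sgn_pow_eq_one z
  rintro h0
  rw [h0, zero_pow hn.ne'] at h
  exact zero_ne_one h

/-- The quotient of two candidates is both a root of unity and a one-unit, hence `1`. -/
theorem sgn_unique {z ζ : P.CInf F} (hz : z ≠ 0) (h : ∃ n : ℕ, 0 < n ∧ ζ ^ n = 1)
    (h1 : ‖ζ⁻¹ * ϖ.absUnit z - 1‖ < 1) : ϖ.sgn z = ζ := by
  obtain ⟨⟨m, hm, hs⟩, h2⟩ := ϖ.sgn_spec hπ hz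
  obtain ⟨n, hn, hζ⟩ := h
  have hs0 := ϖ.sgn_ne_zero z
  have hζ0 : ζ ≠ 0 := by rintro rfl; rw [zero_pow hn.ne'] at hζ; exact zero_ne_one hζ
  have hz0 : ϖ.absUnit z ≠ 0 := norm_pos_iff.1 (by rw [ϖ.norm_absUnit hπ hz]; exact one_pos)
  have h3 : ϖ.sgn z / ζ = 1 := by
    refine eq_one_of_norm_sub_one_lt F (n := m * n) (Nat.mul_pos hm hn) ?_ ?_
    · rw [div_pow, pow_mul, hs, one_pow, mul_comm, pow_mul, hζ, one_pow, div_one]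
    · have : ϖ.sgn z / ζ = (ζ⁻¹ * ϖ.absUnit z) * ((ϖ.sgn z)⁻¹ * ϖ.absUnit z)⁻¹ := by
        field_simp
      rw [this]
      have h4 := norm_inv_sub_one h2
      refine (norm_mul_sub_one_le (ε := max _ _) (max_le h1.le h2.le) (le_max_left _ _)
        (h4.le.trans (le_max_right _ _))).trans_lt (max_lt h1 h2)
  exact (div_eq_one_iff_eq hζ0).1 h3

theorem norm_oneUnit_sub_one_lt {z : P.CInf F} (hz : z ≠ 0) : ‖ϖ.oneUnit z - 1‖ < 1 := by
  rw [oneUnit, mul_comm]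
  exact (ϖ.sgn_spec hπ hz).2

theorem absUnit_mul {z w : P.CInf F} (hz : z ≠ 0) (hw : w ≠ 0) :
    ϖ.absUnit (z * w) = ϖ.absUnit z * ϖ.absUnit w := by
  rw [absUnit, absUnit, absUnit, logq_mul hz hw, add_div, ϖ.rpow_add hπ]
  ring

theorem sgn_mul {z w : P.CInf F} (hz : z ≠ 0) (hw : w ≠ 0) :
    ϖ.sgn (z * w) = ϖ.sgn z * ϖ.sgn w := by
  obtain ⟨⟨m, hm, h1⟩, h2⟩ := ϖ.sgn_spec hπ hz
  obtain ⟨⟨n, hn, h3⟩, h4⟩ := ϖ.sgn_spec hπ hw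
  refine ϖ.sgn_unique hπ (mul_ne_zero hz hw) ⟨m * n, Nat.mul_pos hm hn, ?_⟩ ?_
  · rw [mul_pow, pow_mul, h1, one_pow, mul_comm m, pow_mul, h3, one_pow, one_mul]
  · rw [ϖ.absUnit_mul hπ hz hw, mul_inv, mul_mul_mul_comm]
    exact (norm_mul_sub_one_le (ε := max _ _) (max_le h2.le h4.le) (le_max_left _ _)
      (le_max_right _ _)).trans_lt (max_lt h2 h4)

theorem oneUnit_mul {z w : P.CInf F} (hz : z ≠ 0) (hw : w ≠ 0) :
    ϖ.oneUnit (z * w) = ϖ.oneUnit z * ϖ.oneUnit w := by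
  rw [oneUnit, oneUnit, oneUnit, ϖ.absUnit_mul hπ hz hw, ϖ.sgn_mul hπ hz hw, mul_inv]
  ring

/-- The decomposition of `z ≠ 0` into a power of `π`, a root of unity, and a one-unit. -/
theorem eq_rpow_mul_sgn_mul_oneUnit (z : P.CInf F) :
    z = ϖ.rpow (-(P.logq F z / P.degree F)) * ϖ.sgn z * ϖ.oneUnit z := by
  have h1 := ϖ.sgn_ne_zero z
  have h2 := ϖ.rpow_ne_zero hπ (P.logq F z / P.degree F)
  rw [ϖ.rpow_neg hπ, oneUnit, absUnit]
  field_simp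

omit hπ in
theorem absUnit_of_norm_sub_one_lt {x : P.CInf F} (hx : ‖x - 1‖ < 1) : ϖ.absUnit x = x := by
  have h1 := norm_eq_one_of_norm_sub_one_lt hx
  have h0 : x ≠ 0 := norm_pos_iff.1 (by rw [h1]; exact one_pos)
  rw [absUnit, logq_unique h0 (x := 0) (by rw [h1]; simp), zero_div, rpow_zero, mul_one]

theorem sgn_of_norm_sub_one_lt {x : P.CInf F} (hx : ‖x - 1‖ < 1) : ϖ.sgn x = 1 := by
  have h1 := norm_eq_one_of_norm_sub_one_lt hx
  have h0 : x ≠ 0 := norm_pos_iff.1 (by rw [h1]; exact one_pos)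
  refine ϖ.sgn_unique hπ h0 ⟨1, one_pos, one_pow 1⟩ ?_
  rwa [ϖ.absUnit_of_norm_sub_one_lt hx, inv_one, one_mul]

theorem oneUnit_of_norm_sub_one_lt {x : P.CInf F} (hx : ‖x - 1‖ < 1) : ϖ.oneUnit x = x := by
  rw [oneUnit, ϖ.sgn_of_norm_sub_one_lt hπ hx, ϖ.absUnit_of_norm_sub_one_lt hx, inv_one, mul_one]

omit hπ in
theorem norm_one_add_div_sub_one {z u : P.CInf F} : ‖1 + u / z - 1‖ = ‖u‖ / ‖z‖ := by
  rw [add_sub_cancel_left, norm_div]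

/-- In `z + u = z * (1 + u / z)` the second factor is a one-unit. This is why signs are insensitive
to small translations. -/
theorem sgn_add {z u : P.CInf F} (h : ‖u‖ < ‖z‖) : ϖ.sgn (z + u) = ϖ.sgn z := by
  have hz : z ≠ 0 := norm_pos_iff.1 ((norm_nonneg u).trans_lt h)
  have h1 : z + u = z * (1 + u / z) := by field_simp
  have h2 : ‖1 + u / z - 1‖ < 1 := by
    rw [norm_one_add_div_sub_one, div_lt_one (norm_pos_iff.2 hz)]; exact h
  have h3 : 1 + u / z ≠ 0 := norm_pos_iff.1 (by rw [norm_eq_one_of_norm_sub_one_lt h2]; exact one_pos)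
  rw [h1, ϖ.sgn_mul hπ hz h3, ϖ.sgn_of_norm_sub_one_lt hπ h2, mul_one]

theorem oneUnit_add {z u : P.CInf F} (h : ‖u‖ < ‖z‖) :
    ϖ.oneUnit (z + u) = ϖ.oneUnit z * (1 + u / z) := by
  have hz : z ≠ 0 := norm_pos_iff.1 ((norm_nonneg u).trans_lt h)
  have h1 : z + u = z * (1 + u / z) := by field_simp
  have h2 : ‖1 + u / z - 1‖ < 1 := by
    rw [norm_one_add_div_sub_one, div_lt_one (norm_pos_iff.2 hz)]; exact h
  have h3 : 1 + u / z ≠ 0 := norm_pos_iff.1 (by rw [norm_eq_one_of_norm_sub_one_lt h2]; exact one_pos)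
  rw [h1, ϖ.oneUnit_mul hπ hz h3, ϖ.oneUnit_of_norm_sub_one_lt hπ h2]

end RootSystem
end
end Place
end

/-! ### Finiteness of quotients -/

section FiniteQuotient
open Polynomial

/-- Reducing a relation modulo `x` kills the constant coefficients of all `p i`; then `x` can be
cancelled from the relation and the degrees drop. -/
theorem linearIndependent_polynomial_of_quotient {F A ι : Type*} [Field F] [CommRing A] [IsDomain A]
    [Algebra F A] [Fintype ι] {x : A} (hx0 : x ≠ 0) (b : ι → A)
    (hb : LinearIndependent F fun i => Ideal.Quotient.mk (Ideal.span {x}) (b i)) (n : ℕ) :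
    ∀ p : ι → F[X], (∀ i, (p i).natDegree ≤ n) → ∑ i, aeval x (p i) * b i = 0 → ∀ i, p i = 0 := by
  have hmk : ∀ p : F[X], Ideal.Quotient.mk (Ideal.span {x}) (aeval x p) =
      algebraMap F (A ⧸ Ideal.span {x}) (p.coeff 0) := by
    intro p
    have h1 : aeval x p = aeval x p.divX * x + algebraMap F A (p.coeff 0) := by
      conv_lhs => rw [← divX_mul_X_add p]
      simp
    rw [h1, map_add, map_mul, Ideal.Quotient.eq_zero_iff_mem.2 (Ideal.mem_span_singleton_self x),
      mul_zero, zero_add]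
    rfl
  have hcoeff : ∀ p : ι → F[X], ∑ i, aeval x (p i) * b i = 0 → ∀ i, (p i).coeff 0 = 0 := by
    intro p hs
    have h := congrArg (Ideal.Quotient.mk (Ideal.span {x})) hs
    simp only [map_sum, map_mul, map_zero, hmk, ← Algebra.smul_def] at h
    exact Fintype.linearIndependent_iff.1 hb _ h
  induction n with
  | zero =>
    intro p hp hs i
    rw [Polynomial.eq_C_of_natDegree_le_zero (hp i), hcoeff p hs i, map_zero]
  | succ n ih =>
    intro p hp hs i
    have hX : ∀ i, p i = (p i).divX * X := fun i => by
      conv_lhs => rw [← divX_mul_X_add (p i), hcoeff p hs i, map_zero, add_zero]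
    have hs' : ∑ i, aeval x ((p i).divX) * b i = 0 := by
      apply mul_left_cancel₀ hx0
      rw [mul_zero, ← hs, Finset.mul_sum]
      refine Finset.sum_congr rfl fun i _ => ?_
      conv_rhs => rw [hX i]
      simp only [map_mul, aeval_X]; ring
    have := ih (fun i => (p i).divX) (fun i => by
      rw [natDegree_divX_eq_natDegree_tsub_one]; have := hp i; omega) hs' i
    rw [hX i, this, zero_mul]

/-- A nonzero element of an order of a global function field generates an ideal of finite index. -/
theorem finite_quotient_span_singleton {F : Type*} (K : Type*) {A : Type*} [Field F] [Finite F]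
    [Field K] [Algebra F K] [IsGlobalFunctionField F K] [CommRing A] [IsDomain A] [Algebra F A]
    [Algebra A K] [IsScalarTower F A K] (hAK : Function.Injective (algebraMap A K)) {x : A}
    (hx0 : x ≠ 0) : Finite (A ⧸ Ideal.span {x}) := by
  obtain ⟨y, hy⟩ : ∃ y, y = algebraMap A K x := ⟨_, rfl⟩
  have hy0 : y ≠ 0 := fun h => hx0 (hAK (by rw [← hy, h, map_zero]))
  by_cases halg : IsAlgebraic F y
  · obtain ⟨c, hc⟩ := IsGlobalFunctionField.constants y halg
    have hc0 : c ≠ 0 := by rintro rfl; exact hy0 (by rw [← hc, map_zero])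
    have hu : IsUnit x := by
      have : x = algebraMap F A c := hAK (by rw [← IsScalarTower.algebraMap_apply, hc, hy])
      rw [this]
      exact (IsUnit.mk0 c hc0).map _
    have := Ideal.Quotient.subsingleton_iff.2 (Ideal.span_singleton_eq_top.2 hu)
    infer_instance
  -- Lifts of independent classes modulo `x` are independent over `F⟮y⟯`, so the dimension of the
  -- quotient over `F` is at most `[K : F⟮y⟯]`.
  have hfin := finite_adjoin_of_transcendental (F := F) halg
  suffices Module.Finite F (A ⧸ Ideal.span {x}) from Module.finite_of_finite F
  rw [← Module.rank_lt_aleph0_iff]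
  refine lt_of_le_of_lt (b := ((Module.finrank F⟮y⟯ K : ℕ) : Cardinal)) (rank_le ?_)
    Cardinal.natCast_lt_aleph0
  intro s hs
  let b : s → A := fun i => (Ideal.Quotient.mk_surjective (i : A ⧸ Ideal.span {x})).choose
  have hb : ∀ i, Ideal.Quotient.mk (Ideal.span {x}) (b i) = i := fun i =>
    (Ideal.Quotient.mk_surjective (i : A ⧸ Ideal.span {x})).choose_spec
  have hs' : LinearIndependent F (fun i => Ideal.Quotient.mk (Ideal.span {x}) (b i)) := by
    simpa [hb] using hs
  have key : LinearIndependent F⟮y⟯ (fun i => algebraMap A K (b i)) := by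
    open scoped IntermediateField.algebraAdjoinAdjoin in
    rw [← LinearIndependent.iff_fractionRing (Algebra.adjoin F {y}) F⟮y⟯,
      Fintype.linearIndependent_iff]
    intro g hg
    have : ∀ i, ∃ p : F[X], aeval y p = (g i : K) := fun i => by
      exact (Algebra.adjoin_singleton_eq_range_aeval F y).le (g i).2
    choose p hp using this
    have hz := linearIndependent_polynomial_of_quotient hx0 b hs'
      (Finset.univ.sup fun i => (p i).natDegree) p
      (fun i => Finset.le_sup (f := fun i => (p i).natDegree) (Finset.mem_univ i)) (by
        apply hAK
        simp only [Algebra.smul_def] at hg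
        rw [map_zero, map_sum]
        simp only [map_mul, ← Polynomial.aeval_algebraMap_apply, ← hy, hp]
        exact hg)
    intro i
    apply Subtype.ext
    rw [← hp i, hz i]; simp
  rw [← Fintype.card_coe]
  exact key.fintype_card_le_finrank

/-- A surjection `A ^ n → M` only depends on the coordinates modulo `b`. -/
theorem finite_of_smul_eq_zero {A M : Type*} [CommRing A] [AddCommGroup M] [Module A M]
    [Module.Finite A M] {b : A} [Finite (A ⧸ Ideal.span {b})] (h : ∀ m : M, b • m = 0) : Finite M := by
  obtain ⟨n, f, hf⟩ := Module.Finite.exists_fin' A M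
  have hsurj : Function.Surjective fun g : Fin n → A ⧸ Ideal.span {b} => f fun i => (g i).out := by
    intro m
    obtain ⟨c, rfl⟩ := hf m
    refine ⟨fun i => Ideal.Quotient.mk _ (c i), ?_⟩
    have : ∀ i, ∃ a, (Ideal.Quotient.mk (Ideal.span {b}) (c i)).out = c i + b * a := by
      intro i
      have h1 : Ideal.Quotient.mk (Ideal.span {b}) (Ideal.Quotient.mk (Ideal.span {b}) (c i)).out =
        Ideal.Quotient.mk (Ideal.span {b}) (c i) := Quotient.out_eq _
      rw [Ideal.Quotient.eq, Ideal.mem_span_singleton] at h1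
      obtain ⟨a, ha⟩ := h1
      exact ⟨a, by rw [← ha]; ring⟩
    choose a ha using this
    have h2 : (fun i => (Ideal.Quotient.mk (Ideal.span {b}) (c i)).out) = c + b • a := by
      ext i; simp [ha]
    change f (fun i => (Ideal.Quotient.mk (Ideal.span {b}) (c i)).out) = f c
    rw [h2, map_add, map_smul, h, add_zero]
  exact Finite.of_surjective _ hsurj

/-- The quotient has rank zero, hence is torsion; a product of annihilators of finitely many
generators is a nonzero element annihilating all of it. -/
theorem finite_quotient_of_finrank_eq {A M : Type*} [CommRing A] [IsDomain A] [AddCommGroup M]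
    [Module A M] [Module.Finite A M] (hA : ∀ b : A, b ≠ 0 → Finite (A ⧸ Ideal.span {b}))
    (N : Submodule A M) [Module.Finite A N] (h : Module.finrank A N = Module.finrank A M) :
    Finite (M ⧸ N) := by
  have h1 := rank_quotient_add_rank_of_isDomain N
  have h2 : Module.rank A (M ⧸ N) = 0 := by
    rw [← Module.finrank_eq_rank, ← Module.finrank_eq_rank, ← Module.finrank_eq_rank] at h1
    rw [← Module.finrank_eq_rank]
    norm_cast at h1 ⊢
    omega
  rw [rank_eq_zero_iff] at h2
  obtain ⟨s, hs⟩ := Module.Finite.fg_top (R := A) (M := M ⧸ N)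
  choose c hc0 hc using h2
  have := hA (∏ m ∈ s, c m) (Finset.prod_ne_zero_iff.2 fun m _ => hc0 m)
  refine finite_of_smul_eq_zero (b := ∏ m ∈ s, c m) fun m => ?_
  have hm : m ∈ Submodule.span A (s : Set (M ⧸ N)) := by rw [hs]; trivial
  induction hm using Submodule.span_induction with
  | mem x hx =>
    classical
    rw [← Finset.prod_erase_mul _ _ hx, mul_smul, hc, smul_zero]
  | zero => rw [smul_zero]
  | add x y _ _ ihx ihy => rw [smul_add, ihx, ihy, add_zero]
  | smul a x _ ih => rw [smul_comm, ih, smul_zero]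

end FiniteQuotient

/-! ### Lattices: self-similarity and balls -/

noncomputable section
namespace Place
variable {F : Type*} {K : Type*} [Field F] [Finite F] [Field K] [Algebra F K]
  [IsGlobalFunctionField F K] {P : Place K}

theorem exists_rat_le_rpow (F : Type*) [Field F] [Finite F] (R : ℝ) :
    ∃ N : ℚ, R ≤ (Nat.card F : ℝ) ^ (N : ℝ) := by
  obtain ⟨n, hn⟩ := pow_unbounded_of_one_lt R (one_lt_natCard_real (F := F))
  exact ⟨n, by rw [Rat.cast_natCast, Real.rpow_natCast]; exact hn.le⟩

theorem rpow_natCard_mono {M N : ℚ} (h : M ≤ N) :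
    (Nat.card F : ℝ) ^ (M : ℝ) ≤ (Nat.card F : ℝ) ^ (N : ℝ) :=
  Real.rpow_le_rpow_of_exponent_le one_lt_natCard_real.le (by exact_mod_cast h)

theorem rpow_natCard_lt {M N : ℚ} (h : M < N) :
    (Nat.card F : ℝ) ^ (M : ℝ) < (Nat.card F : ℝ) ^ (N : ℝ) :=
  Real.rpow_lt_rpow_of_exponent_lt one_lt_natCard_real (by exact_mod_cast h)

theorem rpow_natCard_pos (N : ℚ) : 0 < (Nat.card F : ℝ) ^ (N : ℝ) :=
  Real.rpow_pos_of_pos (zero_lt_one.trans one_lt_natCard_real) _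

theorem norm_coeffRing_smul (a : P.coeffRing F) (z : P.CInf F) :
    ‖a • z‖ = ‖algebraMap K (P.CInf F) a‖ * ‖z‖ := by
  rw [← norm_mul, ← Algebra.smul_def]
  rfl

theorem finite_quotient_coeffRing {a : P.coeffRing F} (ha : a ≠ 0) :
    Finite (P.coeffRing F ⧸ Ideal.span {a}) :=
  finite_quotient_span_singleton (F := F) K Subtype.val_injective ha

namespace Lattice
variable (Λ Λ' : P.Lattice F)

instance : Module.Finite (P.coeffRing F) Λ.carrier := Module.Finite.iff_fg.2 Λ.fg

/-- If all of `A` has absolute value at most one, then the lattice is bounded by its generators, and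
discreteness makes it finite. This dichotomy is all that is needed about nonconstant elements of
`A`. -/
theorem finite_or_exists_one_lt_norm :
    (Λ.carrier : Set (P.CInf F)).Finite ∨
      ∃ a : P.coeffRing F, a ≠ 0 ∧ 1 < ‖algebraMap K (P.CInf F) a‖ := by
  by_cases h : ∃ a : P.coeffRing F, 1 < ‖algebraMap K (P.CInf F) a‖
  · obtain ⟨a, ha⟩ := h
    refine Or.inr ⟨a, ?_, ha⟩
    rintro rfl
    simp at ha
    linarith
  push Not at h
  left
  obtain ⟨s, hs⟩ := Λ.fg
  obtain ⟨R, hR⟩ := (s.finite_toSet.image norm).bddAbove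
  have hR' : ∀ z ∈ s, ‖z‖ ≤ max R 0 := fun z hz => (hR ⟨z, hz, rfl⟩).trans (le_max_left _ _)
  refine (Λ.discrete (max R 0)).subset fun z hz => ⟨hz, ?_⟩
  have hz' : z ∈ Submodule.span (P.coeffRing F) (s : Set (P.CInf F)) := by rw [hs]; exact hz
  induction hz' using Submodule.span_induction with
  | mem x hx => exact hR' x hx
  | zero => simp
  | add x y hx hy ihx ihy =>
    exact (IsUltrametricDist.norm_add_le_max _ _).trans
      (max_le (ihx (by rw [← hs] ; exact hx)) (ihy (by rw [← hs]; exact hy)))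
  | smul a x hx ih =>
    rw [norm_coeffRing_smul]
    exact (mul_le_of_le_one_left (norm_nonneg _) (h a)).trans (ih (by rw [← hs]; exact hx))

/-- The self-similarity of the lattice: representatives of `Λ / a Λ`, which is finite because `A /
a` is. -/
theorem exists_representatives {a : P.coeffRing F} (ha : a ≠ 0) :
    ∃ (n : ℕ) (ρ : Fin n → Λ.carrier),
      Function.Bijective fun p : Fin n × Λ.carrier => ρ p.1 + a • p.2 := by
  let f : Λ.carrier →ₗ[P.coeffRing F] Λ.carrier := LinearMap.lsmul _ _ a
  have ha' : algebraMap K (P.CInf F) a ≠ 0 := by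
    rw [Ne, map_eq_zero]; exact fun h => ha (Subtype.ext h)
  have hinj : ∀ x y : Λ.carrier, a • x = a • y → x = y := by
    intro x y h
    apply Subtype.ext
    have h1 : algebraMap K (P.CInf F) a * x = algebraMap K (P.CInf F) a * y := by
      rw [← Algebra.smul_def, ← Algebra.smul_def]
      exact congrArg Subtype.val h
    exact mul_left_cancel₀ ha' h1
  have : Finite (P.coeffRing F ⧸ Ideal.span {a}) := finite_quotient_coeffRing ha
  have : Finite (Λ.carrier ⧸ LinearMap.range f) := by
    refine finite_of_smul_eq_zero (b := a) fun m => ?_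
    obtain ⟨m, rfl⟩ := Submodule.Quotient.mk_surjective _ m
    rw [← Submodule.Quotient.mk_smul, Submodule.Quotient.mk_eq_zero]
    exact ⟨m, rfl⟩
  obtain ⟨n, ⟨e⟩⟩ := Finite.exists_equiv_fin (Λ.carrier ⧸ LinearMap.range f)
  have hout : ∀ i, Submodule.Quotient.mk (p := LinearMap.range f) ((e.symm i).out) = e.symm i :=
    fun i => Quotient.out_eq _
  have hmk : ∀ x, Submodule.Quotient.mk (p := LinearMap.range f) (a • x) = 0 := fun x =>
    (Submodule.Quotient.mk_eq_zero _).2 ⟨x, rfl⟩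
  refine ⟨n, fun i => (e.symm i).out, ?_, ?_⟩
  · rintro ⟨i, x⟩ ⟨j, y⟩ h
    have h1 := congrArg (Submodule.Quotient.mk (p := LinearMap.range f)) h
    simp only [Submodule.Quotient.mk_add, hout, hmk, add_zero] at h1
    obtain rfl := e.symm.injective h1
    exact Prod.ext rfl (hinj x y (add_left_cancel h))
  · intro z
    set i := e (Submodule.Quotient.mk z) with hi
    have h1 : Submodule.Quotient.mk (p := LinearMap.range f) (z - (e.symm i).out) = 0 := by
      rw [Submodule.Quotient.mk_sub, hout, hi, Equiv.symm_apply_apply, sub_self]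
    obtain ⟨x, hx⟩ := (Submodule.Quotient.mk_eq_zero _).1 h1
    refine ⟨(i, x), ?_⟩
    change (e.symm i).out + f x = z
    rw [hx, add_sub_cancel]

variable {Λ Λ'} in
theorem finite_quotient (hle : Λ.carrier ≤ Λ'.carrier) (h : Λ.rank = Λ'.rank) :
    Finite (Λ'.carrier ⧸ Λ.carrier.submoduleOf Λ'.carrier) := by
  have : Module.Finite (P.coeffRing F) (Λ.carrier.submoduleOf Λ'.carrier) :=
    Module.Finite.equiv (Submodule.submoduleOfEquivOfLe hle).symm
  refine finite_quotient_of_finrank_eq (fun b hb => finite_quotient_coeffRing hb) _ ?_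
  rw [(Submodule.submoduleOfEquivOfLe hle).finrank_eq]
  exact h

/-- The elements of the lattice of absolute value at most `q ^ N`. -/
def ball (N : ℚ) : Submodule F (P.CInf F) where
  carrier := {z | z ∈ Λ.carrier ∧ ‖z‖ ≤ (Nat.card F : ℝ) ^ (N : ℝ)}
  add_mem' hx hy := ⟨add_mem hx.1 hy.1,
    (IsUltrametricDist.norm_add_le_max _ _).trans (max_le hx.2 hy.2)⟩
  zero_mem' := ⟨zero_mem _, by rw [norm_zero]; exact (rpow_natCard_pos N).le⟩
  smul_mem' c x hx := by
    by_cases hc : c = 0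
    · subst hc
      rw [zero_smul]
      exact ⟨zero_mem _, by rw [norm_zero]; exact (rpow_natCard_pos N).le⟩
    · refine ⟨?_, (norm_smul_finite F hc x).trans_le hx.2⟩
      rw [← algebraMap_smul (P.coeffRing F) c x]
      exact Λ.carrier.smul_mem _ hx.1

theorem mem_ball {N : ℚ} {z : P.CInf F} :
    z ∈ Λ.ball N ↔ z ∈ Λ.carrier ∧ ‖z‖ ≤ (Nat.card F : ℝ) ^ (N : ℝ) := Iff.rfl

instance (N : ℚ) : Finite (Λ.ball N) := (Λ.discrete _).to_subtype

instance (N : ℚ) : Fintype (Λ.ball N) := Fintype.ofFinite _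

/-- The finite set of the nonzero `z ≡ u` with `log z ≤ N`. -/
def cosetFinset (u : P.CInf F) (N : ℚ) : Finset (P.CInf F) := (Λ.cosetLE_finite u N).toFinset

variable {Λ}

theorem mem_cosetFinset {u : P.CInf F} {N : ℚ} {z : P.CInf F} :
    z ∈ Λ.cosetFinset u N ↔ z - u ∈ Λ.carrier ∧ z ≠ 0 ∧ P.logq F z ≤ N := by
  rw [cosetFinset, Set.Finite.mem_toFinset]
  exact and_assoc

theorem mem_cosetFinset' {u : P.CInf F} {N : ℚ} {z : P.CInf F} :
    z ∈ Λ.cosetFinset u N ↔ z - u ∈ Λ.carrier ∧ z ≠ 0 ∧ ‖z‖ ≤ (Nat.card F : ℝ) ^ (N : ℝ) := by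
  rw [mem_cosetFinset]
  constructor
  · rintro ⟨h1, h2, h3⟩; exact ⟨h1, h2, (logq_le_iff h2).1 h3⟩
  · rintro ⟨h1, h2, h3⟩; exact ⟨h1, h2, (logq_le_iff h2).2 h3⟩

theorem cosetFinset_mono (u : P.CInf F) {M N : ℚ} (h : M ≤ N) :
    Λ.cosetFinset u M ⊆ Λ.cosetFinset u N := fun z hz => by
  rw [mem_cosetFinset] at hz ⊢
  exact ⟨hz.1, hz.2.1, hz.2.2.trans h⟩

theorem finprod_cosetLE (u : P.CInf F) (N : ℚ) (f : P.CInf F → P.CInf F) :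
    ∏ᶠ z ∈ Λ.cosetLE u N, f z = ∏ z ∈ Λ.cosetFinset u N, f z :=
  finprod_mem_eq_finite_toFinset_prod _ _

end Lattice
end Place
end

/-! ### Rationality of the `Z`-functions and their derivatives at `S = 1` -/

noncomputable section
namespace Place

section Rational

theorem valueAtOne_zero : valueAtOne 0 = 0 := Finsupp.sum_zero_index

theorem derivAtOne_zero : derivAtOne 0 = 0 := Finsupp.sum_zero_index

theorem valueAtOne_add (p s : ℚ →₀ ℤ) : valueAtOne (p + s) = valueAtOne p + valueAtOne s :=
  Finsupp.sum_add_index' (fun _ => rfl) fun _ _ _ => rfl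

theorem derivAtOne_add (p s : ℚ →₀ ℤ) : derivAtOne (p + s) = derivAtOne p + derivAtOne s :=
  Finsupp.sum_add_index' (fun _ => by simp) fun _ _ _ => by push_cast; ring

theorem valueAtOne_single (x : ℚ) (c : ℤ) : valueAtOne (Finsupp.single x c) = c :=
  Finsupp.sum_single_index rfl

theorem derivAtOne_single (x : ℚ) (c : ℤ) : derivAtOne (Finsupp.single x c) = c * x :=
  Finsupp.sum_single_index (by simp)

theorem derivAtOne_neg (p : ℚ →₀ ℤ) : derivAtOne (-p) = -derivAtOne p := by
  have := derivAtOne_add p (-p)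
  rw [add_neg_cancel, derivAtOne_zero] at this
  linarith

theorem derivAtOne_sub (p s : ℚ →₀ ℤ) : derivAtOne (p - s) = derivAtOne p - derivAtOne s := by
  rw [sub_eq_add_neg, derivAtOne_add, derivAtOne_neg, sub_eq_add_neg]

theorem derivAtOne_sum {ι : Type*} (t : Finset ι) (p : ι → ℚ →₀ ℤ) :
    derivAtOne (∑ i ∈ t, p i) = ∑ i ∈ t, derivAtOne (p i) := by
  classical
  induction t using Finset.induction_on with
  | empty => exact derivAtOne_zero
  | insert i t hi ih => rw [Finset.sum_insert hi, Finset.sum_insert hi, derivAtOne_add, ih]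

theorem ofFinsupp_add (p s : ℚ →₀ ℤ) :
    HahnSeries.ofFinsupp (p + s) = HahnSeries.ofFinsupp p + HahnSeries.ofFinsupp s := by
  ext x; simp [HahnSeries.coeff_ofFinsupp]

theorem ofFinsupp_single (x : ℚ) (c : ℤ) :
    HahnSeries.ofFinsupp (Finsupp.single x c) = HahnSeries.single x c := by
  ext y
  rw [HahnSeries.coeff_ofFinsupp]
  by_cases h : y = x
  · subst h; simp
  · rw [HahnSeries.coeff_single_of_ne h, Finsupp.single_eq_of_ne h]

theorem ofFinsupp_injective :
    Function.Injective (HahnSeries.ofFinsupp : (ℚ →₀ ℤ) → HahnSeries ℚ ℤ) := by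
  intro p s h
  ext x
  rw [← HahnSeries.coeff_ofFinsupp p, ← HahnSeries.coeff_ofFinsupp s, h]

/-- The product rule for finite sums of rational powers of `S`. -/
theorem exists_ofFinsupp_mul (p s : ℚ →₀ ℤ) :
    ∃ t : ℚ →₀ ℤ, HahnSeries.ofFinsupp t = HahnSeries.ofFinsupp p * HahnSeries.ofFinsupp s ∧
      valueAtOne t = valueAtOne p * valueAtOne s ∧
      derivAtOne t = derivAtOne p * valueAtOne s + valueAtOne p * derivAtOne s := by
  induction p using Finsupp.induction_linear with
  | zero => exact ⟨0, by simp, by simp [valueAtOne_zero], by simp [valueAtOne_zero, derivAtOne_zero]⟩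
  | add p p' ih ih' =>
    obtain ⟨t, h1, h2, h3⟩ := ih
    obtain ⟨t', h1', h2', h3'⟩ := ih'
    refine ⟨t + t', ?_, ?_, ?_⟩
    · rw [ofFinsupp_add, ofFinsupp_add, h1, h1', add_mul]
    · rw [valueAtOne_add, valueAtOne_add, h2, h2', add_mul]
    · rw [derivAtOne_add, derivAtOne_add, valueAtOne_add, h3, h3']; push_cast; ring
  | single x c =>
    induction s using Finsupp.induction_linear with
    | zero => exact ⟨0, by simp, by simp [valueAtOne_zero], by simp [valueAtOne_zero, derivAtOne_zero]⟩
    | add p p' ih ih' =>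
      obtain ⟨t, h1, h2, h3⟩ := ih
      obtain ⟨t', h1', h2', h3'⟩ := ih'
      refine ⟨t + t', ?_, ?_, ?_⟩
      · rw [ofFinsupp_add, ofFinsupp_add, h1, h1', mul_add]
      · rw [valueAtOne_add, valueAtOne_add, h2, h2', mul_add]
      · rw [derivAtOne_add, derivAtOne_add, valueAtOne_add, h3, h3']; push_cast; ring
    | single y d =>
      refine ⟨Finsupp.single (x + y) (c * d), ?_, ?_, ?_⟩
      · simp only [ofFinsupp_single, HahnSeries.single_mul_single]
      · simp only [valueAtOne_single]
      · simp only [valueAtOne_single, derivAtOne_single]; push_cast; ring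

theorem isRationalWithDerivAtOne_ofFinsupp (p : ℚ →₀ ℤ) :
    IsRationalWithDerivAtOne (HahnSeries.ofFinsupp p) (derivAtOne p) := by
  refine ⟨p, Finsupp.single 0 1, ?_, ?_, ?_⟩
  · rw [valueAtOne_single]; exact one_ne_zero
  · rw [ofFinsupp_single, HahnSeries.single_zero_one, mul_one]
  · simp [valueAtOne_single, derivAtOne_single]

namespace IsRationalWithDerivAtOne

/-- For two presentations `p / s` and `p' / s'` one has `p * s' = p' * s` as finite sums; comparing
values and derivatives at `S = 1` by the product rule gives the claim. -/
theorem unique {f : HahnSeries ℚ ℤ} {D E : ℚ} (hD : IsRationalWithDerivAtOne f D)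
    (hE : IsRationalWithDerivAtOne f E) : D = E := by
  obtain ⟨p, s, hs, h, rfl⟩ := hD
  obtain ⟨p', s', hs', h', rfl⟩ := hE
  obtain ⟨t, h1, h2, h3⟩ := exists_ofFinsupp_mul p s'
  obtain ⟨t', h1', h2', h3'⟩ := exists_ofFinsupp_mul p' s
  have ht : t = t' := ofFinsupp_injective (by rw [h1, h1', ← h, ← h']; ring)
  subst ht
  have e1 : (valueAtOne p * valueAtOne s' : ℚ) = valueAtOne p' * valueAtOne s := by
    exact_mod_cast h2.symm.trans h2'
  have e2 := h3.symm.trans h3'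
  have a0 : (valueAtOne s : ℚ) ≠ 0 := by exact_mod_cast hs
  have c0 : (valueAtOne s' : ℚ) ≠ 0 := by exact_mod_cast hs'
  rw [div_eq_div_iff (pow_ne_zero 2 a0) (pow_ne_zero 2 c0)]
  linear_combination (valueAtOne s * valueAtOne s' : ℚ) * e2 -
    (valueAtOne s' * derivAtOne s + valueAtOne s * derivAtOne s' : ℚ) * e1

theorem add {f g : HahnSeries ℚ ℤ} {D E : ℚ} (hD : IsRationalWithDerivAtOne f D)
    (hE : IsRationalWithDerivAtOne g E) : IsRationalWithDerivAtOne (f + g) (D + E) := by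
  obtain ⟨p, s, hs, h, rfl⟩ := hD
  obtain ⟨p', s', hs', h', rfl⟩ := hE
  obtain ⟨t, h1, h2, h3⟩ := exists_ofFinsupp_mul p s'
  obtain ⟨t', h1', h2', h3'⟩ := exists_ofFinsupp_mul p' s
  obtain ⟨w, h4, h5, h6⟩ := exists_ofFinsupp_mul s s'
  refine ⟨t + t', w, ?_, ?_, ?_⟩
  · rw [h5]; exact mul_ne_zero hs hs'
  · rw [ofFinsupp_add, h4, h1, h1', ← h, ← h']; ring
  · have a0 : (valueAtOne s : ℚ) ≠ 0 := by exact_mod_cast hs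
    have c0 : (valueAtOne s' : ℚ) ≠ 0 := by exact_mod_cast hs'
    rw [derivAtOne_add, valueAtOne_add, h2, h2', h3, h3', h5, h6]
    push_cast
    field_simp
    ring

theorem sum {ι : Type*} (t : Finset ι) {f : ι → HahnSeries ℚ ℤ} {D : ι → ℚ}
    (h : ∀ i ∈ t, IsRationalWithDerivAtOne (f i) (D i)) :
    IsRationalWithDerivAtOne (∑ i ∈ t, f i) (∑ i ∈ t, D i) := by
  classical
  induction t using Finset.induction_on with
  | empty =>
    have := isRationalWithDerivAtOne_ofFinsupp 0
    rwa [map_zero, derivAtOne_zero] at this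
  | insert i t hi ih =>
    rw [Finset.sum_insert hi, Finset.sum_insert hi]
    exact (h i (Finset.mem_insert_self i t)).add (ih fun j hj => h j (Finset.mem_insert_of_mem hj))

end IsRationalWithDerivAtOne
end Rational

namespace Lattice
variable {F : Type*} {K : Type*} [Field F] [Finite F] [Field K] [Algebra F K]
  [IsGlobalFunctionField F K] {P : Place K} {Λ Λ' : P.Lattice F}

theorem ZDeriv_eq {u : P.CInf F} {D : ℚ} (h : IsRationalWithDerivAtOne (Λ.Z u) D) :
    Λ.ZDeriv u = D := by
  rw [ZDeriv, dif_pos ⟨D, h⟩]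
  exact (Exists.choose_spec (p := IsRationalWithDerivAtOne (Λ.Z u)) ⟨D, h⟩).unique h

theorem isRational_ZDeriv {u : P.CInf F} (h : ∃ D, IsRationalWithDerivAtOne (Λ.Z u) D) :
    IsRationalWithDerivAtOne (Λ.Z u) (Λ.ZDeriv u) := by
  obtain ⟨D, h⟩ := h
  rwa [ZDeriv_eq h]

variable (Λ) in
/-- The part of the `Z`-function with exponents at most `N`. -/
def truncZ (u : P.CInf F) (N : ℚ) : ℚ →₀ ℤ :=
  ∑ z ∈ Λ.cosetFinset u N, Finsupp.single (P.logq F z) 1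

theorem derivAtOne_truncZ (u : P.CInf F) (N : ℚ) :
    derivAtOne (Λ.truncZ u N) = ∑ z ∈ Λ.cosetFinset u N, P.logq F z := by
  rw [truncZ, derivAtOne_sum]
  exact Finset.sum_congr rfl fun z _ => by rw [derivAtOne_single]; simp

theorem truncZ_apply (u : P.CInf F) (N x : ℚ) :
    Λ.truncZ u N x = if x ≤ N then (Λ.Z u).coeff x else 0 := by
  classical
  rw [truncZ, Finsupp.finsetSum_apply]
  simp only [Finsupp.single_apply]
  rw [Finset.sum_boole]
  split_ifs with h
  · change _ = (({z | z ∈ Λ.coset u ∧ P.logq F z = x}.ncard : ℕ) : ℤ)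
    rw [← Set.ncard_coe_finset]
    congr 2
    ext z
    simp only [Finset.coe_filter, Set.mem_ofPred_eq, mem_cosetFinset, coset]
    constructor
    · rintro ⟨⟨h1, h2, -⟩, h4⟩; exact ⟨⟨h1, h2⟩, h4⟩
    · rintro ⟨⟨h1, h2⟩, h4⟩; exact ⟨⟨h1, h2, h4.trans_le h⟩, h4⟩
  · rw [Nat.cast_eq_zero, Finset.card_eq_zero, Finset.filter_eq_empty_iff]
    intro z hz h1
    rw [mem_cosetFinset] at hz
    exact h (h1 ▸ hz.2.2)

/-- Translation by `u` is a bijection between the elements of `Λ` and of `u + Λ` of absolute value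
`q ^ x > |u|`, and it preserves `log`. -/
theorem Z_coeff_eq {u : P.CInf F} {N x : ℚ} (hu : ‖u‖ ≤ (Nat.card F : ℝ) ^ (N : ℝ)) (hx : N < x) :
    (Λ.Z u).coeff x = (Λ.Z 0).coeff x := by
  change (({z | z ∈ Λ.coset u ∧ P.logq F z = x}.ncard : ℕ) : ℤ) =
    (({z | z ∈ Λ.coset 0 ∧ P.logq F z = x}.ncard : ℕ) : ℤ)
  have hlt : ∀ z : P.CInf F, z ≠ 0 → P.logq F z = x → ‖u‖ < ‖z‖ := by
    intro z hz h
    rw [norm_eq_rpow_logq hz, h]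
    exact hu.trans_lt (rpow_natCard_lt hx)
  have key : ∀ (w z : P.CInf F), z ≠ 0 → ‖w‖ < ‖z‖ → w + z ≠ 0 ∧ P.logq F (w + z) = P.logq F z := by
    intro w z hz h
    have h1 := norm_add_eq_right_of_lt h
    have h2 : w + z ≠ 0 := norm_pos_iff.1 (by rw [h1]; exact norm_pos_iff.2 hz)
    exact ⟨h2, logq_congr h2 hz h1⟩
  congr 1
  symm
  refine Set.ncard_congr (fun z _ => u + z) ?_ ?_ ?_
  · rintro z ⟨⟨h1, h2⟩, h3⟩
    obtain ⟨h4, h5⟩ := key u z h2 (hlt z h2 h3)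
    exact ⟨⟨by simpa using h1, h4⟩, h5.trans h3⟩
  · intro z w _ _ h
    exact add_left_cancel h
  · rintro z ⟨⟨h1, h2⟩, h3⟩
    obtain ⟨h4, h5⟩ := key (-u) z h2 (by rw [norm_neg]; exact hlt z h2 h3)
    refine ⟨-u + z, ⟨⟨?_, h4⟩, h5.trans h3⟩, by simp⟩
    rw [sub_zero, neg_add_eq_sub]; exact h1

theorem Z_eq_add {u : P.CInf F} {N : ℚ} (hu : ‖u‖ ≤ (Nat.card F : ℝ) ^ (N : ℝ)) :
    Λ.Z u = Λ.Z 0 + HahnSeries.ofFinsupp (Λ.truncZ u N - Λ.truncZ 0 N) := by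
  ext x
  rw [HahnSeries.coeff_add, HahnSeries.coeff_ofFinsupp, Finsupp.sub_apply, truncZ_apply, truncZ_apply]
  split_ifs with h
  · ring
  · rw [Z_coeff_eq hu (not_le.1 h)]; simp

/-- If `z = ρ i + a • w` is larger than all `ρ i`, then `log z = log a + log w`; conversely each `w`
of the right size yields `n` such `z`. So `Z` satisfies a functional equation up to finitely many
terms. -/
theorem exists_coeff_Z_eq {a : P.coeffRing F} (ha : a ≠ 0)
    {n : ℕ} {ρ : Fin n → Λ.carrier} (hρ : Function.Bijective fun p : Fin n × Λ.carrier => ρ p.1 + a • p.2) :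
    ∃ N : ℚ, ∀ x, N < x → (Λ.Z 0).coeff x =
      n * (Λ.Z 0).coeff (x - P.logq F (algebraMap K (P.CInf F) a)) := by
  set α := algebraMap K (P.CInf F) a with hα
  have hα0 : α ≠ 0 := by
    rw [hα, Ne, map_eq_zero]; exact fun h => ha (Subtype.ext h)
  obtain ⟨R, hR⟩ := (Set.finite_range fun i => ‖(ρ i : P.CInf F)‖).bddAbove
  obtain ⟨N, hN⟩ := exists_rat_le_rpow F R
  refine ⟨N, fun x hx => ?_⟩
  have hρx : ∀ i (z : P.CInf F), z ≠ 0 → P.logq F z = x → ‖(ρ i : P.CInf F)‖ < ‖z‖ := by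
    intro i z hz h
    rw [norm_eq_rpow_logq hz, h]
    exact ((hR ⟨i, rfl⟩).trans hN).trans_lt (rpow_natCard_lt hx)
  have hsmul : ∀ z : P.CInf F, a • z = α * z := fun z => Algebra.smul_def _ _
  change (({z | z ∈ Λ.coset 0 ∧ P.logq F z = x}.ncard : ℕ) : ℤ) =
    n * (({z | z ∈ Λ.coset 0 ∧ P.logq F z = x - P.logq F α}.ncard : ℕ) : ℤ)
  set S := {z | z ∈ Λ.coset 0 ∧ P.logq F z = x - P.logq F α} with hS
  have h1 : {z | z ∈ Λ.coset 0 ∧ P.logq F z = x} =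
      (fun p : Fin n × P.CInf F => (ρ p.1 : P.CInf F) + α * p.2) '' (Set.univ ×ˢ S) := by
    ext z
    constructor
    · rintro ⟨⟨hz, hz0⟩, hzx⟩
      rw [sub_zero] at hz
      obtain ⟨⟨i, w⟩, hiw⟩ := hρ.2 ⟨z, hz⟩
      have hiw' : (ρ i : P.CInf F) + α * w = z := by
        rw [← hsmul]; exact congrArg Subtype.val hiw
      have h2 : ‖-(ρ i : P.CInf F)‖ < ‖z‖ := by rw [norm_neg]; exact hρx i z hz0 hzx
      have h3 : α * (w : P.CInf F) = -(ρ i : P.CInf F) + z := by rw [← hiw']; ring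
      have h4 := norm_add_eq_right_of_lt h2
      rw [← h3] at h4
      have h5 : α * (w : P.CInf F) ≠ 0 := norm_pos_iff.1 (by rw [h4]; exact norm_pos_iff.2 hz0)
      have h6 : (w : P.CInf F) ≠ 0 := right_ne_zero_of_mul h5
      refine ⟨(i, w), ⟨trivial, ⟨by rw [sub_zero]; exact w.2, h6⟩, ?_⟩, hiw'⟩
      have h7 := logq_congr h5 hz0 h4
      rw [logq_mul hα0 h6, hzx] at h7
      linarith
    · rintro ⟨⟨i, w⟩, ⟨-, ⟨hw, hw0⟩, hwx⟩, rfl⟩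
      rw [sub_zero] at hw
      dsimp only at hw hw0 hwx ⊢
      have h5 := mul_ne_zero hα0 hw0
      have h6 : P.logq F (α * w) = x := by rw [logq_mul hα0 hw0, hwx]; ring
      have h4 := norm_add_eq_right_of_lt (hρx i _ h5 h6)
      have h7 : (ρ i : P.CInf F) + α * w ≠ 0 := norm_pos_iff.1 (by rw [h4]; exact norm_pos_iff.2 h5)
      refine ⟨⟨?_, h7⟩, (logq_congr h7 h5 h4).trans h6⟩
      rw [sub_zero, ← hsmul]
      exact add_mem (ρ i).2 (Λ.carrier.smul_mem a hw)
  rw [h1, Set.InjOn.ncard_image, Set.ncard_prod, Set.ncard_univ, Nat.card_eq_fintype_card,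
    Fintype.card_fin]
  · push_cast; rfl
  · rintro ⟨i, w⟩ ⟨-, ⟨hw, -⟩, -⟩ ⟨j, w'⟩ ⟨-, ⟨hw', -⟩, -⟩ h
    rw [sub_zero] at hw hw'
    dsimp only at hw hw' h
    have h2 : (i, (⟨w, hw⟩ : Λ.carrier)) = (j, ⟨w', hw'⟩) := by
      apply hρ.1
      apply Subtype.ext
      rw [← hsmul, ← hsmul] at h
      exact h
    rw [Prod.mk.injEq] at h2
    exact Prod.ext h2.1 (congrArg Subtype.val h2.2)

theorem exists_isRational_Z_zero : ∃ D, IsRationalWithDerivAtOne (Λ.Z 0) D := by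
  rcases Λ.finite_or_exists_one_lt_norm with hfin | ⟨a, ha0, ha⟩
  · obtain ⟨R, hR⟩ := (hfin.image (P.logq F)).bddAbove
    have : Λ.Z 0 = HahnSeries.ofFinsupp (Λ.truncZ 0 R) := by
      ext x
      rw [HahnSeries.coeff_ofFinsupp, truncZ_apply]
      split_ifs with h
      · rfl
      · change (({z | z ∈ Λ.coset 0 ∧ P.logq F z = x}.ncard : ℕ) : ℤ) = 0
        rw [Nat.cast_eq_zero]
        convert Set.ncard_empty (P.CInf F)
        rw [Set.eq_empty_iff_forall_notMem]
        rintro z ⟨⟨hz, -⟩, rfl⟩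
        rw [sub_zero] at hz
        exact h (hR ⟨z, hz, rfl⟩)
    rw [this]
    exact ⟨_, isRationalWithDerivAtOne_ofFinsupp _⟩
  by_cases htriv : ∀ z ∈ Λ.carrier, z = 0
  · have : Λ.Z 0 = HahnSeries.ofFinsupp 0 := by
      ext x
      rw [map_zero, HahnSeries.coeff_zero]
      change (({z | z ∈ Λ.coset 0 ∧ P.logq F z = x}.ncard : ℕ) : ℤ) = 0
      rw [Nat.cast_eq_zero]
      convert Set.ncard_empty (P.CInf F)
      rw [Set.eq_empty_iff_forall_notMem]
      rintro z ⟨⟨hz, hz0⟩, -⟩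
      rw [sub_zero] at hz
      exact hz0 (htriv z hz)
    rw [this]
    exact ⟨_, isRationalWithDerivAtOne_ofFinsupp _⟩
  push Not at htriv
  obtain ⟨z0, hz0, hz00⟩ := htriv
  obtain ⟨n, ρ, hρ⟩ := Λ.exists_representatives ha0
  obtain ⟨N, hN⟩ := exists_coeff_Z_eq ha0 hρ
  -- If `n = 1` then `a Λ = Λ`, and dividing a shortest nonzero element by `a` gives a shorter one.
  -- This matters because the denominator `1 - n * S ^ δ` takes the value `1 - n` at `S = 1`.
  have hn : n ≠ 1 := by
    rintro rfl
    have hsurj : ∀ z ∈ Λ.carrier, ∃ w ∈ Λ.carrier, a • w = z := by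
      intro z hz
      obtain ⟨⟨i, w⟩, h⟩ := hρ.2 ⟨z, hz⟩
      obtain ⟨⟨j, w'⟩, h'⟩ := hρ.2 0
      obtain rfl := Subsingleton.elim i j
      refine ⟨w - w', sub_mem w.2 w'.2, ?_⟩
      have h2 : a • (w - w') = (⟨z, hz⟩ : Λ.carrier) := by
        rw [smul_sub, ← add_sub_add_left_eq_sub _ _ (ρ i)]
        exact (congrArg₂ _ h h').trans (sub_zero _)
      exact congrArg Subtype.val h2
    obtain ⟨z, ⟨⟨hz, hz1⟩, hz2⟩, hmin⟩ := Set.exists_min_image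
      ({z | z ∈ Λ.carrier ∧ ‖z‖ ≤ ‖z0‖} \ {0}) norm ((Λ.discrete ‖z0‖).subset Set.sdiff_subset)
      ⟨z0, ⟨hz0, le_rfl⟩, hz00⟩
    obtain ⟨w, hw, hwz⟩ := hsurj z hz
    have hz0' : z ≠ 0 := hz2
    have hw0 : w ≠ 0 := by rintro rfl; exact hz0' (by rw [← hwz, smul_zero])
    have hlt : ‖w‖ < ‖z‖ := by
      rw [← hwz, norm_coeffRing_smul]
      exact (lt_mul_iff_one_lt_left (norm_pos_iff.2 hw0)).2 ha
    exact (hmin w ⟨⟨hw, hlt.le.trans hz1⟩, hw0⟩).not_gt hlt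
  set δ := P.logq F (algebraMap K (P.CInf F) a) with hδ
  let s : ℚ →₀ ℤ := Finsupp.single 0 1 - Finsupp.single δ (n : ℤ)
  have hs : HahnSeries.ofFinsupp s = 1 - HahnSeries.single δ (n : ℤ) := by
    rw [eq_sub_iff_add_eq, ← ofFinsupp_single, ← ofFinsupp_add, sub_add_cancel, ofFinsupp_single,
      HahnSeries.single_zero_one]
  have hc : ∀ x, (Λ.Z 0 * HahnSeries.ofFinsupp s).coeff x =
      (Λ.Z 0).coeff x - n * (Λ.Z 0).coeff (x - δ) := by
    intro x
    rw [hs, mul_sub, mul_one, HahnSeries.coeff_sub]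
    conv_lhs => rw [← sub_add_cancel x δ, HahnSeries.coeff_mul_single_add, sub_add_cancel]
    rw [mul_comm]
  -- Above `N` the recursion makes the coefficients vanish; below `N` only finitely many exponents
  -- of `Z` and of its shift by `δ` occur.
  have hsupp : (Function.support (Λ.Z 0 * HahnSeries.ofFinsupp s).coeff).Finite := by
    refine ((Λ.truncZ 0 N).support.finite_toSet.union
      ((Λ.truncZ 0 (N - δ)).support.finite_toSet.image (· + δ))).subset fun x hx => ?_
    rw [Function.mem_support, hc] at hx
    have hxN : x ≤ N := by
      by_contra h
      rw [hN x (not_le.1 h), sub_self] at hx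
      exact hx rfl
    by_cases h : (Λ.Z 0).coeff x = 0
    · right
      refine ⟨x - δ, ?_, sub_add_cancel x δ⟩
      rw [Finset.mem_coe, Finsupp.mem_support_iff, truncZ_apply, if_pos (by linarith)]
      intro h'
      rw [h, h', mul_zero, sub_zero] at hx
      exact hx rfl
    · left
      rwa [Finset.mem_coe, Finsupp.mem_support_iff, truncZ_apply, if_pos hxN]
  refine ⟨_, Finsupp.ofSupportFinite _ hsupp, s, ?_, ?_, rfl⟩
  · have h1 := valueAtOne_add s (Finsupp.single δ (n : ℤ))
    rw [sub_add_cancel, valueAtOne_single, valueAtOne_single] at h1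
    intro h2
    rw [h2, zero_add] at h1
    exact hn (by exact_mod_cast h1.symm)
  · ext x
    rfl

theorem exists_isRational_Z (u : P.CInf F) : ∃ D, IsRationalWithDerivAtOne (Λ.Z u) D := by
  obtain ⟨N, hN⟩ := exists_rat_le_rpow F ‖u‖
  obtain ⟨D, hD⟩ := exists_isRational_Z_zero (Λ := Λ)
  rw [Z_eq_add hN]
  exact ⟨_, hD.add (isRationalWithDerivAtOne_ofFinsupp _)⟩

/-- The poorly controlled tails of the two series cancel, leaving the exponents that the partial
products of `exp u` contribute to `π`. -/
theorem ZDeriv_sub_ZDeriv_zero {u : P.CInf F} {N : ℚ} (hu : ‖u‖ ≤ (Nat.card F : ℝ) ^ (N : ℝ)) :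
    Λ.ZDeriv u - Λ.ZDeriv 0 =
      ∑ z ∈ Λ.cosetFinset u N, P.logq F z - ∑ z ∈ Λ.cosetFinset 0 N, P.logq F z := by
  have h := (isRational_ZDeriv (exists_isRational_Z_zero (Λ := Λ))).add
    (isRationalWithDerivAtOne_ofFinsupp (Λ.truncZ u N - Λ.truncZ 0 N))
  rw [← Z_eq_add hu] at h
  rw [ZDeriv_eq h, derivAtOne_sub, derivAtOne_truncZ, derivAtOne_truncZ]
  ring

end Lattice
end Place
end

/-! ### Convergence of the products of one-units -/

noncomputable section
namespace Place
namespace Lattice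
variable {F : Type*} {K : Type*} [Field F] [Finite F] [Field K] [Algebra F K]
  [IsGlobalFunctionField F K] {P : Place K} {Λ Λ' : P.Lattice F} {π : K} (ϖ : P.RootSystem F π)

theorem exists_bound_oneUnit_finset (hπ : P.v π = WithZero.exp (-1)) (s : Finset (P.CInf F))
    (hs : ∀ z ∈ s, z ≠ 0) : ∃ ρ : ℝ, 0 ≤ ρ ∧ ρ < 1 ∧ ∀ z ∈ s, ‖ϖ.oneUnit z - 1‖ ≤ ρ := by
  classical
  induction s using Finset.induction_on with
  | empty => exact ⟨0, le_rfl, one_pos, by simp⟩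
  | insert z s _ ih =>
    obtain ⟨ρ, h0, h1, h2⟩ := ih fun w hw => hs w (Finset.mem_insert_of_mem hw)
    refine ⟨max ρ ‖ϖ.oneUnit z - 1‖, le_max_of_le_left h0,
      max_lt h1 (ϖ.norm_oneUnit_sub_one_lt hπ (hs z (Finset.mem_insert_self z s))), fun w hw => ?_⟩
    rcases Finset.mem_insert.1 hw with rfl | hw
    · exact le_max_right _ _
    · exact (h2 w hw).trans (le_max_left _ _)

theorem norm_oneUnit_add_sub_one_le (hπ : P.v π = WithZero.exp (-1)) {z u : P.CInf F} {ρ : ℝ}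
    (hρ : ρ ≤ 1) (h : ‖u‖ < ‖z‖) (h1 : ‖ϖ.oneUnit z - 1‖ ≤ ρ) (h2 : ‖u‖ / ‖z‖ ≤ ρ) :
    ‖ϖ.oneUnit (z + u) - 1‖ ≤ ρ := by
  rw [ϖ.oneUnit_add hπ h]
  refine norm_mul_sub_one_le hρ h1 ?_
  rwa [RootSystem.norm_one_add_div_sub_one]

/-- The one-unit parts of the lattice elements stay away from the boundary of the unit ball. -/
theorem exists_bound_oneUnit_lattice (hπ : P.v π = WithZero.exp (-1)) (Λ : P.Lattice F) :
    ∃ ρ : ℝ, 0 ≤ ρ ∧ ρ < 1 ∧ ∀ z ∈ Λ.carrier, z ≠ 0 → ‖ϖ.oneUnit z - 1‖ ≤ ρ := by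
  classical
  have hbase : ∀ R : ℝ, ∃ ρ : ℝ, 0 ≤ ρ ∧ ρ < 1 ∧
      ∀ z ∈ Λ.carrier, z ≠ 0 → ‖z‖ ≤ R → ‖ϖ.oneUnit z - 1‖ ≤ ρ := by
    intro R
    obtain ⟨ρ, h0, h1, h2⟩ := exists_bound_oneUnit_finset ϖ hπ ((Λ.discrete R).toFinset.erase 0)
      fun z hz => (Finset.mem_erase.1 hz).1
    exact ⟨ρ, h0, h1, fun z hz hz0 hzR => h2 z (Finset.mem_erase.2 ⟨hz0, by simpa using ⟨hz, hzR⟩⟩)⟩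
  rcases Λ.finite_or_exists_one_lt_norm with hfin | ⟨a, ha0, ha⟩
  · obtain ⟨R, hR⟩ := (hfin.image norm).bddAbove
    obtain ⟨ρ, h0, h1, h2⟩ := hbase R
    exact ⟨ρ, h0, h1, fun z hz hz0 => h2 z hz hz0 (hR ⟨z, hz, rfl⟩)⟩
  obtain ⟨n, r, hr⟩ := Λ.exists_representatives ha0
  set α := algebraMap K (P.CInf F) a with hα
  have hα0 : α ≠ 0 := norm_pos_iff.1 (zero_lt_one.trans ha)
  have hsmul : ∀ z : P.CInf F, a • z = α * z := fun z => Algebra.smul_def _ _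
  obtain ⟨R', hR'⟩ := (Set.finite_range fun i => ‖(r i : P.CInf F)‖).bddAbove
  set R := max R' 0 with hR
  have hR0 : 0 ≤ R := le_max_right _ _
  have hrR : ∀ i, ‖(r i : P.CInf F)‖ ≤ R := fun i => (hR' ⟨i, rfl⟩).trans (le_max_left _ _)
  obtain ⟨ρ1, h0, h1, h2⟩ := hbase (R + 1)
  -- The three entries bound the contributions of short lattice elements, of `α` itself, and of the
  -- correction `1 + r i / (α * w)` when `|α * w| > R + 1`.
  set ρ := max ρ1 (max ‖ϖ.oneUnit α - 1‖ (R / (R + 1))) with hρ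
  have hρ1 : ρ < 1 := max_lt h1 (max_lt (ϖ.norm_oneUnit_sub_one_lt hπ hα0)
    ((div_lt_one (by positivity)).2 (by linarith)))
  refine ⟨ρ, le_max_of_le_left h0, hρ1, ?_⟩
  -- Induction over shells of ratio `|α|`: a large `z = r i + α * w` has `w` in the previous shell.
  -- By the ultrametric inequality the bounds for the three factors do not accumulate.
  have key : ∀ k : ℕ, ∀ z ∈ Λ.carrier, z ≠ 0 → ‖z‖ ≤ (R + 1) * ‖α‖ ^ k → ‖ϖ.oneUnit z - 1‖ ≤ ρ := by
    intro k
    induction k with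
    | zero =>
      intro z hz hz0 hzR
      exact (h2 z hz hz0 (by simpa using hzR)).trans (le_max_left _ _)
    | succ k ih =>
      intro z hz hz0 hzR
      by_cases hsmall : ‖z‖ ≤ R + 1
      · exact (h2 z hz hz0 hsmall).trans (le_max_left _ _)
      push Not at hsmall
      obtain ⟨⟨i, w⟩, hiw⟩ := hr.2 ⟨z, hz⟩
      have hiw' : (r i : P.CInf F) + α * w = z := by
        rw [← hsmul]; exact congrArg Subtype.val hiw
      have hlt : ‖(r i : P.CInf F)‖ < ‖z‖ := (hrR i).trans_lt ((lt_add_one R).trans hsmall)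
      have h3 : α * (w : P.CInf F) = -(r i : P.CInf F) + z := by rw [← hiw']; ring
      have h4 : ‖α * (w : P.CInf F)‖ = ‖z‖ := by
        rw [h3]; exact norm_add_eq_right_of_lt (by rwa [norm_neg])
      have h5 : α * (w : P.CInf F) ≠ 0 := norm_pos_iff.1 (by rw [h4]; exact norm_pos_iff.2 hz0)
      have hw0 : (w : P.CInf F) ≠ 0 := right_ne_zero_of_mul h5
      rw [← hiw', add_comm]
      refine norm_oneUnit_add_sub_one_le ϖ hπ hρ1.le (by rwa [h4]) ?_ ?_
      · rw [ϖ.oneUnit_mul hπ hα0 hw0]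
        refine norm_mul_sub_one_le hρ1.le
          ((le_max_left _ _).trans (le_max_right _ _)) (ih w w.2 hw0 ?_)
        rw [← h4, norm_mul, pow_succ, ← mul_assoc, mul_comm ‖α‖] at hzR
        exact le_of_mul_le_mul_right hzR (norm_pos_iff.2 hα0)
      · rw [h4]
        refine le_trans ?_ ((le_max_right _ _).trans (le_max_right _ _))
        exact div_le_div₀ hR0 (hrR i) (by positivity) hsmall.le
  intro z hz hz0
  obtain ⟨k, hk⟩ := pow_unbounded_of_one_lt ‖z‖ ha
  refine key k z hz hz0 (hk.le.trans ?_)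
  exact le_mul_of_one_le_left (by positivity) (by linarith)

/-- Elements of the coset with `|z| > 2 |u|` differ from a lattice element by the relative error
`|u| / |z| ≤ 1 / 2`; the others are finite in number. -/
theorem exists_bound_oneUnit_coset (hπ : P.v π = WithZero.exp (-1)) (Λ : P.Lattice F) (u : P.CInf F) :
    ∃ ρ : ℝ, 0 ≤ ρ ∧ ρ < 1 ∧ ∀ z, z - u ∈ Λ.carrier → z ≠ 0 → ‖ϖ.oneUnit z - 1‖ ≤ ρ := by
  obtain ⟨N, hN⟩ := exists_rat_le_rpow F (2 * ‖u‖)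
  obtain ⟨ρ1, h0, h1, h2⟩ := exists_bound_oneUnit_finset ϖ hπ (Λ.cosetFinset u N)
    fun z hz => (mem_cosetFinset.1 hz).2.1
  obtain ⟨ρ2, h3, h4, h5⟩ := exists_bound_oneUnit_lattice ϖ hπ Λ
  have hlt : max ρ1 (max ρ2 (1 / 2)) < 1 := max_lt h1 (max_lt h4 (by norm_num))
  refine ⟨max ρ1 (max ρ2 (1 / 2)), le_max_of_le_left h0, hlt, fun z hz hz0 => ?_⟩
  by_cases hle : ‖z‖ ≤ (Nat.card F : ℝ) ^ (N : ℝ)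
  · exact (h2 z (mem_cosetFinset'.2 ⟨hz, hz0, hle⟩)).trans (le_max_left _ _)
  have hz1 : 2 * ‖u‖ < ‖z‖ := hN.trans_lt (not_le.1 hle)
  have hz2 : ‖u‖ < ‖z‖ := by linarith [norm_nonneg u]
  have h6 : ‖z - u‖ = ‖z‖ := by
    rw [← neg_add_eq_sub]; exact norm_add_eq_right_of_lt (by rwa [norm_neg])
  have h7 : z - u ≠ 0 := norm_pos_iff.1 (by rw [h6]; exact norm_pos_iff.2 hz0)
  rw [← sub_add_cancel z u]
  refine norm_oneUnit_add_sub_one_le ϖ hπ hlt.le (by rwa [h6]) ((h5 _ hz h7).trans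
    ((le_max_left _ _).trans (le_max_right _ _)))
    (le_trans ?_ ((le_max_right _ _).trans (le_max_right _ _)))
  rw [h6, div_le_div_iff₀ (norm_pos_iff.2 hz0) two_pos]
  linarith

/-- The product of the one-unit parts over a finite set that is stable under translation by a finite
subspace of small elements. -/
theorem norm_prod_oneUnit_sub_one_le (hπ : P.v π = WithZero.exp (-1)) (V : Submodule F (P.CInf F))
    [Fintype V] (s : Finset (P.CInf F)) (hs : ∀ z ∈ s, ∀ v ∈ V, z + v ∈ s) {ρ ε : ℝ} (hε1 : ε ≤ 1)
    (hε : 0 ≤ ε) (hV : ρ ^ Nat.card V ≤ ε) (h0 : ∀ z ∈ s, ‖ϖ.oneUnit z - 1‖ ≤ ρ)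
    (hlt : ∀ z ∈ s, ∀ v ∈ V, ‖v‖ < ‖z‖) (hsmall : ∀ z ∈ s, ∀ v ∈ V, ‖v‖ / ‖z‖ ≤ ε) :
    ‖∏ z ∈ s, ϖ.oneUnit z - 1‖ ≤ ε := by
  classical
  -- Group by classes modulo `V`. The product over `z + V` is `⟨z⟩ ^ |V| * ∏ (1 + v / z)`, and `⟨z⟩
  -- ^ |V| - 1 = (⟨z⟩ - 1) ^ |V|` since `|V|` is a power of `q`.
  rw [← Finset.prod_fiberwise_of_maps_to (s := s) (t := s.image V.mkQ) (g := V.mkQ)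
    fun z hz => Finset.mem_image_of_mem _ hz]
  refine norm_prod_sub_one_le _ _ hε hε1 fun y hy => ?_
  obtain ⟨z, hz, rfl⟩ := Finset.mem_image.1 hy
  have hfib : s.filter (fun w => V.mkQ w = V.mkQ z) = Finset.univ.image fun v : V => z + v := by
    ext w
    rw [Finset.mem_filter, Finset.mem_image]
    constructor
    · rintro ⟨-, h⟩
      rw [Submodule.mkQ_apply, Submodule.mkQ_apply, Submodule.Quotient.eq] at h
      exact ⟨⟨w - z, h⟩, Finset.mem_univ _, add_sub_cancel z w⟩
    · rintro ⟨v, -, rfl⟩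
      refine ⟨hs z hz v v.2, ?_⟩
      rw [Submodule.mkQ_apply, Submodule.mkQ_apply, Submodule.Quotient.eq, add_sub_cancel_left]
      exact v.2
  rw [hfib, Finset.prod_image fun v _ w _ h => Subtype.ext (add_left_cancel h),
    Finset.prod_congr rfl fun (v : V) _ => ϖ.oneUnit_add hπ (hlt z hz v v.2), Finset.prod_mul_distrib,
    Finset.prod_const, Finset.card_univ, ← Nat.card_eq_fintype_card]
  refine norm_mul_sub_one_le hε1 ?_ (norm_prod_sub_one_le _ _ hε hε1 fun v _ => ?_)
  · rw [Module.natCard_eq_pow_finrank (K := F)] at hV ⊢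
    have h1 := sub_pow_natCard_pow F (Module.finrank F V) (ϖ.oneUnit z) 1
    rw [one_pow] at h1
    rw [← h1, norm_pow]
    exact (pow_le_pow_left₀ (norm_nonneg _) (h0 z hz) _).trans hV
  · rw [RootSystem.norm_one_add_div_sub_one]
    exact hsmall z hz v v.2

theorem partialU_eq (u : P.CInf F) (N : ℚ) :
    Λ.partialU ϖ u N = ∏ z ∈ Λ.cosetFinset u N, ϖ.oneUnit z := finprod_cosetLE u N _

theorem norm_partialU_sub_one_lt (hπ : P.v π = WithZero.exp (-1)) (u : P.CInf F) (N : ℚ) :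
    ‖Λ.partialU ϖ u N - 1‖ < 1 := by
  obtain ⟨ρ, h0, h1, h2⟩ := exists_bound_oneUnit_finset ϖ hπ (Λ.cosetFinset u N)
    fun z hz => (mem_cosetFinset.1 hz).2.1
  rw [partialU_eq]
  exact (norm_prod_sub_one_le _ _ h0 h1.le h2).trans_lt h1

theorem exists_le_card_ball (h : (Λ.carrier : Set (P.CInf F)).Infinite) (n : ℕ) :
    ∃ M : ℚ, n ≤ Nat.card (Λ.ball M) := by
  obtain ⟨s, hs, hcard⟩ := h.exists_subset_card_eq n
  obtain ⟨R, hR⟩ := (s.finite_toSet.image norm).bddAbove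
  obtain ⟨M, hM⟩ := exists_rat_le_rpow F R
  refine ⟨M, ?_⟩
  rw [← hcard]
  have hsub : (s : Set (P.CInf F)) ⊆ Λ.ball M := fun z hz => ⟨hs hz, (hR ⟨z, hz, rfl⟩).trans hM⟩
  have h1 := Set.ncard_le_ncard hsub (Λ.discrete _)
  rwa [Set.ncard_coe_finset] at h1

/-- In an infinite lattice, first take a ball `V` with `ρ ^ |V|` below `ε`, then `N` so large that
`V` is small relative to all elements beyond `q ^ N`. The remaining shell is stable under `V`. A
finite lattice has empty shells for large `N`. -/
theorem exists_norm_partialU_sub_lt (hπ : P.v π = WithZero.exp (-1)) (u : P.CInf F) {ε : ℝ}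
    (hε : 0 < ε) (hε1 : ε ≤ 1) :
    ∃ N : ℚ, ∀ M, N ≤ M → ‖Λ.partialU ϖ u M - Λ.partialU ϖ u N‖ ≤ ε := by
  classical
  have hred : ∀ N M : ℚ, N ≤ M →
      ‖∏ z ∈ Λ.cosetFinset u M \ Λ.cosetFinset u N, ϖ.oneUnit z - 1‖ ≤ ε →
      ‖Λ.partialU ϖ u M - Λ.partialU ϖ u N‖ ≤ ε := by
    intro N M hNM h
    have h1 := norm_eq_one_of_norm_sub_one_lt (norm_partialU_sub_one_lt (Λ := Λ) ϖ hπ u N)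
    have h2 : Λ.partialU ϖ u M - Λ.partialU ϖ u N = Λ.partialU ϖ u N *
        (∏ z ∈ Λ.cosetFinset u M \ Λ.cosetFinset u N, ϖ.oneUnit z - 1) := by
      rw [partialU_eq, partialU_eq, ← Finset.prod_sdiff (cosetFinset_mono u hNM)]
      ring
    rwa [h2, norm_mul, h1, one_mul]
  by_cases hinf : (Λ.carrier : Set (P.CInf F)).Infinite
  · obtain ⟨ρ, h0, h1, h2⟩ := exists_bound_oneUnit_coset ϖ hπ Λ u
    obtain ⟨n, hn⟩ := exists_pow_lt_of_lt_one hε h1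
    obtain ⟨M0, hM0⟩ := exists_le_card_ball hinf n
    obtain ⟨N, hN⟩ := exists_rat_le_rpow F ((Nat.card F : ℝ) ^ (M0 : ℝ) / ε)
    have hq0 := rpow_natCard_pos (F := F) M0
    refine ⟨N, fun M hNM => hred N M hNM ?_⟩
    have hmem : ∀ z, z ∈ Λ.cosetFinset u M \ Λ.cosetFinset u N ↔
        z - u ∈ Λ.carrier ∧ z ≠ 0 ∧ ‖z‖ ≤ (Nat.card F : ℝ) ^ (M : ℝ) ∧
          (Nat.card F : ℝ) ^ (N : ℝ) < ‖z‖ := by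
      intro z
      rw [Finset.mem_sdiff, mem_cosetFinset', mem_cosetFinset', ← not_le]
      tauto
    have hbig : ∀ z ∈ Λ.cosetFinset u M \ Λ.cosetFinset u N, ∀ v ∈ Λ.ball M0,
        ‖v‖ < ‖z‖ ∧ ‖v‖ / ‖z‖ ≤ ε := by
      intro z hz v hv
      obtain ⟨-, hz0, -, hz3⟩ := (hmem z).1 hz
      have h3 := hN.trans_lt hz3
      rw [div_lt_iff₀ hε] at h3
      have h4 : ‖v‖ < ‖z‖ * ε := hv.2.trans_lt h3
      refine ⟨h4.trans_le (mul_le_of_le_one_right (norm_nonneg _) hε1), ?_⟩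
      rw [div_le_iff₀ (norm_pos_iff.2 hz0), mul_comm]
      exact h4.le
    refine norm_prod_oneUnit_sub_one_le ϖ hπ (Λ.ball M0) _ ?_ hε1 hε.le (ρ := ρ) ?_ ?_
      (fun z hz v hv => (hbig z hz v hv).1) (fun z hz v hv => (hbig z hz v hv).2)
    · intro z hz v hv
      have h3 := norm_add_eq_right_of_lt (hbig z hz v hv).1
      rw [add_comm] at h3
      obtain ⟨hz1, hz0, hz2, hz3⟩ := (hmem z).1 hz
      refine (hmem _).2 ⟨?_, norm_pos_iff.1 (by rw [h3]; exact norm_pos_iff.2 hz0), by rwa [h3],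
        by rwa [h3]⟩
      rw [add_sub_right_comm]
      exact add_mem hz1 hv.1
    · exact (pow_le_pow_of_le_one h0 h1.le hM0).trans hn.le
    · intro z hz
      obtain ⟨hz1, hz0, -⟩ := (hmem z).1 hz
      exact h2 z hz1 hz0
  · rw [Set.not_infinite] at hinf
    obtain ⟨N, hN⟩ := ((hinf.image (· + u)).image (P.logq F)).bddAbove
    refine ⟨N, fun M hNM => hred N M hNM ?_⟩
    have : Λ.cosetFinset u M \ Λ.cosetFinset u N = ∅ := by
      rw [Finset.sdiff_eq_empty_iff_subset]
      intro z hz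
      rw [mem_cosetFinset] at hz ⊢
      exact ⟨hz.1, hz.2.1, hN ⟨z, ⟨z - u, hz.1, sub_add_cancel z u⟩, rfl⟩⟩
    rw [this, Finset.prod_empty, sub_self, norm_zero]
    exact hε.le

theorem tendsto_partialU (hπ : P.v π = WithZero.exp (-1)) (u : P.CInf F) :
    Filter.Tendsto (Λ.partialU ϖ u) Filter.atTop (nhds (Λ.U ϖ u)) := by
  have hc : CauchySeq (Λ.partialU ϖ u) := by
    rw [Metric.cauchySeq_iff']
    intro ε hε
    obtain ⟨N, hN⟩ := exists_norm_partialU_sub_lt (Λ := Λ) ϖ hπ u (ε := min 1 (ε / 2))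
      (by positivity) (min_le_left _ _)
    refine ⟨N, fun M hM => ?_⟩
    rw [dist_eq_norm]
    exact ((hN M hM).trans (min_le_right _ _)).trans_lt (half_lt_self hε)
  exact tendsto_nhds_limUnder (cauchySeq_tendsto_of_complete hc)

theorem norm_U_sub_one_lt (hπ : P.v π = WithZero.exp (-1)) (u : P.CInf F) :
    ‖Λ.U ϖ u - 1‖ < 1 := by
  have h := tendsto_partialU (Λ := Λ) ϖ hπ u
  obtain ⟨N, hN⟩ := (Metric.tendsto_nhds.1 h 1 one_pos).exists
  rw [dist_comm, dist_eq_norm] at hN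
  rw [← sub_add_sub_cancel (Λ.U ϖ u) (Λ.partialU ϖ u N) 1]
  exact (IsUltrametricDist.norm_add_le_max _ _).trans_lt
    (max_lt hN (norm_partialU_sub_one_lt ϖ hπ u N))

theorem U_ne_zero (hπ : P.v π = WithZero.exp (-1)) (u : P.CInf F) : Λ.U ϖ u ≠ 0 :=
  norm_pos_iff.1 (by
    rw [norm_eq_one_of_norm_sub_one_lt (norm_U_sub_one_lt ϖ hπ u)]; exact one_pos)

end Lattice
end Place
end

/-! ### The exponential function and its values at division points -/

theorem isOfFinOrder_prod {C ι : Type*} [CommMonoid C] (s : Finset ι) (f : ι → C)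
    (h : ∀ i ∈ s, IsOfFinOrder (f i)) : IsOfFinOrder (∏ i ∈ s, f i) := by
  classical
  induction s using Finset.induction_on with
  | empty => simp
  | insert i s hi ih =>
    rw [Finset.prod_insert hi]
    exact (h i (Finset.mem_insert_self i s)).mul (ih fun j hj => h j (Finset.mem_insert_of_mem hj))

theorem isOfFinOrder_inv₀ {C : Type*} [Field C] {x : C} (h : IsOfFinOrder x) :
    IsOfFinOrder x⁻¹ := by
  rw [isOfFinOrder_iff_pow_eq_one] at h ⊢
  obtain ⟨n, hn, h⟩ := h
  exact ⟨n, hn, by rw [inv_pow, h, inv_one]⟩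

noncomputable section
namespace Place
namespace Lattice
variable {F : Type*} {K : Type*} [Field F] [Finite F] [Field K] [Algebra F K]
  [IsGlobalFunctionField F K] {P : Place K} {Λ Λ' : P.Lattice F}

theorem multipliable_exp (Λ : P.Lattice F) (z : P.CInf F) :
    Multipliable fun l : {l : P.CInf F // l ∈ Λ.carrier ∧ l ≠ 0} => 1 - z / (l : P.CInf F) := by
  simp only [sub_eq_add_neg]
  apply multipliable_one_add_of_tendsto_cofinite
  rw [Metric.tendsto_nhds]
  intro ε hε
  rw [Filter.eventually_cofinite]
  refine ((Λ.discrete (‖z‖ / ε)).preimage Subtype.val_injective.injOn).subset ?_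
  rintro ⟨l, hl, hl0⟩ h
  refine ⟨hl, ?_⟩
  have h' : ε ≤ ‖z‖ / ‖l‖ := by simpa using h
  rw [le_div_iff₀ (norm_pos_iff.2 hl0), mul_comm] at h'
  rwa [le_div_iff₀ hε]

variable (Λ) in
/-- The partial product of the exponential function over the lattice elements with `log l ≤ N`. -/
def partialExp (N : ℚ) (z : P.CInf F) : P.CInf F := z * ∏ l ∈ Λ.cosetFinset 0 N, (1 - z / l)

theorem mem_cosetFinset_zero {N : ℚ} {l : P.CInf F} (h : l ∈ Λ.cosetFinset 0 N) :
    l ∈ Λ.carrier ∧ l ≠ 0 := by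
  rw [mem_cosetFinset, sub_zero] at h
  exact ⟨h.1, h.2.1⟩

theorem tendsto_partialExp (z : P.CInf F) :
    Filter.Tendsto (fun N => Λ.partialExp N z) Filter.atTop (nhds (Λ.exp z)) := by
  classical
  refine Filter.Tendsto.const_mul z ?_
  have h := (Λ.multipliable_exp z).hasProd
  have ht : Filter.Tendsto (fun N : ℚ => (Λ.cosetFinset 0 N).subtype fun l => l ∈ Λ.carrier ∧ l ≠ 0)
      Filter.atTop Filter.atTop := by
    refine Filter.tendsto_atTop_finset_of_monotone
      (fun M N hMN => Finset.subtype_mono (cosetFinset_mono 0 hMN)) ?_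
    rintro ⟨l, hl, hl0⟩
    exact ⟨P.logq F l, by rw [Finset.mem_subtype, mem_cosetFinset, sub_zero]; exact ⟨hl, hl0, le_rfl⟩⟩
  refine (h.comp ht).congr fun N => ?_
  exact Finset.prod_subtype_of_mem (fun l => 1 - z / l) fun l hl => mem_cosetFinset_zero hl

theorem prod_ball {M : Type*} [CommMonoid M] (N : ℚ) (f : P.CInf F → M) :
    ∏ v : Λ.ball N, f v = f 0 * ∏ l ∈ Λ.cosetFinset 0 N, f l := by
  classical
  have h0 : (0 : P.CInf F) ∉ Λ.cosetFinset 0 N := fun h => (mem_cosetFinset_zero h).2 rfl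
  rw [← Finset.prod_insert h0]
  symm
  refine Finset.prod_subtype _ (fun x => ?_) f
  rw [Finset.mem_insert, mem_cosetFinset', sub_zero, mem_ball]
  constructor
  · rintro (rfl | ⟨h1, -, h3⟩)
    · exact (Λ.ball N).zero_mem
    · exact ⟨h1, h3⟩
  · rintro ⟨h1, h2⟩
    by_cases hx : x = 0
    · exact Or.inl hx
    · exact Or.inr ⟨h1, hx, h2⟩

theorem prod_coset {M : Type*} [CommMonoid M] {u : P.CInf F} (hu : u ∉ Λ.carrier) {N : ℚ}
    (hN : ‖u‖ ≤ (Nat.card F : ℝ) ^ (N : ℝ)) (f : P.CInf F → M) :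
    ∏ z ∈ Λ.cosetFinset u N, f z = ∏ v : Λ.ball N, f (u + v) := by
  classical
  have h1 : Λ.cosetFinset u N = Finset.univ.image fun v : Λ.ball N => u + v := by
    ext z
    rw [mem_cosetFinset', Finset.mem_image]
    constructor
    · rintro ⟨h1, -, h3⟩
      exact ⟨⟨z - u, h1, (norm_sub_le_max _ _).trans (max_le h3 hN)⟩, Finset.mem_univ _,
        add_sub_cancel u z⟩
    · rintro ⟨v, -, rfl⟩
      refine ⟨by rw [add_sub_cancel_left]; exact v.2.1, fun h => hu ?_,
        (IsUltrametricDist.norm_add_le_max _ _).trans (max_le hN v.2.2)⟩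
      rw [eq_neg_of_add_eq_zero_left h]
      exact neg_mem v.2.1
  rw [h1, Finset.prod_image fun v _ w _ h => Subtype.ext (add_left_cancel h)]

variable (Λ) in
/-- The additive polynomial whose zeros are the lattice elements with `log l ≤ N`. -/
def ballPoly (N : ℚ) (z : P.CInf F) : P.CInf F := ∏ v : Λ.ball N, (z - v)

theorem ballPoly_eq_toLinearMap (N : ℚ) (z : P.CInf F) :
    Λ.ballPoly N z = (isLinearized_prod_X_sub_C (Λ.ball N)).toLinearMap z := by
  rw [IsLinearized.toLinearMap_apply, Polynomial.eval_prod, ballPoly]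
  simp

theorem ballPoly_sub (N : ℚ) (z w : P.CInf F) :
    Λ.ballPoly N (z - w) = Λ.ballPoly N z - Λ.ballPoly N w := by
  simp only [ballPoly_eq_toLinearMap, map_sub]

theorem ballPoly_eq_prod_add (N : ℚ) (z : P.CInf F) :
    Λ.ballPoly N z = ∏ v : Λ.ball N, (z + v) := by
  refine Fintype.prod_equiv (Equiv.neg _) _ _ fun v => ?_
  simp [sub_eq_add_neg]

theorem ballPoly_ne_zero {u : P.CInf F} (hu : u ∉ Λ.carrier) (N : ℚ) : Λ.ballPoly N u ≠ 0 := by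
  refine Finset.prod_ne_zero_iff.2 fun v _ h => hu ?_
  rw [sub_eq_zero.1 h]
  exact v.2.1

theorem prod_cosetFinset_ne_zero (u : P.CInf F) (N : ℚ) : ∏ l ∈ Λ.cosetFinset u N, l ≠ 0 :=
  Finset.prod_ne_zero_iff.2 fun _ hl => (mem_cosetFinset.1 hl).2.1

theorem partialExp_eq_div (N : ℚ) (z : P.CInf F) :
    Λ.partialExp N z = Λ.ballPoly N z / ∏ l ∈ Λ.cosetFinset 0 N, l := by
  -- The factors `1 - z / l` equal `(z - l) / (-l)`; the signs disappear because the index set is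
  -- stable under negation.
  have hneg : ∏ l ∈ Λ.cosetFinset 0 N, l = ∏ l ∈ Λ.cosetFinset 0 N, -l := by
    have hmem : ∀ l ∈ Λ.cosetFinset 0 N, -l ∈ Λ.cosetFinset 0 N := fun l hl => by
      rw [mem_cosetFinset', sub_zero] at hl ⊢
      exact ⟨neg_mem hl.1, neg_ne_zero.2 hl.2.1, by rw [norm_neg]; exact hl.2.2⟩
    exact Finset.prod_nbij' (fun l => -l) (fun l => -l) hmem hmem (by simp) (by simp) (by simp)
  rw [ballPoly, prod_ball N fun v => z - v, hneg, partialExp, sub_zero, mul_div_assoc,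
    ← Finset.prod_div_distrib]
  congr 1
  refine Finset.prod_congr rfl fun l hl => ?_
  have := (mem_cosetFinset_zero hl).2
  field_simp
  ring

theorem partialExp_add (N : ℚ) (z w : P.CInf F) :
    Λ.partialExp N (z + w) = Λ.partialExp N z + Λ.partialExp N w := by
  simp only [partialExp_eq_div, ballPoly_eq_toLinearMap, map_add, add_div]

theorem partialExp_smul (N : ℚ) (c : F) (z : P.CInf F) :
    Λ.partialExp N (c • z) = c • Λ.partialExp N z := by
  simp only [partialExp_eq_div, ballPoly_eq_toLinearMap, map_smul, smul_div_assoc]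

theorem partialExp_of_notMem {u : P.CInf F} (hu : u ∉ Λ.carrier) {N : ℚ}
    (hN : ‖u‖ ≤ (Nat.card F : ℝ) ^ (N : ℝ)) :
    Λ.partialExp N u = (∏ z ∈ Λ.cosetFinset u N, z) / ∏ l ∈ Λ.cosetFinset 0 N, l := by
  rw [partialExp_eq_div, ballPoly_eq_prod_add, prod_coset hu hN fun z => z]

variable (Λ) in
/-- The exponential function of a lattice as a linear map. -/
def expLinear : P.CInf F →ₗ[F] P.CInf F where
  toFun := Λ.exp
  map_add' z w := tendsto_nhds_unique (tendsto_partialExp (z + w))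
    (((tendsto_partialExp z).add (tendsto_partialExp w)).congr fun N => (partialExp_add N z w).symm)
  map_smul' c z := by
    refine tendsto_nhds_unique (tendsto_partialExp (c • z)) ?_
    have h := (tendsto_partialExp (Λ := Λ) z).const_mul (algebraMap F (P.CInf F) c)
    simp only [← Algebra.smul_def] at h
    exact h.congr fun N => (partialExp_smul N c z).symm

theorem expLinear_apply (z : P.CInf F) : Λ.expLinear z = Λ.exp z := rfl

theorem exp_of_mem {l : P.CInf F} (hl : l ∈ Λ.carrier) : Λ.exp l = 0 := by
  by_cases h0 : l = 0
  · rw [h0, exp, zero_mul]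
  refine tendsto_nhds_unique (tendsto_partialExp l) (tendsto_const_nhds.congr' ?_)
  filter_upwards [Filter.eventually_ge_atTop (P.logq F l)] with N hN
  rw [partialExp, Finset.prod_eq_zero (i := l), mul_zero]
  · rw [mem_cosetFinset, sub_zero]; exact ⟨hl, h0, hN⟩
  · rw [div_self h0, sub_self]

variable {π : K} (ϖ : P.RootSystem F π)

theorem partialEps_eq (u : P.CInf F) (N : ℚ) : Λ.partialEps ϖ u N =
    (∏ z ∈ Λ.cosetFinset u N, ϖ.sgn z) / ∏ z ∈ Λ.cosetFinset 0 N, ϖ.sgn z := by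
  rw [partialEps, finprod_cosetLE, finprod_cosetLE]

/-- The shells between `M` and `N` of `u + Λ` and of `Λ` correspond under translation by `u`, which
is smaller than their elements and so preserves `sgn`; their contributions cancel. -/
theorem partialEps_eq_of_le (hπ : P.v π = WithZero.exp (-1)) {u : P.CInf F} {M N : ℚ}
    (hu : ‖u‖ ≤ (Nat.card F : ℝ) ^ (M : ℝ)) (h : M ≤ N) :
    Λ.partialEps ϖ u N = Λ.partialEps ϖ u M := by
  classical
  have hmem : ∀ (y z : P.CInf F), z ∈ Λ.cosetFinset y N \ Λ.cosetFinset y M ↔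
      z - y ∈ Λ.carrier ∧ z ≠ 0 ∧ ‖z‖ ≤ (Nat.card F : ℝ) ^ (N : ℝ) ∧
        (Nat.card F : ℝ) ^ (M : ℝ) < ‖z‖ := by
    intro y z
    rw [Finset.mem_sdiff, mem_cosetFinset', mem_cosetFinset', ← not_le]
    tauto
  have hlt : ∀ y z : P.CInf F, z ∈ Λ.cosetFinset y N \ Λ.cosetFinset y M → ‖u‖ < ‖z‖ :=
    fun y z hz => hu.trans_lt ((hmem y z).1 hz).2.2.2
  have key : ∏ z ∈ Λ.cosetFinset u N \ Λ.cosetFinset u M, ϖ.sgn z =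
      ∏ z ∈ Λ.cosetFinset 0 N \ Λ.cosetFinset 0 M, ϖ.sgn z := by
    refine Finset.prod_nbij' (fun z => -u + z) (fun z => u + z) ?_ ?_ (by simp) (by simp) ?_
    · intro z hz
      have h1 := norm_add_eq_right_of_lt (x := -u) (y := z) (by rw [norm_neg]; exact hlt u z hz)
      rw [hmem] at hz ⊢
      rw [h1, ← norm_ne_zero_iff, h1, norm_ne_zero_iff, sub_zero, neg_add_eq_sub]
      exact hz
    · intro z hz
      have h1 := norm_add_eq_right_of_lt (x := u) (y := z) (hlt 0 z hz)
      rw [hmem] at hz ⊢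
      rw [h1, ← norm_ne_zero_iff, h1, norm_ne_zero_iff, add_sub_cancel_left]
      rwa [sub_zero] at hz
    · intro z hz
      rw [add_comm (-u) z, ϖ.sgn_add hπ (by rw [norm_neg]; exact hlt u z hz)]
  rw [partialEps_eq, partialEps_eq, ← Finset.prod_sdiff (cosetFinset_mono u h),
    ← Finset.prod_sdiff (cosetFinset_mono 0 h), key]
  exact mul_div_mul_left _ _ (Finset.prod_ne_zero_iff.2 fun z _ => ϖ.sgn_ne_zero z)

theorem eventually_partialEps_eq (hπ : P.v π = WithZero.exp (-1)) (u : P.CInf F) :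
    ∀ᶠ N : ℚ in Filter.atTop, Λ.partialEps ϖ u N = Λ.eps ϖ u := by
  obtain ⟨M, hM⟩ := exists_rat_le_rpow F ‖u‖
  refine Classical.epsilon_spec
    (p := fun a => ∀ᶠ N : ℚ in Filter.atTop, Λ.partialEps ϖ u N = a) ⟨Λ.partialEps ϖ u M, ?_⟩
  filter_upwards [Filter.eventually_ge_atTop M] with N hN
  exact partialEps_eq_of_le ϖ hπ hM hN

theorem isOfFinOrder_eps (hπ : P.v π = WithZero.exp (-1)) (u : P.CInf F) :
    IsOfFinOrder (Λ.eps ϖ u) := by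
  obtain ⟨N, hN⟩ := (eventually_partialEps_eq (Λ := Λ) ϖ hπ u).exists
  have h : ∀ s : Finset (P.CInf F), IsOfFinOrder (∏ z ∈ s, ϖ.sgn z) := fun s =>
    isOfFinOrder_prod s _ fun z _ => isOfFinOrder_iff_pow_eq_one.2 (ϖ.sgn_pow_eq_one z)
  rw [← hN, partialEps_eq, div_eq_mul_inv]
  exact (h _).mul (isOfFinOrder_inv₀ (h _))

theorem prod_cosetFinset_eq (hπ : P.v π = WithZero.exp (-1)) (u : P.CInf F) (N : ℚ) :
    ∏ z ∈ Λ.cosetFinset u N, z =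
      ϖ.rpow (-((∑ z ∈ Λ.cosetFinset u N, P.logq F z) / P.degree F)) *
        (∏ z ∈ Λ.cosetFinset u N, ϖ.sgn z) * Λ.partialU ϖ u N := by
  rw [partialU_eq, Finset.sum_div, ← Finset.sum_neg_distrib, ϖ.rpow_sum hπ,
    ← Finset.prod_mul_distrib, ← Finset.prod_mul_distrib]
  exact Finset.prod_congr rfl fun z _ => ϖ.eq_rpow_mul_sgn_mul_oneUnit hπ z

/-- The product formula for the division points of a lattice. -/
theorem exp_eq (hπ : P.v π = WithZero.exp (-1)) {u : P.CInf F} (hu : u ∉ Λ.carrier) :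
    Λ.exp u = ϖ.rpow (-((P.degree F : ℚ)⁻¹ * (Λ.ZDeriv u - Λ.ZDeriv 0))) *
      Λ.eps ϖ u * Λ.U ϖ u * (Λ.U ϖ 0)⁻¹ := by
  obtain ⟨M, hM⟩ := exists_rat_le_rpow F ‖u‖
  refine tendsto_nhds_unique (tendsto_partialExp u) ?_
  refine (((tendsto_partialU ϖ hπ u).const_mul (ϖ.rpow (-((P.degree F : ℚ)⁻¹ *
    (Λ.ZDeriv u - Λ.ZDeriv 0))) * Λ.eps ϖ u)).mul
    ((tendsto_partialU ϖ hπ 0).inv₀ (U_ne_zero ϖ hπ 0))).congr' ?_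
  -- For such `N` the powers of `π` and the signs in the partial product already have their final
  -- values; only the one-unit factors still vary.
  filter_upwards [Filter.eventually_ge_atTop M, eventually_partialEps_eq (Λ := Λ) ϖ hπ u]
    with N hN hε
  have hN' := hM.trans (rpow_natCard_mono hN)
  rw [partialExp_of_notMem hu hN', prod_cosetFinset_eq ϖ hπ, prod_cosetFinset_eq ϖ hπ, ← hε,
    partialEps_eq, ZDeriv_sub_ZDeriv_zero hN', mul_sub, neg_sub, sub_eq_neg_add, ϖ.rpow_add hπ,
    ← neg_neg ((P.degree F : ℚ)⁻¹ * ∑ z ∈ Λ.cosetFinset 0 N, P.logq F z), ϖ.rpow_neg hπ (-_),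
    ← div_eq_inv_mul, ← div_eq_inv_mul]
  ring

/-- Nonvanishing off the lattice is read off the product formula, each of whose factors is nonzero.
-/
theorem exp_ne_zero (hπ : P.v π = WithZero.exp (-1)) {u : P.CInf F} (hu : u ∉ Λ.carrier)
    (ϖ : P.RootSystem F π) : Λ.exp u ≠ 0 := by
  rw [exp_eq ϖ hπ hu]
  have h : Λ.eps ϖ u ≠ 0 := by
    obtain ⟨n, hn, h⟩ := isOfFinOrder_iff_pow_eq_one.1 (isOfFinOrder_eps (Λ := Λ) ϖ hπ u)
    rintro h0
    rw [h0, zero_pow hn.ne'] at h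
    exact zero_ne_one h
  exact mul_ne_zero (mul_ne_zero (mul_ne_zero (ϖ.rpow_ne_zero hπ _) h) (U_ne_zero ϖ hπ u))
    (inv_ne_zero (U_ne_zero ϖ hπ 0))

end Lattice
end Place
end

/-! ### Lattice pairs and the discriminant -/

noncomputable section
namespace Place
namespace Lattice
variable {F : Type*} {K : Type*} [Field F] [Finite F] [Field K] [Algebra F K]
  [IsGlobalFunctionField F K] {P : Place K} {Λ Λ' : P.Lattice F}

/-- On a ball smaller than every nonzero lattice element all factors `1 - z / l` are one-units, so
`exp` preserves absolute values there, and high powers of `π` have distinct images. Two polynomials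
agreeing on the range are therefore equal. -/
theorem infinite_range_exp {π : K} (hπ : P.v π = WithZero.exp (-1)) (Λ : P.Lattice F) :
    (Set.range Λ.exp).Infinite := by
  obtain ⟨r, hr0, hr⟩ : ∃ r : ℝ, 0 < r ∧ ∀ l ∈ Λ.carrier, l ≠ 0 → r < ‖l‖ := by
    by_cases h : (Λ.cosetFinset 0 0).Nonempty
    · obtain ⟨m, hm, hmin⟩ := Finset.exists_min_image _ norm h
      have hm0 := norm_pos_iff.2 (mem_cosetFinset_zero hm).2
      refine ⟨‖m‖ / 2, half_pos hm0, fun l hl hl0 => ?_⟩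
      by_contra! hle
      have hlm : ‖l‖ < ‖m‖ := hle.trans_lt (half_lt_self hm0)
      refine (hmin l ?_).not_gt hlm
      rw [mem_cosetFinset', sub_zero] at hm ⊢
      exact ⟨hl, hl0, hlm.le.trans hm.2.2⟩
    · refine ⟨1, one_pos, fun l hl hl0 => ?_⟩
      by_contra! hle
      refine h ⟨l, ?_⟩
      rw [mem_cosetFinset', sub_zero]
      exact ⟨hl, hl0, by simpa using hle⟩
  have hnorm : ∀ z : P.CInf F, ‖z‖ ≤ r → ‖Λ.exp z‖ = ‖z‖ := by
    intro z hz
    refine tendsto_nhds_unique (tendsto_partialExp z).norm (tendsto_const_nhds.congr fun N => ?_)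
    rw [partialExp, norm_mul, norm_prod, Finset.prod_eq_one, mul_one]
    intro l hl
    obtain ⟨hl, hl0⟩ := mem_cosetFinset_zero hl
    apply norm_eq_one_of_norm_sub_one_lt
    rw [sub_sub_cancel_left, norm_neg, norm_div, div_lt_one (norm_pos_iff.2 hl0)]
    exact hz.trans_lt (hr l hl hl0)
  set t := algebraMap K (P.CInf F) π with ht
  have ht1 : ‖t‖ < 1 := by
    rw [ht, norm_algebraMap, abv_lt_one_iff, hπ, ← WithZero.exp_zero, WithZero.exp_lt_exp]
    norm_num
  have ht0 : 0 < ‖t‖ := by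
    rw [ht, RootSystem.norm_algebraMap_uniformizer hπ]
    exact Real.rpow_pos_of_pos (zero_lt_one.trans one_lt_natCard_real) _
  obtain ⟨n, hn⟩ := exists_pow_lt_of_lt_one hr0 ht1
  have hle : ∀ k, ‖t ^ (n + k)‖ ≤ r := fun k => by
    rw [norm_pow]
    exact (pow_le_pow_of_le_one ht0.le ht1.le (Nat.le_add_right n k)).trans hn.le
  refine Set.infinite_of_injective_forall_mem (f := fun k : ℕ => Λ.exp (t ^ (n + k))) ?_
    fun k => ⟨_, rfl⟩
  intro j k h
  have h1 := congrArg norm h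
  dsimp only at h1
  rw [hnorm _ (hle j), hnorm _ (hle k), norm_pow, norm_pow] at h1
  exact Nat.add_left_cancel (pow_right_injective₀ ht0 ht1.ne h1)

theorem IsNormalizedIsogeny.unique {π : K} (hπ : P.v π = WithZero.exp (-1))
    {φ ψ : Polynomial (P.CInf F)} (hφ : Λ.IsNormalizedIsogeny Λ' φ) (hψ : Λ.IsNormalizedIsogeny Λ' ψ) :
    φ = ψ := by
  refine Polynomial.eq_of_infinite_eval_eq _ _ ((infinite_range_exp hπ Λ).mono ?_)
  rintro _ ⟨z, rfl⟩
  exact (hφ.exp_eq z).symm.trans (hψ.exp_eq z)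

theorem index_eq_natCard :
    Λ.index Λ' = Nat.card (Λ'.carrier ⧸ Λ.carrier.submoduleOf Λ'.carrier) := rfl

theorem cosetFinset_congr {u w : P.CInf F} (h : u - w ∈ Λ.carrier) (N : ℚ) :
    Λ.cosetFinset u N = Λ.cosetFinset w N := by
  ext z
  rw [mem_cosetFinset, mem_cosetFinset]
  refine and_congr_left fun _ => ⟨fun hz => ?_, fun hz => ?_⟩
  · rw [← sub_add_sub_cancel z u w]; exact add_mem hz h
  · rw [← sub_sub_sub_cancel_right z u w]; exact sub_mem hz h

variable (Λ Λ') in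
/-- The group of classes of a lattice modulo a sublattice. -/
abbrev Classes : Type _ := Λ'.carrier ⧸ Λ.carrier.submoduleOf Λ'.carrier

/-- A representative of a class of a lattice modulo a sublattice. -/
def Classes.rep (x : Classes Λ Λ') : P.CInf F := (x.out : Λ'.carrier)

theorem Classes.rep_mem (x : Classes Λ Λ') : x.rep ∈ Λ'.carrier := x.out.2

theorem Classes.mk_eq_iff (x : Classes Λ Λ') {z : P.CInf F} (hz : z ∈ Λ'.carrier) :
    Submodule.Quotient.mk ⟨z, hz⟩ = x ↔ z - x.rep ∈ Λ.carrier := by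
  have h : Submodule.Quotient.mk (p := Λ.carrier.submoduleOf Λ'.carrier) x.out = x := Quotient.out_eq x
  conv_lhs => rw [← h]
  rw [Submodule.Quotient.eq]
  rfl

theorem Classes.eq_iff {x y : Classes Λ Λ'} : x = y ↔ x.rep - y.rep ∈ Λ.carrier := by
  rw [← y.mk_eq_iff x.rep_mem]
  have h : Submodule.Quotient.mk (p := Λ.carrier.submoduleOf Λ'.carrier) x.out = x := Quotient.out_eq x
  exact ⟨fun hxy => h.trans hxy, fun hxy => h.symm.trans hxy⟩

theorem Classes.eq_zero_iff {x : Classes Λ Λ'} : x = 0 ↔ x.rep ∈ Λ.carrier := by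
  have h := (0 : Classes Λ Λ').mk_eq_iff (zero_mem Λ'.carrier)
  have h0 : (0 : Classes Λ Λ').rep ∈ Λ.carrier := by
    rw [← neg_mem_iff, ← zero_sub]
    exact h.1 rfl
  rw [Classes.eq_iff]
  exact ⟨fun hx => by simpa using add_mem hx h0, fun hx => sub_mem hx h0⟩

section
variable [Fintype (Classes Λ Λ')] (hle : Λ.carrier ≤ Λ'.carrier)
include hle

theorem cosetFinset_pair [DecidableEq (P.CInf F)] (N : ℚ) : Λ'.cosetFinset 0 N =
    Finset.univ.biUnion fun x : Classes Λ Λ' => Λ.cosetFinset x.rep N := by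
  ext z
  rw [Finset.mem_biUnion, mem_cosetFinset, sub_zero]
  simp only [mem_cosetFinset]
  constructor
  · rintro ⟨h1, h2⟩
    exact ⟨Submodule.Quotient.mk ⟨z, h1⟩, Finset.mem_univ _, (Classes.mk_eq_iff _ h1).1 rfl, h2⟩
  · rintro ⟨x, -, h1, h2⟩
    refine ⟨?_, h2⟩
    rw [← sub_add_cancel z x.rep]
    exact add_mem (hle h1) x.rep_mem

omit [Fintype (Classes Λ Λ')] hle in
theorem pairwiseDisjoint_cosetFinset (s : Set (Classes Λ Λ')) (N : ℚ) :
    s.PairwiseDisjoint fun x : Classes Λ Λ' => Λ.cosetFinset x.rep N := by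
  intro x _ y _ hxy
  refine Finset.disjoint_left.2 fun z hz hz' => hxy ?_
  rw [mem_cosetFinset] at hz hz'
  rw [Classes.eq_iff, ← sub_sub_sub_cancel_left]
  exact sub_mem hz'.1 hz.1

theorem prod_cosetFinset_pair {M : Type*} [CommMonoid M] (N : ℚ) (f : P.CInf F → M) :
    ∏ z ∈ Λ'.cosetFinset 0 N, f z = ∏ x : Classes Λ Λ', ∏ z ∈ Λ.cosetFinset x.rep N, f z := by
  classical
  rw [cosetFinset_pair hle, Finset.prod_biUnion (pairwiseDisjoint_cosetFinset _ N)]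

theorem Z_pair : Λ'.Z 0 = ∑ x : Classes Λ Λ', Λ.Z x.rep := by
  classical
  ext y
  have h : Λ'.truncZ 0 y = ∑ x : Classes Λ Λ', Λ.truncZ x.rep y := by
    rw [truncZ, cosetFinset_pair hle, Finset.sum_biUnion (pairwiseDisjoint_cosetFinset _ y)]
    rfl
  have h1 := DFunLike.congr_fun h y
  rw [truncZ_apply, if_pos le_rfl, Finsupp.finsetSum_apply] at h1
  rw [h1, HahnSeries.coeff_sum]
  exact Finset.sum_congr rfl fun x _ => by rw [truncZ_apply, if_pos le_rfl]

omit [Fintype (Classes Λ Λ')] hle in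
theorem Z_congr {u w : P.CInf F} (h : u - w ∈ Λ.carrier) : Λ.Z u = Λ.Z w := by
  ext y
  have h1 := truncZ_apply (Λ := Λ) u y y
  have h2 := truncZ_apply (Λ := Λ) w y y
  rw [if_pos le_rfl] at h1 h2
  rw [← h1, ← h2, truncZ, truncZ, cosetFinset_congr h]

variable [DecidableEq (Classes Λ Λ')]

theorem ZDeriv_pair : Λ'.ZDeriv 0 = Λ.ZDeriv 0 +
    ∑ x ∈ Finset.univ.erase (0 : Classes Λ Λ'), Λ.ZDeriv x.rep := by
  have h0 : Λ.ZDeriv (0 : Classes Λ Λ').rep = Λ.ZDeriv 0 := by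
    have : Λ.Z (0 : Classes Λ Λ').rep = Λ.Z 0 :=
      Z_congr (by rw [sub_zero]; exact Classes.eq_zero_iff.1 rfl)
    rw [ZDeriv, ZDeriv, this]
  rw [← h0, Finset.add_sum_erase Finset.univ (fun x : Classes Λ Λ' => Λ.ZDeriv x.rep)
    (Finset.mem_univ 0)]
  apply ZDeriv_eq
  rw [Z_pair hle]
  exact IsRationalWithDerivAtOne.sum _ fun x _ => isRational_ZDeriv (exists_isRational_Z _)

theorem prod_cosetFinset_pair_erase {M : Type*} [CommMonoid M] (N : ℚ) (f : P.CInf F → M) :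
    ∏ z ∈ Λ'.cosetFinset 0 N, f z = (∏ z ∈ Λ.cosetFinset 0 N, f z) *
      ∏ x ∈ Finset.univ.erase (0 : Classes Λ Λ'), ∏ z ∈ Λ.cosetFinset x.rep N, f z := by
  rw [prod_cosetFinset_pair hle, ← Finset.mul_prod_erase _ _ (Finset.mem_univ (0 : Classes Λ Λ')),
    cosetFinset_congr (u := (0 : Classes Λ Λ').rep) (w := 0)
      (by rw [sub_zero]; exact Classes.eq_zero_iff.1 rfl)]

omit [Fintype (Classes Λ Λ')] [DecidableEq (Classes Λ Λ')] hle in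
theorem rep_notMem {x : Classes Λ Λ'} (hx : x ≠ 0) : x.rep ∉ Λ.carrier :=
  fun h => hx (Classes.eq_zero_iff.2 h)

/-- For such `N` the ball of `Λ'` is the disjoint union of the translates of the ball of `Λ` by the
representatives. Additivity turns the factor of a class into `ballPoly z - ballPoly x.rep`, and
normalizing divides it by `ballPoly x.rep`. -/
theorem partialExp_pair {N : ℚ} (hN : ∀ x : Classes Λ Λ', ‖x.rep‖ ≤ (Nat.card F : ℝ) ^ (N : ℝ))
    (z : P.CInf F) : Λ'.partialExp N z = Λ.partialExp N z *
      ∏ x ∈ Finset.univ.erase (0 : Classes Λ Λ'),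
        (Λ.partialExp N z / Λ.partialExp N x.rep - 1) := by
  have h1 : Λ'.ballPoly N z = Λ.ballPoly N z *
      ∏ x ∈ Finset.univ.erase (0 : Classes Λ Λ'), (Λ.ballPoly N z - Λ.ballPoly N x.rep) := by
    rw [ballPoly, prod_ball N fun v => z - v, prod_cosetFinset_pair_erase hle, ← mul_assoc,
      ← prod_ball N fun v => z - v]
    refine congrArg _ (Finset.prod_congr rfl fun x hx => ?_)
    rw [← ballPoly_sub, ballPoly, prod_coset (rep_notMem (Finset.ne_of_mem_erase hx)) (hN x)]
    exact Finset.prod_congr rfl fun v _ => by ring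
  have h2 : ∏ l ∈ Λ'.cosetFinset 0 N, l = (∏ l ∈ Λ.cosetFinset 0 N, l) *
      ∏ x ∈ Finset.univ.erase (0 : Classes Λ Λ'), Λ.ballPoly N x.rep := by
    rw [prod_cosetFinset_pair_erase hle N fun l => l]
    refine congrArg _ (Finset.prod_congr rfl fun x hx => ?_)
    rw [ballPoly_eq_prod_add, prod_coset (rep_notMem (Finset.ne_of_mem_erase hx)) (hN x) fun z => z]
  rw [partialExp_eq_div, h1, h2, mul_div_mul_comm, ← Finset.prod_div_distrib, ← partialExp_eq_div]
  refine congrArg _ (Finset.prod_congr rfl fun x hx => ?_)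
  have h3 := ballPoly_ne_zero (rep_notMem (Finset.ne_of_mem_erase hx)) N
  have h4 := prod_cosetFinset_ne_zero (Λ := Λ) 0 N
  rw [partialExp_eq_div, partialExp_eq_div, div_div_div_cancel_right₀ h4, sub_div, div_self h3]

omit [DecidableEq (Classes Λ Λ')] hle in
variable (Λ Λ') in
theorem exists_rep_bound : ∃ N : ℚ, ∀ x : Classes Λ Λ', ‖x.rep‖ ≤ (Nat.card F : ℝ) ^ (N : ℝ) := by
  obtain ⟨R, hR⟩ := (Set.finite_range fun x : Classes Λ Λ' => ‖x.rep‖).bddAbove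
  obtain ⟨N, hN⟩ := exists_rat_le_rpow F R
  exact ⟨N, fun x => (hR ⟨x, rfl⟩).trans hN⟩

variable {π : K} (hπ : P.v π = WithZero.exp (-1)) (ϖ : P.RootSystem F π)
include hπ

theorem U_pair : Λ'.U ϖ 0 = Λ.U ϖ 0 *
    ∏ x ∈ Finset.univ.erase (0 : Classes Λ Λ'), Λ.U ϖ x.rep := by
  refine tendsto_nhds_unique (tendsto_partialU ϖ hπ 0) ?_
  refine ((tendsto_partialU ϖ hπ 0).mul (tendsto_finsetProd _ fun x _ =>
    tendsto_partialU ϖ hπ x.rep)).congr fun N => ?_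
  simp only [partialU_eq]
  rw [prod_cosetFinset_pair_erase hle]

include ϖ

theorem exp_pair (z : P.CInf F) : Λ'.exp z = Λ.exp z *
    ∏ x ∈ Finset.univ.erase (0 : Classes Λ Λ'), (Λ.exp z / Λ.exp x.rep - 1) := by
  refine tendsto_nhds_unique (tendsto_partialExp z) ?_
  refine ((tendsto_partialExp z).mul (tendsto_finsetProd _ fun x hx =>
    ((tendsto_partialExp z).div (tendsto_partialExp x.rep) (exp_ne_zero hπ
      (rep_notMem (Finset.ne_of_mem_erase hx)) ϖ)).sub_const 1)).congr' ?_
  obtain ⟨M, hM⟩ := exists_rep_bound Λ Λ'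
  filter_upwards [Filter.eventually_ge_atTop M] with N hN
  exact (partialExp_pair hle (fun x => (hM x).trans (rpow_natCard_mono hN)) z).symm

omit [DecidableEq (Classes Λ Λ')] hle in
/-- The polynomial whose zeros are the values of `exp` at the elements of the larger lattice. -/
theorem isLinearized_prod_X_sub_C_exp :
    IsLinearized F (∏ x : Classes Λ Λ', (Polynomial.X - Polynomial.C (Λ.exp x.rep))) := by
  -- The kernel of `exp` is exactly `Λ`, so the classes are in bijection with the finite `F`-space
  -- `exp(Λ')`, to which the statement on subspaces applies.
  let W : Submodule F (P.CInf F) := (Λ'.carrier.restrictScalars F).map Λ.expLinear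
  have hW : ∀ x : Classes Λ Λ', Λ.exp x.rep ∈ W := fun x => ⟨x.rep, x.rep_mem, rfl⟩
  have hbij : Function.Bijective fun x : Classes Λ Λ' => (⟨Λ.exp x.rep, hW x⟩ : W) := by
    constructor
    · intro x y h
      by_contra hxy
      have h1 : Λ.exp (x.rep - y.rep) = 0 := by
        rw [← expLinear_apply, map_sub, sub_eq_zero]
        exact congrArg Subtype.val h
      exact exp_ne_zero hπ (fun h2 => hxy (Classes.eq_iff.2 h2)) ϖ h1
    · rintro ⟨_, z, hz, rfl⟩
      refine ⟨Submodule.Quotient.mk ⟨z, hz⟩, Subtype.ext ?_⟩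
      have h1 := exp_of_mem ((Classes.mk_eq_iff (Λ := Λ) _ hz).1 rfl)
      rw [← expLinear_apply, map_sub, sub_eq_zero] at h1
      exact h1.symm
  have : Fintype W := Fintype.ofBijective _ hbij
  rw [hbij.prod_comp fun w : W => Polynomial.X - Polynomial.C (w : P.CInf F)]
  exact isLinearized_prod_X_sub_C W

omit hle in
theorem prod_exp_rep_ne_zero :
    ∏ x ∈ Finset.univ.erase (0 : Classes Λ Λ'), Λ.exp x.rep ≠ 0 :=
  Finset.prod_ne_zero_iff.2 fun _ hx => exp_ne_zero hπ (rep_notMem (Finset.ne_of_mem_erase hx)) ϖ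

open Polynomial in
theorem isNormalizedIsogeny :
    Λ.IsNormalizedIsogeny Λ' (Polynomial.C (∏ x ∈ Finset.univ.erase (0 : Classes Λ Λ'), Λ.exp x.rep)⁻¹ *
      ∏ x : Classes Λ Λ', (X - Polynomial.C (Λ.exp x.rep))) := by
  have hc := prod_exp_rep_ne_zero (Λ := Λ) (Λ' := Λ') hπ ϖ
  have h0 : Λ.exp (0 : Classes Λ Λ').rep = 0 := exp_of_mem (Classes.eq_zero_iff.1 rfl)
  have hsplit : ∏ x : Classes Λ Λ', (X - Polynomial.C (Λ.exp x.rep)) =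
      X * ∏ x ∈ Finset.univ.erase (0 : Classes Λ Λ'), (X - Polynomial.C (Λ.exp x.rep)) := by
    rw [← Finset.mul_prod_erase _ _ (Finset.mem_univ (0 : Classes Λ Λ')), h0, map_zero, sub_zero]
  constructor
  · intro i hi
    rw [coeff_C_mul] at hi
    exact isLinearized_prod_X_sub_C_exp hπ ϖ i (right_ne_zero_of_mul hi)
  · rw [coeff_C_mul, hsplit, coeff_X_mul, coeff_zero_eq_eval_zero, eval_prod]
    -- The linear coefficient comes out as the product of `-exp x.rep`. Negation permutes the
    -- nonzero classes, and `exp` is odd and `Λ`-periodic, so the signs can be dropped in every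
    -- characteristic.
    have hneg : ∏ x ∈ Finset.univ.erase (0 : Classes Λ Λ'), eval 0 (X - Polynomial.C (Λ.exp x.rep)) =
        ∏ x ∈ Finset.univ.erase (0 : Classes Λ Λ'), Λ.exp x.rep := by
      refine Finset.prod_nbij' (fun x => -x) (fun x => -x) (by simp) (by simp) (by simp) (by simp) ?_
      intro x _
      have h1 : (-x).rep + x.rep ∈ Λ.carrier := by
        have h2 : Submodule.Quotient.mk ⟨-x.rep, neg_mem x.rep_mem⟩ = -x :=
          congrArg Neg.neg ((x.mk_eq_iff x.rep_mem).2 (by rw [sub_self]; exact zero_mem _))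
        have h3 := neg_mem ((Classes.mk_eq_iff (-x) (neg_mem x.rep_mem)).1 h2)
        rwa [neg_sub, sub_neg_eq_add] at h3
      have h2 := exp_of_mem h1
      rw [← expLinear_apply, map_add] at h2
      rw [eval_sub, eval_X, eval_C, zero_sub]
      exact (eq_neg_of_add_eq_zero_left h2).symm
    rw [hneg, inv_mul_cancel₀ hc]
  · rw [natDegree_C_mul (inv_ne_zero hc), natDegree_prod_of_monic _ _ fun x _ => monic_X_sub_C _,
      index_eq_natCard, Nat.card_eq_fintype_card]
    simp
  · intro z
    rw [exp_pair hle hπ ϖ z, eval_mul, eval_C, hsplit, eval_mul, eval_X, eval_prod, mul_left_comm,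
      ← Finset.prod_inv_distrib, ← Finset.prod_mul_distrib]
    refine congrArg _ (Finset.prod_congr rfl fun x hx => ?_)
    have h3 := exp_ne_zero hπ (rep_notMem (Finset.ne_of_mem_erase hx)) ϖ
    rw [eval_sub, eval_X, eval_C]
    field_simp

theorem discriminant_eq_inv_prod :
    Λ.discriminant Λ' = (∏ x ∈ Finset.univ.erase (0 : Classes Λ Λ'), Λ.exp x.rep)⁻¹ := by
  have h : ∃ φ, Λ.IsNormalizedIsogeny Λ' φ := ⟨_, isNormalizedIsogeny hle hπ ϖ⟩
  rw [discriminant, dif_pos h, h.choose_spec.unique hπ (isNormalizedIsogeny hle hπ ϖ),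
    Polynomial.leadingCoeff_mul, Polynomial.leadingCoeff_C,
    (Polynomial.monic_prod_of_monic _ _ fun x _ => Polynomial.monic_X_sub_C _).leadingCoeff, mul_one]

omit hle hπ in
theorem pairEps_eq : Λ.pairEps Λ' ϖ =
    (∏ x ∈ Finset.univ.erase (0 : Classes Λ Λ'), Λ.eps ϖ x.rep)⁻¹ := by
  rw [pairEps, ← finprod_mem_finset_eq_prod]
  congr 1
  refine finprod_congr fun x => ?_
  simp only [Finset.mem_erase, Finset.mem_univ, and_true]
  rfl

/-- The product formula for the discriminant of a lattice pair. -/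
theorem discriminant_eq : Λ.discriminant Λ' =
    ϖ.rpow ((P.degree F : ℚ)⁻¹ * (Λ'.ZDeriv 0 - (Λ.index Λ' : ℚ) * Λ.ZDeriv 0)) *
      Λ.pairEps Λ' ϖ * Λ.U ϖ 0 ^ Λ.index Λ' * (Λ'.U ϖ 0)⁻¹ := by
  -- There are only index minus one nonzero classes; the missing copies of `Z_Λ` and `U_Λ` come from
  -- the zero class in the decomposition of `Λ'`.
  have hcard : (Finset.univ.erase (0 : Classes Λ Λ')).card + 1 = Λ.index Λ' := by
    rw [Finset.card_erase_add_one (Finset.mem_univ _), Finset.card_univ, index_eq_natCard,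
      Nat.card_eq_fintype_card]
  rw [discriminant_eq_inv_prod hle hπ ϖ, Finset.prod_congr rfl fun x hx =>
    exp_eq ϖ hπ (rep_notMem (Finset.ne_of_mem_erase hx)), Finset.prod_mul_distrib,
    Finset.prod_mul_distrib, Finset.prod_mul_distrib, Finset.prod_const, ← ϖ.rpow_sum hπ,
    Finset.sum_neg_distrib, ← Finset.mul_sum, Finset.sum_sub_distrib, Finset.sum_const, ϖ.rpow_neg hπ,
    pairEps_eq, U_pair hle hπ ϖ, ZDeriv_pair hle, ← hcard]
  set n := (Finset.univ.erase (0 : Classes Λ Λ')).card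
  have hexp : Λ.ZDeriv 0 + ∑ x ∈ Finset.univ.erase (0 : Classes Λ Λ'), Λ.ZDeriv x.rep -
      ((n + 1 : ℕ) : ℚ) * Λ.ZDeriv 0 =
      ∑ x ∈ Finset.univ.erase (0 : Classes Λ Λ'), Λ.ZDeriv x.rep - n • Λ.ZDeriv 0 := by
    rw [nsmul_eq_mul]; push_cast; ring
  rw [hexp, mul_inv, mul_inv, mul_inv, inv_inv, inv_pow, inv_inv, mul_inv, pow_succ]
  have hU := U_ne_zero (Λ := Λ) ϖ hπ 0
  field_simp

end

end Lattice
end Place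
end

/-! ### The main theorem -/

theorem mainTheorem1 (F K : Type*) [Field F] [Finite F] [Field K] [Algebra F K]
    [IsGlobalFunctionField F K] (P : Place K)
    (π : K) (hπ : P.v π = WithZero.exp (-1)) (ϖ : P.RootSystem F π)
    (r : ℕ) (hr : 1 ≤ r) (Λ Λ' : P.Lattice F) (hΛ : Λ.rank = r) (hΛ' : Λ'.rank = r)
    (hle : Λ.carrier ≤ Λ'.carrier) :
    -- the infinite products and the `Z`-functions of both lattices are meaningful
    (∀ M : P.Lattice F, M = Λ ∨ M = Λ' →
      (∀ z : P.CInf F,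
        Multipliable fun l : {l : P.CInf F // l ∈ M.carrier ∧ l ≠ 0} => 1 - z / (l : P.CInf F)) ∧
      ∀ u ∈ M.kSpan,
        Place.IsRationalWithDerivAtOne (M.Z u) (M.ZDeriv u) ∧
        Filter.Tendsto (M.partialU ϖ u) Filter.atTop (nhds (M.U ϖ u)) ∧
        ‖M.U ϖ u - 1‖ < 1) ∧
    -- the division points
    (∀ u ∈ Λ.kSpan, u ∉ Λ.carrier →
      (∀ᶠ N : ℚ in Filter.atTop, Λ.partialEps ϖ u N = Λ.eps ϖ u) ∧
      (∃ n : ℕ, 0 < n ∧ Λ.eps ϖ u ^ n = 1) ∧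
      Λ.exp u =
        ϖ.rpow (-((P.degree F : ℚ)⁻¹ * (Λ.ZDeriv u - Λ.ZDeriv 0))) *
          Λ.eps ϖ u * Λ.U ϖ u * (Λ.U ϖ 0)⁻¹) ∧
    -- the discriminant of the lattice pair
    (∃! φ : Polynomial (P.CInf F), Λ.IsNormalizedIsogeny Λ' φ) ∧
    (∃ n : ℕ, 0 < n ∧ Λ.pairEps Λ' ϖ ^ n = 1) ∧
    Λ.discriminant Λ' =
      ϖ.rpow ((P.degree F : ℚ)⁻¹ * (Λ'.ZDeriv 0 - (Λ.index Λ' : ℚ) * Λ.ZDeriv 0)) *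
        Λ.pairEps Λ' ϖ * Λ.U ϖ 0 ^ Λ.index Λ' * (Λ'.U ϖ 0)⁻¹ := by
  classical
  have hfin : Finite (Place.Lattice.Classes Λ Λ') :=
    Place.Lattice.finite_quotient hle (hΛ.trans hΛ'.symm)
  have : Fintype (Place.Lattice.Classes Λ Λ') := Fintype.ofFinite _
  refine ⟨fun M _ => ⟨M.multipliable_exp, fun u _ =>
      ⟨Place.Lattice.isRational_ZDeriv (Place.Lattice.exists_isRational_Z u),
        Place.Lattice.tendsto_partialU ϖ hπ u, Place.Lattice.norm_U_sub_one_lt ϖ hπ u⟩⟩,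
    fun u _ hu => ⟨Place.Lattice.eventually_partialEps_eq ϖ hπ u,
      isOfFinOrder_iff_pow_eq_one.1 (Place.Lattice.isOfFinOrder_eps ϖ hπ u),
      Place.Lattice.exp_eq ϖ hπ hu⟩,
    ⟨_, Place.Lattice.isNormalizedIsogeny hle hπ ϖ, fun ψ hψ =>
      hψ.unique hπ (Place.Lattice.isNormalizedIsogeny hle hπ ϖ)⟩, ?_,
    Place.Lattice.discriminant_eq hle hπ ϖ⟩
  rw [Place.Lattice.pairEps_eq]
  exact isOfFinOrder_iff_pow_eq_one.1 (isOfFinOrder_inv₀ (isOfFinOrder_prod _ _ fun x _ =>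
    Place.Lattice.isOfFinOrder_eps ϖ hπ _))
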